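/- Let $\Omega\subset\mathbb R^2$ be a simply connected region (a compact, connected, simply connected polygonal set) that is exactly covered by a finite conforming triangular grid $\mathcal T$. For integers $k\ge 0$, $r_1\ge -1$, $r_2\ge 0$ let $\mathcal P_k^{(r_1,r_2)}(\mathcal T)$ denote the space of all functions $u$ whose restriction to each triangle $K\in\mathcal T$ is a polynomial of degree at most $k$, which are continuous on $\Omega$ if $r_1\ge 0$ (if $r_1=-1$, $u$ is only an element of $L^2(\Omega)$), and for which each of the following quantities takes the same value when computed from any of the triangles containing the vertex or edge in question: 1. at each vertex $x$ of $\mathcal T$, the derivatives $\dfrac{\partial^{i+j}u}{\partial x^i\partial y^j}(x)$ with $i+j\le r_2$; 2. on each edge $e=[a,b]$ of $\mathcal T$ with unit normal $n$ and barycentric coordinates $\lambda_a,\lambda_b$, the moments $\dfrac1{|e|}\displaystyle\int_e \frac{\partial^\theta u}{\partial n^\theta}\,\lambda_a^{i}\lambda_b^{j}\,ds$ with $0\le\theta\le r_1$, $i+j=k-\theta$ and $i,j\ge r_2-\theta+1$. Let $r_1,r_2,k$ be integers with $r_1\ge 1$, $r_2\ge 2r_1$ and $k\ge 2r_2+1$,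 and put $\boldsymbol r=(r_1,r_2)$, $\boldsymbol r'=(r_1-1,r_2-1)$, $\boldsymbol r''=(r_1-2,r_2-2)$. With $\operatorname{curl}u=(\partial_y u,-\partial_x u)$ and $\operatorname{div}v=\partial_xv_1+\partial_yv_2$, taken on each triangle, the sequence $$\mathbb R\hookrightarrow\mathcal P_k^{(\boldsymbol r)}(\mathcal T)\xrightarrow{\ \operatorname{curl}\ }\big[\mathcal P_{k-1}^{(\boldsymbol r')}(\mathcal T)\big]^2\xrightarrow{\ \operatorname{div}\ }\mathcal P_{k-2}^{(\boldsymbol r'')}(\mathcal T)\longrightarrow 0$$ is well defined and exact, the first map (inclusion of the constants) being injective. -/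

import Mathlib

namespace SmoothFE

noncomputable section

/-- The Euclidean plane. -/
abbrev Plane := EuclideanSpace ℝ (Fin 2)

/-- Real polynomials in the two coordinates of the plane. -/
abbrev Poly := MvPolynomial (Fin 2) ℝ

/-- Value of a polynomial at a point of the plane. -/
def value (x : Plane) (p : Poly) : ℝ := MvPolynomial.eval (fun i => x i) p

/-- `T` is a (conforming, finite) triangular grid of the region `Ω`: the geometric simplicial
complex `T` has finitely many faces, each of its vertices and edges belongs to a triangle of `T`
(the faces of a simplicial complex in the plane have at most three vertices), and the faces
cover exactly `Ω`. -/
structure IsTriangularGrid (T : Geometry.SimplicialComplex ℝ Plane) (Ω : Set Plane) : Prop where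
  finite : T.faces.Finite
  pure : ∀ s ∈ T.faces, ∃ t ∈ T.faces, t.card = 3 ∧ s ⊆ t
  cover : T.space = Ω

/-- The triangles (elements) of a grid, each given by the set of its three vertices. -/
def Triangle (T : Geometry.SimplicialComplex ℝ Plane) : Type :=
  {K : Finset Plane // K ∈ T.faces ∧ K.card = 3}

/-- Piecewise polynomial functions with respect to `T`: one polynomial on each triangle.
As triangles have non-empty interior, such a family is the same thing as a piecewise polynomial
element of `L²`; when the polynomials agree on common vertices and edges it is the same thing as
a continuous piecewise polynomial function on the region. -/
abbrev Broken (T : Geometry.SimplicialComplex ℝ Plane) : Type := Triangle T → Poly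

/-- The directional derivative `∂/∂n = n₀ ∂/∂x + n₁ ∂/∂y`. -/
def dirDeriv (n : Plane) (p : Poly) : Poly :=
  n 0 • MvPolynomial.pderiv 0 p + n 1 • MvPolynomial.pderiv 1 p

/-- The degree of freedom `∂^{i+j} p / ∂x^i ∂y^j (x)` at a vertex `x`. -/
def vertexDOF (x : Plane) (i j : ℕ) (p : Poly) : ℝ :=
  value x ((MvPolynomial.pderiv 0)^[i] ((MvPolynomial.pderiv 1)^[j] p))

/-- The degree of freedom `|e|⁻¹ ∫_e (∂^θ p / ∂n^θ) λ_a^i λ_b^j ds` on the edge `e` with end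
points `a` and `b`. In the constant speed parametrization `t ↦ (1 - t) a + t b` of the edge, the
normalized arc length is `dt`, and the barycentric coordinates are `λ_a = 1 - t`, `λ_b = t`. -/
def edgeDOF (a b n : Plane) (θ i j : ℕ) (p : Poly) : ℝ :=
  ∫ t in (0 : ℝ)..1,
    value (AffineMap.lineMap a b t) ((dirDeriv n)^[θ] p) * ((1 - t) ^ i * t ^ j)

theorem value_add (x : Plane) (p q : Poly) : value x (p + q) = value x p + value x q := by
  simp [value]

theorem value_smul (x : Plane) (c : ℝ) (p : Poly) : value x (c • p) = c * value x p := by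
  simp [value, MvPolynomial.smul_eval]

theorem dirDeriv_add (n : Plane) (p q : Poly) :
    dirDeriv n (p + q) = dirDeriv n p + dirDeriv n q := by
  simp only [dirDeriv, map_add, smul_add]; abel

theorem dirDeriv_smul (n : Plane) (c : ℝ) (p : Poly) :
    dirDeriv n (c • p) = c • dirDeriv n p := by
  simp only [dirDeriv, Derivation.map_smul, smul_add, smul_comm c]

theorem iterate_add_of {D : Poly → Poly} (h : ∀ p q, D (p + q) = D p + D q) (m : ℕ) (p q : Poly) :
    D^[m] (p + q) = D^[m] p + D^[m] q := by
  induction m generalizing p q with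
  | zero => rfl
  | succ m ih => simp only [Function.iterate_succ, Function.comp_apply, h, ih]

theorem iterate_smul_of {D : Poly → Poly} (h : ∀ (c : ℝ) p, D (c • p) = c • D p) (m : ℕ) (c : ℝ)
    (p : Poly) : D^[m] (c • p) = c • D^[m] p := by
  induction m generalizing p with
  | zero => rfl
  | succ m ih => simp only [Function.iterate_succ, Function.comp_apply, h, ih]

theorem vertexDOF_add (x : Plane) (i j : ℕ) (p q : Poly) :
    vertexDOF x i j (p + q) = vertexDOF x i j p + vertexDOF x i j q := by
  simp only [vertexDOF, iterate_add_of (map_add _), value_add]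

theorem vertexDOF_smul (x : Plane) (i j : ℕ) (c : ℝ) (p : Poly) :
    vertexDOF x i j (c • p) = c * vertexDOF x i j p := by
  simp only [vertexDOF, iterate_smul_of (Derivation.map_smul _), value_smul]

theorem continuous_value_lineMap (a b : Plane) (p : Poly) :
    Continuous fun t : ℝ => value (AffineMap.lineMap a b t) p := by
  have h : Continuous fun t : ℝ => fun i : Fin 2 => (AffineMap.lineMap a b t : Plane) i := by
    refine continuous_pi fun i => ?_
    simp only [AffineMap.lineMap_apply, vsub_eq_sub, vadd_eq_add, PiLp.add_apply, PiLp.smul_apply]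
    fun_prop
  exact (MvPolynomial.continuous_eval p).comp h

theorem edgeDOF_add (a b n : Plane) (θ i j : ℕ) (p q : Poly) :
    edgeDOF a b n θ i j (p + q) = edgeDOF a b n θ i j p + edgeDOF a b n θ i j q := by
  have hc : ∀ p : Poly, IntervalIntegrable (fun t : ℝ =>
      value (AffineMap.lineMap a b t) ((dirDeriv n)^[θ] p) * ((1 - t) ^ i * t ^ j))
      MeasureTheory.volume 0 1 := fun p =>
    ((continuous_value_lineMap a b _).mul (by fun_prop)).intervalIntegrable 0 1
  unfold edgeDOF
  rw [← intervalIntegral.integral_add (hc p) (hc q)]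
  simp only [iterate_add_of (dirDeriv_add n), value_add, add_mul]

theorem edgeDOF_smul (a b n : Plane) (θ i j : ℕ) (c : ℝ) (p : Poly) :
    edgeDOF a b n θ i j (c • p) = c * edgeDOF a b n θ i j p := by
  simp only [edgeDOF, iterate_smul_of (dirDeriv_smul n), value_smul, mul_assoc,
    intervalIntegral.integral_const_mul]

/-- The global finite element space `𝒫_k^{(r₁, r₂)}(T)`: the piecewise polynomials of degree at
most `k` that are continuous on the region (for `r₁ ≥ 0`; for `r₁ = -1` this requirement is
dropped and the space is a subspace of `L²` only) and for which each degree of freedom at a vertex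
or on an edge takes the same value from all triangles that contain this vertex or edge.
The degrees of freedom are the derivatives of order at most `r₂` at the vertices, and on every edge
the moments of the normal derivatives of order `θ ≤ r₁` against `λ_a^i λ_b^j` with `i + j = k - θ`
and `i, j ≥ r₂ - θ + 1`. -/
def space (T : Geometry.SimplicialComplex ℝ Plane) (k : ℕ) (r₁ r₂ : ℤ) :
    Submodule ℝ (Broken T) where
  carrier := {u |
    (∀ K, u K ∈ MvPolynomial.restrictTotalDegree (Fin 2) ℝ k) ∧
    (0 ≤ r₁ → ∃ f : Plane → ℝ, ContinuousOn f T.space ∧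
      ∀ K : Triangle T, ∀ x ∈ convexHull ℝ (K.1 : Set Plane), f x = value x (u K)) ∧
    (∀ (x : Plane) (K K' : Triangle T), x ∈ K.1 → x ∈ K'.1 →
      ∀ i j : ℕ, (i : ℤ) + j ≤ r₂ → vertexDOF x i j (u K) = vertexDOF x i j (u K')) ∧
    (∀ (a b : Plane) (K K' : Triangle T), a ≠ b → a ∈ K.1 → b ∈ K.1 → a ∈ K'.1 → b ∈ K'.1 →
      ∀ n : Plane, ‖n‖ = 1 → inner ℝ n (b - a) = 0 →
      ∀ θ i j : ℕ, (θ : ℤ) ≤ r₁ → i + j + θ = k → r₂ + 1 ≤ (i : ℤ) + θ → r₂ + 1 ≤ (j : ℤ) + θ →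
        edgeDOF a b n θ i j (u K) = edgeDOF a b n θ i j (u K'))}
  zero_mem' := by
    refine ⟨fun K => Submodule.zero_mem _,
      fun _ => ⟨fun _ => 0, continuousOn_const, fun K x _ => by simp [value]⟩, ?_, ?_⟩
    · intro x K K' _ _ i j _
      rfl
    · intro a b K K' _ _ _ _ _ n _ _ θ i j _ _ _ _
      rfl
  add_mem' := by
    rintro u v ⟨hu1, hu2, hu3, hu4⟩ ⟨hv1, hv2, hv3, hv4⟩
    refine ⟨fun K => Submodule.add_mem _ (hu1 K) (hv1 K), fun h => ?_, ?_, ?_⟩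
    · obtain ⟨f, hf, hfu⟩ := hu2 h
      obtain ⟨g, hg, hgv⟩ := hv2 h
      exact ⟨fun x => f x + g x, hf.add hg, fun K x hx => by
        simp only [hfu K x hx, hgv K x hx, Pi.add_apply, value_add]⟩
    · intro x K K' h1 h2 i j h3
      simp only [Pi.add_apply, vertexDOF_add, hu3 x K K' h1 h2 i j h3, hv3 x K K' h1 h2 i j h3]
    · intro a b K K' h1 h2 h3 h4 h5 n h6 h7 θ i j h8 h9 h10 h11
      simp only [Pi.add_apply, edgeDOF_add, hu4 a b K K' h1 h2 h3 h4 h5 n h6 h7 θ i j h8 h9 h10 h11,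
        hv4 a b K K' h1 h2 h3 h4 h5 n h6 h7 θ i j h8 h9 h10 h11]
  smul_mem' := by
    rintro c u ⟨hu1, hu2, hu3, hu4⟩
    refine ⟨fun K => Submodule.smul_mem _ c (hu1 K), fun h => ?_, ?_, ?_⟩
    · obtain ⟨f, hf, hfu⟩ := hu2 h
      exact ⟨fun x => c * f x, continuousOn_const.mul hf, fun K x hx => by
        simp only [hfu K x hx, Pi.smul_apply, value_smul]⟩
    · intro x K K' h1 h2 i j h3
      simp only [Pi.smul_apply, vertexDOF_smul, hu3 x K K' h1 h2 i j h3]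
    · intro a b K K' h1 h2 h3 h4 h5 n h6 h7 θ i j h8 h9 h10 h11
      simp only [Pi.smul_apply, edgeDOF_smul, hu4 a b K K' h1 h2 h3 h4 h5 n h6 h7 θ i j h8 h9 h10 h11]

/-- The inclusion of the constants: `c` is sent to the constant function `c`. -/
def const (T : Geometry.SimplicialComplex ℝ Plane) : ℝ →ₗ[ℝ] Broken T where
  toFun c := fun _ => MvPolynomial.C c
  map_add' c d := by ext; simp
  map_smul' c d := by ext; simp [MvPolynomial.smul_eq_C_mul]

/-- The curl of a scalar function, `curl u = (∂u/∂y, -∂u/∂x)`, taken on each triangle. -/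
def curl (T : Geometry.SimplicialComplex ℝ Plane) : Broken T →ₗ[ℝ] Broken T × Broken T where
  toFun u := (fun K => MvPolynomial.pderiv 1 (u K), fun K => -MvPolynomial.pderiv 0 (u K))
  map_add' u v := by
    refine Prod.ext ?_ ?_ <;> funext K
    · exact map_add _ _ _
    · simp [add_comm]
  map_smul' c u := by
    refine Prod.ext ?_ ?_ <;> funext K <;> simp [Derivation.map_smul]

/-- The divergence of a vector field, `div v = ∂v₁/∂x + ∂v₂/∂y`, taken on each triangle. -/
def div (T : Geometry.SimplicialComplex ℝ Plane) : Broken T × Broken T →ₗ[ℝ] Broken T where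
  toFun v := fun K => MvPolynomial.pderiv 0 (v.1 K) + MvPolynomial.pderiv 1 (v.2 K)
  map_add' u v := by
    funext K
    simp only [Prod.fst_add, Prod.snd_add, Pi.add_apply, map_add]; abel
  map_smul' c u := by
    funext K
    simp [Derivation.map_smul]

end

end SmoothFE

namespace SmoothFE

open MvPolynomial Finset

noncomputable section

/-! ### Polynomials in two variables -/

/-! The degrees of freedom are first replaced by orders of vanishing. The `m`-th normal derivative
of a jump, restricted to an edge, is a polynomial of degree at most `k - m` that vanishes at the end
points to order `r₂ + 1 - m`. The prescribed moments are exactly those that force such a polynomial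
to be zero. So (`mem_space_iff`) the space consists of the piecewise polynomials of degree at most
`k` whose jumps vanish to order `r₂ + 1` at common vertices and to order `r₁ + 1` on common edges.
Since a derivative lowers these orders by one, the maps of the sequence are well defined.

A function with zero curl is piecewise constant, continuous and finitely valued on a connected
region, hence constant. A divergence-free field has a polynomial potential on each triangle
(`exists_curl_eq`). The gradients of these potentials are single-valued, so the potentials differ by
locally constant functions. These form a cocycle, which splits because the region is simply
connected (`exists_locallyConstant_splitting`, `exists_constants`). After constants have been added,
the jumps of the potential vanish to one order more than those of the field.

Surjectivity of the divergence is local once the fluxes through the edges are known. Given `q`, one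
chooses jets of a field at the vertices with the right divergence, and fluxes through the edges
whose sum around each triangle is the integral of `q` there. Such fluxes exist by duality: a nonzero
function on the triangles has an edge that lies in exactly one triangle of its support
(`exists_edge_of_ne_zero`), so no nonzero functional kills all the boundary sums. Each edge then
gets a field with the chosen jets and flux and with divergence `q` (`exists_edge_field`), and these
data are interpolated on each triangle (`exists_interpolation`).

The remaining error is treated in Bernstein form. With the basis `λ^α / α!`, derivatives become
differences of shifted coefficients, the order of vanishing at a vertex or an edge is read off from
which coefficients are zero, and integrals are multiples of sums of coefficients. The error has
coefficients in a box of indices, with sum zero by the divergence theorem. The difference of two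
neighbouring unit coefficients is the divergence of a one-term bubble directed along an edge, and
the box is connected under such moves, so the error is the divergence of a bubble field
(`exists_bubble`). -/

theorem mem_restrictTotalDegree_iff_coeff {n : ℕ} {p : Poly} :
    p ∈ restrictTotalDegree (Fin 2) ℝ n ↔ ∀ s : Fin 2 →₀ ℕ, coeff s p ≠ 0 → s.degree ≤ n := by
  rw [mem_restrictTotalDegree, totalDegree, Finset.sup_le_iff]
  simp only [mem_support_iff]
  rfl

theorem pderiv_mem_restrictTotalDegree {n : ℕ} {p : Poly}
    (hp : p ∈ restrictTotalDegree (Fin 2) ℝ n) (i : Fin 2) :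
    pderiv i p ∈ restrictTotalDegree (Fin 2) ℝ (n - 1) := by
  rw [mem_restrictTotalDegree_iff_coeff] at *
  intro s hs
  rw [coeff_pderiv] at hs
  have := hp _ (left_ne_zero_of_mul hs)
  simp at this
  omega

theorem mul_mem_restrictTotalDegree {m n : ℕ} {p q : Poly}
    (hp : p ∈ restrictTotalDegree (Fin 2) ℝ m) (hq : q ∈ restrictTotalDegree (Fin 2) ℝ n) :
    p * q ∈ restrictTotalDegree (Fin 2) ℝ (m + n) := by
  rw [mem_restrictTotalDegree] at *
  exact (totalDegree_mul _ _).trans (by omega)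

theorem C_mem_restrictTotalDegree (n : ℕ) (c : ℝ) :
    (C c : Poly) ∈ restrictTotalDegree (Fin 2) ℝ n := by
  rw [mem_restrictTotalDegree]
  simp

theorem X_mem_restrictTotalDegree (i : Fin 2) :
    (X i : Poly) ∈ restrictTotalDegree (Fin 2) ℝ 1 := by
  rw [mem_restrictTotalDegree, totalDegree_X]

/-- The antiderivative of a polynomial with respect to one variable. -/
def antideriv (i : Fin 2) : Poly →ₗ[ℝ] Poly :=
  (basisMonomials (Fin 2) ℝ).constr ℝ fun s =>
    monomial (s + Finsupp.single i 1) ((s i + 1 : ℝ)⁻¹)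

theorem antideriv_monomial (i : Fin 2) (s : Fin 2 →₀ ℕ) :
    antideriv i (monomial s 1) = monomial (s + Finsupp.single i 1) ((s i + 1 : ℝ)⁻¹) := by
  have := (basisMonomials (Fin 2) ℝ).constr_basis ℝ (fun s =>
    (monomial (s + Finsupp.single i 1) ((s i + 1 : ℝ)⁻¹) : Poly)) s
  simpa [antideriv] using this

theorem coeff_antideriv_ne_zero {i : Fin 2} {s : Fin 2 →₀ ℕ} {p : Poly}
    (h : coeff s (antideriv i p) ≠ 0) :
    ∃ s', coeff s' p ≠ 0 ∧ s = s' + Finsupp.single i 1 := by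
  by_contra! hc
  apply h
  rw [p.as_sum, map_sum, coeff_sum]
  refine Finset.sum_eq_zero fun t ht => ?_
  have : monomial t (coeff t p) = coeff t p • (monomial t 1 : Poly) := by
    rw [smul_monomial, smul_eq_mul, mul_one]
  rw [this, map_smul, antideriv_monomial, coeff_smul, coeff_monomial,
    if_neg fun h => hc t (mem_support_iff.1 ht) h.symm, smul_zero]

theorem antideriv_mem_restrictTotalDegree {n : ℕ} {p : Poly}
    (hp : p ∈ restrictTotalDegree (Fin 2) ℝ n) (i : Fin 2) :
    antideriv i p ∈ restrictTotalDegree (Fin 2) ℝ (n + 1) := by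
  rw [mem_restrictTotalDegree_iff_coeff] at *
  intro s hs
  obtain ⟨s', h1, rfl⟩ := coeff_antideriv_ne_zero hs
  have := hp _ h1
  simp
  omega

theorem pderiv_antideriv (i : Fin 2) (p : Poly) : pderiv i (antideriv i p) = p := by
  have : (pderiv i).toLinearMap ∘ₗ antideriv i = LinearMap.id := by
    refine (basisMonomials (Fin 2) ℝ).ext fun s => ?_
    have h : ((s i : ℝ) + 1) ≠ 0 := by positivity
    simp [antideriv_monomial, pderiv_monomial, h]
  exact LinearMap.congr_fun this p

theorem pderiv_antideriv_comm {i j : Fin 2} (hij : i ≠ j) (p : Poly) :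
    pderiv i (antideriv j p) = antideriv j (pderiv i p) := by
  have : (pderiv i).toLinearMap ∘ₗ antideriv j = antideriv j ∘ₗ (pderiv i).toLinearMap := by
    refine (basisMonomials (Fin 2) ℝ).ext fun s => ?_
    have e : ∀ t (a : ℝ), (monomial t a : Poly) = a • monomial t 1 := fun t a => by
      rw [smul_monomial, smul_eq_mul, mul_one]
    simp only [LinearMap.comp_apply, coe_basisMonomials, antideriv_monomial,
      Derivation.coeFn_coe, pderiv_monomial]
    rw [e _ (1 * _), map_smul, antideriv_monomial, smul_monomial]
    by_cases hs : s i = 0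
    · simp [hs, hij]
    · have h2 : (s + Finsupp.single j (1 : ℕ)) i = s i := by simp [hij]
      have h3 : (s - Finsupp.single i (1 : ℕ)) j = s j := by simp [hij.symm]
      have h4 : s + Finsupp.single j 1 - Finsupp.single i 1
          = s - Finsupp.single i 1 + Finsupp.single j 1 := by
        refine Finsupp.ext fun l => ?_
        rcases eq_or_ne l i with rfl | hl
        · simp [hij]
        · simp [hl.symm]
      rw [h2, h3, h4]
      simp [mul_comm]
  exact LinearMap.congr_fun this p

theorem pderiv_comm (i j : Fin 2) (p : Poly) :
    pderiv i (pderiv j p) = pderiv j (pderiv i p) := by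
  rcases eq_or_ne i j with rfl | hij
  · rfl
  · ext s
    simp only [coeff_pderiv]
    simp [hij, hij.symm, add_right_comm]
    ring

/-- The Poincaré lemma for divergence-free polynomial vector fields in the plane. -/
theorem exists_curl_eq {n : ℕ} {p q : Poly} (hp : p ∈ restrictTotalDegree (Fin 2) ℝ n)
    (hq : q ∈ restrictTotalDegree (Fin 2) ℝ n) (h : pderiv 0 p + pderiv 1 q = 0) :
    ∃ w ∈ restrictTotalDegree (Fin 2) ℝ (n + 1), pderiv 1 w = p ∧ -pderiv 0 w = q := by
  have h10 : (1 : Fin 2) ≠ 0 := by decide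
  -- With `Q = ∫ q dx` the potential is `∫ (p + ∂Q/∂y) dy - Q`. The integrand has `x`-derivative
  -- `∂p/∂x + ∂q/∂y = 0`, so the first term does not disturb `-∂w/∂x = q`.
  refine ⟨antideriv 1 (p + pderiv 1 (antideriv 0 q)) - antideriv 0 q, ?_, ?_, ?_⟩
  · refine Submodule.sub_mem _ (antideriv_mem_restrictTotalDegree (Submodule.add_mem _ hp ?_) _)
      (antideriv_mem_restrictTotalDegree hq _)
    simpa using pderiv_mem_restrictTotalDegree (antideriv_mem_restrictTotalDegree hq 0) 1
  · rw [map_sub, pderiv_antideriv]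
    ring
  · rw [map_sub, pderiv_antideriv, pderiv_antideriv_comm h10.symm, map_add, pderiv_comm,
      pderiv_antideriv, h]
    simp

theorem dirDeriv_mem_restrictTotalDegree {n : ℕ} {p : Poly}
    (hp : p ∈ restrictTotalDegree (Fin 2) ℝ n) (d : Plane) :
    dirDeriv d p ∈ restrictTotalDegree (Fin 2) ℝ (n - 1) :=
  Submodule.add_mem _ (Submodule.smul_mem _ _ (pderiv_mem_restrictTotalDegree hp 0))
    (Submodule.smul_mem _ _ (pderiv_mem_restrictTotalDegree hp 1))

theorem pderiv_dirDeriv_comm (i : Fin 2) (d : Plane) (p : Poly) :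
    pderiv i (dirDeriv d p) = dirDeriv d (pderiv i p) := by
  simp only [dirDeriv, map_add, Derivation.map_smul, pderiv_comm i]

theorem dirDeriv_comm (d e : Plane) (p : Poly) :
    dirDeriv d (dirDeriv e p) = dirDeriv e (dirDeriv d p) := by
  conv_lhs => rw [dirDeriv, pderiv_dirDeriv_comm, pderiv_dirDeriv_comm, ← dirDeriv_smul,
    ← dirDeriv_smul, ← dirDeriv_add]
  rfl

theorem dirDeriv_iterate_comm (d e : Plane) (m : ℕ) (p : Poly) :
    dirDeriv d ((dirDeriv e)^[m] p) = (dirDeriv e)^[m] (dirDeriv d p) := by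
  induction m generalizing p with
  | zero => rfl
  | succ m ih => rw [Function.iterate_succ_apply, Function.iterate_succ_apply, ih, dirDeriv_comm]

theorem value_sub (x : Plane) (p q : Poly) : value x (p - q) = value x p - value x q := by
  simp [value]

theorem value_mul (x : Plane) (p q : Poly) : value x (p * q) = value x p * value x q := by
  simp [value]

theorem value_C (x : Plane) (c : ℝ) : value x (C c) = c := by simp [value]

theorem value_zero (x : Plane) : value x 0 = 0 := by simp [value]

theorem continuous_value (p : Poly) : Continuous fun x : Plane => value x p := by
  have h : Continuous fun x : Plane => fun i : Fin 2 => x i := by fun_prop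
  exact (MvPolynomial.continuous_eval p).comp h

theorem hasDerivAt_value_lineMap (a b : Plane) (p : Poly) (t : ℝ) :
    HasDerivAt (fun t : ℝ => value (AffineMap.lineMap a b t) p)
      (value (AffineMap.lineMap a b t) (dirDeriv (b - a) p)) t := by
  induction p using MvPolynomial.induction_on with
  | C c => simpa [value, dirDeriv] using hasDerivAt_const t c
  | add p q hp hq =>
    simp only [value_add, dirDeriv_add]
    exact hp.add hq
  | mul_X p i hp =>
    have hX : HasDerivAt (fun t : ℝ => value (AffineMap.lineMap a b t) (X i)) ((b - a) i) t := by
      simp only [value, eval_X, AffineMap.lineMap_apply, vsub_eq_sub, vadd_eq_add, PiLp.add_apply,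
        PiLp.smul_apply, smul_eq_mul]
      simpa using ((hasDerivAt_id t).mul_const ((b - a) i)).add_const (a i)
    simp only [value_mul]
    refine (hp.mul hX).congr_deriv ?_
    have hd : value (AffineMap.lineMap a b t) (dirDeriv (b - a) (X i)) = (b - a) i := by
      fin_cases i <;> simp [dirDeriv, value, smul_eval]
    have : dirDeriv (b - a) (p * X i) = dirDeriv (b - a) p * X i + p * dirDeriv (b - a) (X i) := by
      simp only [dirDeriv, Derivation.leibniz, smul_eq_mul, smul_eq_C_mul]
      ring
    rw [this, value_add, value_mul, value_mul, hd]

/-- A polynomial that is constant on a segment has zero derivative along it. -/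
theorem value_dirDeriv_eq_zero_of_segment {a b : Plane} {p : Poly}
    (h : ∀ x ∈ segment ℝ a b, value x p = 0) :
    ∀ x ∈ segment ℝ a b, value x (dirDeriv (b - a) p) = 0 := by
  intro x hx
  rw [segment_eq_image_lineMap] at hx h
  obtain ⟨t, ht, rfl⟩ := hx
  have h1 := (hasDerivAt_value_lineMap a b p t).hasDerivWithinAt (s := Set.Icc 0 1)
  have h2 : HasDerivWithinAt (fun t : ℝ => value (AffineMap.lineMap a b t) p) 0
      (Set.Icc 0 1) t :=
    (hasDerivWithinAt_const t _ (0 : ℝ)).congr (fun s hs => h _ ⟨s, hs, rfl⟩) (h _ ⟨t, ht, rfl⟩)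
  exact (uniqueDiffOn_Icc_zero_one t ht).eq_deriv _ h1 h2

/-- A polynomial is constant on a segment along which its derivative vanishes. -/
theorem value_eq_of_segment {a b : Plane} {p : Poly}
    (h : ∀ x ∈ segment ℝ a b, value x (dirDeriv (b - a) p) = 0) :
    ∀ x ∈ segment ℝ a b, value x p = value a p := by
  intro x hx
  rw [segment_eq_image_lineMap] at hx h
  obtain ⟨t, ht, rfl⟩ := hx
  have := constant_of_derivWithin_zero (f := fun t : ℝ => value (AffineMap.lineMap a b t) p)
    (a := 0) (b := 1)
    (fun s _ => (hasDerivAt_value_lineMap a b p s).differentiableAt.differentiableWithinAt)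
    (fun s hs => by
      rw [(hasDerivAt_value_lineMap a b p s).hasDerivWithinAt.derivWithin
        (uniqueDiffOn_Icc_zero_one s (Set.Ico_subset_Icc_self hs))]
      exact h _ ⟨s, Set.Ico_subset_Icc_self hs, rfl⟩) t ht
  simpa using this

/-! ### Polynomials vanishing to a given order -/

/-- The polynomials whose derivatives of order less than `s` vanish on `S`. -/
def vanishing (S : Set Plane) : ℕ → Submodule ℝ Poly
  | 0 => ⊤
  | s + 1 =>
    { carrier := {p | (∀ x ∈ S, value x p = 0) ∧ ∀ i, pderiv i p ∈ vanishing S s}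
      zero_mem' := ⟨fun x _ => value_zero x, fun i => by simp⟩
      add_mem' := fun hp hq => ⟨fun x hx => by rw [value_add, hp.1 x hx, hq.1 x hx, add_zero],
        fun i => by rw [map_add]; exact Submodule.add_mem _ (hp.2 i) (hq.2 i)⟩
      smul_mem' := fun c p hp => ⟨fun x hx => by rw [value_smul, hp.1 x hx, mul_zero],
        fun i => by rw [Derivation.map_smul]; exact Submodule.smul_mem _ c (hp.2 i)⟩ }

theorem mem_vanishing_zero (S : Set Plane) (p : Poly) : p ∈ vanishing S 0 := Submodule.mem_top

theorem mem_vanishing_succ {S : Set Plane} {s : ℕ} {p : Poly} :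
    p ∈ vanishing S (s + 1) ↔
      (∀ x ∈ S, value x p = 0) ∧ ∀ i, pderiv i p ∈ vanishing S s := Iff.rfl

theorem dirDeriv_mem_vanishing {S : Set Plane} {s : ℕ} {p : Poly} (hp : p ∈ vanishing S (s + 1))
    (d : Plane) : dirDeriv d p ∈ vanishing S s :=
  Submodule.add_mem _ (Submodule.smul_mem _ _ (hp.2 0)) (Submodule.smul_mem _ _ (hp.2 1))

theorem iterate_dirDeriv_mem_vanishing {S : Set Plane} {s m : ℕ} {p : Poly}
    (hp : p ∈ vanishing S (s + m)) (d : Plane) : (dirDeriv d)^[m] p ∈ vanishing S s := by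
  induction m generalizing p with
  | zero => exact hp
  | succ m ih => exact ih (dirDeriv_mem_vanishing hp d)

theorem value_eq_zero_of_mem_vanishing {S : Set Plane} {s : ℕ} (hs : 0 < s) {p : Poly}
    (hp : p ∈ vanishing S s) {x : Plane} (hx : x ∈ S) : value x p = 0 := by
  obtain ⟨s, rfl⟩ := Nat.exists_eq_succ_of_ne_zero hs.ne'
  exact hp.1 x hx

/-- Vanishing to order `s` at a point in terms of partial derivatives. -/
theorem mem_vanishing_singleton_iff {x : Plane} {s : ℕ} {p : Poly} :
    p ∈ vanishing {x} s ↔ ∀ i j : ℕ, i + j < s → vertexDOF x i j p = 0 := by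
  induction s generalizing p with
  | zero => simp [mem_vanishing_zero]
  | succ s ih =>
    have comm : ∀ (j : ℕ) (p : Poly),
        (pderiv 1)^[j] (pderiv 0 p) = pderiv 0 ((pderiv 1)^[j] p) := by
      intro j
      induction j with
      | zero => exact fun _ => rfl
      | succ j ihj =>
        intro p
        rw [Function.iterate_succ_apply, Function.iterate_succ_apply, ← ihj, pderiv_comm]
    have h0 : ∀ i j, vertexDOF x i j (pderiv 0 p) = vertexDOF x (i + 1) j p := fun i j => by
      rw [vertexDOF, vertexDOF, Function.iterate_succ_apply, comm]
    have h1 : ∀ i j, vertexDOF x i j (pderiv 1 p) = vertexDOF x i (j + 1) p := fun i j => by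
      rw [vertexDOF, vertexDOF, Function.iterate_succ_apply]
    rw [mem_vanishing_succ, Fin.forall_fin_two, ih, ih]
    simp only [h0, h1, Set.mem_singleton_iff, forall_eq]
    constructor
    · rintro ⟨h, h', h''⟩ i j hij
      match i, j with
      | 0, 0 => exact h
      | i + 1, j => exact h' i j (by omega)
      | i, j + 1 => exact h'' i j (by omega)
    · exact fun h => ⟨h 0 0 (by omega), fun i j hij => h _ _ (by omega),
        fun i j hij => h _ _ (by omega)⟩

/-- Vanishing to order `s` on a segment in terms of derivatives in a transversal direction. -/
theorem mem_vanishing_segment_of_iterate {a b d : Plane}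
    (hd : (b - a) 0 * d 1 - (b - a) 1 * d 0 ≠ 0) {s : ℕ} {p : Poly}
    (h : ∀ m < s, ∀ x ∈ segment ℝ a b, value x ((dirDeriv d)^[m] p) = 0) :
    p ∈ vanishing (segment ℝ a b) s := by
  induction s generalizing p with
  | zero => exact mem_vanishing_zero _ _
  | succ s ih =>
    refine ⟨fun x hx => h 0 (by omega) x hx, fun i => ih fun m hm x hx => ?_⟩
    set D := (b - a) 0 * d 1 - (b - a) 1 * d 0
    -- As `b - a` and `d` span the plane, Cramer's rule writes a partial derivative through these
    -- two directions. The tangential part costs nothing: it vanishes wherever the iterated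
    -- derivative vanishes on the segment.
    have key : ∃ u v : ℝ, pderiv i p = u • dirDeriv d p + v • dirDeriv (b - a) p := by
      have h1 : D * D⁻¹ = 1 := mul_inv_cancel₀ hd
      fin_cases i
      · refine ⟨-(b - a) 1 * D⁻¹, d 1 * D⁻¹, ?_⟩
        simp only [dirDeriv, smul_eq_C_mul, map_mul, map_neg]
        have h2 := congrArg (C : ℝ → Poly) h1
        simp only [D, map_sub, map_mul, map_one] at h2
        simp only [D, Fin.zero_eta] at *
        linear_combination (-1 : Poly) * pderiv 0 p * h2
      · refine ⟨(b - a) 0 * D⁻¹, -d 0 * D⁻¹, ?_⟩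
        simp only [dirDeriv, smul_eq_C_mul, map_mul, map_neg]
        have h2 := congrArg (C : ℝ → Poly) h1
        simp only [D, map_sub, map_mul, map_one] at h2
        simp only [D, Fin.mk_one] at *
        linear_combination (-1 : Poly) * pderiv 1 p * h2
    obtain ⟨u, v, huv⟩ := key
    have e1 := h (m + 1) (by omega) x hx
    have e2 := value_dirDeriv_eq_zero_of_segment (h m (by omega)) x hx
    rw [Function.iterate_succ_apply] at e1
    rw [dirDeriv_iterate_comm] at e2
    rw [huv, iterate_add_of (dirDeriv_add d), iterate_smul_of (dirDeriv_smul d),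
      iterate_smul_of (dirDeriv_smul d), value_add, value_smul, value_smul, e1, e2]
    ring

/-! ### Barycentric coordinates -/

/-- The cross product of two vectors of the plane. -/
def cross (u v : Plane) : ℝ := u 0 * v 1 - u 1 * v 0

/-- Twice the signed area of a triangle. -/
def tdet (x : Fin 3 → Plane) : ℝ := cross (x 1 - x 0) (x 2 - x 0)

/-- The derivative of the barycentric coordinate of index `m` in the direction `d`. -/
def slope (x : Fin 3 → Plane) (m : Fin 3) (d : Plane) : ℝ :=
  cross (x (m + 2) - x (m + 1)) d / tdet x

/-- The partial derivatives of the barycentric coordinate of index `m`. -/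
def grad (x : Fin 3 → Plane) (m : Fin 3) (i : Fin 2) : ℝ :=
  slope x m (EuclideanSpace.single i 1)

/-- The barycentric coordinates of a triangle, as polynomials. -/
def bary (x : Fin 3 → Plane) (m : Fin 3) : Poly :=
  C (grad x m 0) * (X 0 - C (x (m + 1) 0)) + C (grad x m 1) * (X 1 - C (x (m + 1) 1))

theorem grad_zero (x : Fin 3 → Plane) (m : Fin 3) :
    grad x m 0 = -(x (m + 2) - x (m + 1)) 1 / tdet x := by
  simp [grad, slope, cross]

theorem grad_one (x : Fin 3 → Plane) (m : Fin 3) :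
    grad x m 1 = (x (m + 2) - x (m + 1)) 0 / tdet x := by
  simp [grad, slope, cross]

theorem slope_eq (x : Fin 3 → Plane) (m : Fin 3) (d : Plane) :
    slope x m d = grad x m 0 * d 0 + grad x m 1 * d 1 := by
  rw [grad_zero, grad_one, slope, cross]
  ring

/-- Vertex indices are taken modulo 3, so the edge opposite to vertex `m` joins `m + 1` and `m + 2`.
These values serve to evaluate cyclic sums. -/
theorem fin_three_add : (0 : Fin 3) + 1 = 1 ∧ (0 : Fin 3) + 2 = 2 ∧ (1 : Fin 3) + 1 = 2 ∧
    (1 : Fin 3) + 2 = 0 ∧ (2 : Fin 3) + 1 = 0 ∧ (2 : Fin 3) + 2 = 1 := by decide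

theorem sum_slope (x : Fin 3 → Plane) (d : Plane) : ∑ m, slope x m d = 0 := by
  obtain ⟨h1, h2, h3, h4, h5, h6⟩ := fin_three_add
  simp only [Fin.sum_univ_three, slope, cross, h1, h2, h3, h4, h5, h6, PiLp.sub_apply]
  ring

theorem sum_grad (x : Fin 3 → Plane) (i : Fin 2) : ∑ m, grad x m i = 0 := sum_slope x _

theorem slope_sub {x : Fin 3 → Plane} (hx : tdet x ≠ 0) (m i j : Fin 3) :
    slope x m (x i - x j) = (if m = i then 1 else 0) - (if m = j then 1 else 0) := by
  obtain ⟨h1, h2, h3, h4, h5, h6⟩ := fin_three_add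
  rw [slope, div_eq_iff hx]
  fin_cases m <;> fin_cases i <;> fin_cases j <;>
    simp [cross, tdet, h1, h3, h4, h5, h6] <;> ring

theorem pderiv_bary (x : Fin 3 → Plane) (m : Fin 3) (i : Fin 2) :
    pderiv i (bary x m) = C (grad x m i) := by
  fin_cases i <;> simp [bary, pderiv_X]

theorem bary_mem_restrictTotalDegree (x : Fin 3 → Plane) (m : Fin 3) :
    bary x m ∈ restrictTotalDegree (Fin 2) ℝ 1 := by
  have h : ∀ (a c : ℝ) (i : Fin 2),
      C a * (X i - C c) ∈ restrictTotalDegree (Fin 2) ℝ 1 := fun a c i => by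
    simpa using mul_mem_restrictTotalDegree (C_mem_restrictTotalDegree 0 a)
      (Submodule.sub_mem _ (X_mem_restrictTotalDegree i) (C_mem_restrictTotalDegree 1 c))
  exact Submodule.add_mem _ (h _ _ _) (h _ _ _)

theorem value_bary (x : Fin 3 → Plane) (m : Fin 3) (y : Plane) :
    value y (bary x m) = slope x m (y - x (m + 1)) := by
  simp [value, bary, slope_eq]

theorem value_bary_vertex {x : Fin 3 → Plane} (hx : tdet x ≠ 0) (m j : Fin 3) :
    value (x j) (bary x m) = if m = j then 1 else 0 := by
  rw [value_bary, slope_sub hx]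
  simp

theorem slope_lineMap (x : Fin 3 → Plane) (m : Fin 3) (a b y : Plane) (t : ℝ) :
    slope x m (AffineMap.lineMap a b t - y)
      = (1 - t) * slope x m (a - y) + t * slope x m (b - y) := by
  simp only [slope, cross, AffineMap.lineMap_apply, vsub_eq_sub, vadd_eq_add, PiLp.add_apply,
    PiLp.smul_apply, PiLp.sub_apply, smul_eq_mul]
  ring

theorem value_bary_lineMap {x : Fin 3 → Plane} (hx : tdet x ≠ 0) (m i j : Fin 3) (t : ℝ) :
    value (AffineMap.lineMap (x i) (x j) t) (bary x m)
      = (1 - t) * (if m = i then 1 else 0) + t * (if m = j then 1 else 0) := by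
  rw [value_bary, slope_lineMap, ← value_bary, ← value_bary, value_bary_vertex hx,
    value_bary_vertex hx]

/-- Affine functions are recovered from their values at the vertices. Together with `sum_bary` this
is what makes the Bernstein forms span all polynomials. -/
theorem sum_smul_bary {x : Fin 3 → Plane} (hx : tdet x ≠ 0) (i : Fin 2) :
    ∑ m, x m i • bary x m = X i := by
  obtain ⟨h1, h2, h3, h4, h5, h6⟩ := fin_three_add
  have e0 : ∑ m, x m i * grad x m 0 = if i = 0 then 1 else 0 := by
    simp only [Fin.sum_univ_three, grad_zero, h1, h2, h3, h4, h5, h6]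
    simp only [← mul_div_assoc, ← add_div]
    rw [div_eq_iff hx]
    fin_cases i <;> simp [tdet, cross] <;> ring
  have e1 : ∑ m, x m i * grad x m 1 = if i = 1 then 1 else 0 := by
    simp only [Fin.sum_univ_three, grad_one, h1, h2, h3, h4, h5, h6]
    simp only [← mul_div_assoc, ← add_div]
    rw [div_eq_iff hx]
    fin_cases i <;> simp [tdet, cross] <;> ring
  have e2 : ∑ m, x m i * (grad x m 0 * x (m + 1) 0 + grad x m 1 * x (m + 1) 1) = 0 := by
    simp only [Fin.sum_univ_three, grad_zero, grad_one, h1, h2, h3, h4, h5, h6]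
    simp only [div_mul_eq_mul_div, ← mul_div_assoc, ← add_div]
    rw [div_eq_zero_iff]
    left
    fin_cases i <;> simp <;> ring
  have key : ∑ m, x m i • bary x m = C (∑ m, x m i * grad x m 0) * X 0
      + C (∑ m, x m i * grad x m 1) * X 1
      - C (∑ m, x m i * (grad x m 0 * x (m + 1) 0 + grad x m 1 * x (m + 1) 1)) := by
    simp only [Fin.sum_univ_three, bary, smul_eq_C_mul, map_add, map_mul]
    ring
  rw [key, e0, e1, e2]
  fin_cases i <;> simp

theorem sum_bary {x : Fin 3 → Plane} (hx : tdet x ≠ 0) : ∑ m, bary x m = 1 := by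
  obtain ⟨h1, h2, h3, h4, h5, h6⟩ := fin_three_add
  have e2 : ∑ m, -(grad x m 0 * x (m + 1) 0 + grad x m 1 * x (m + 1) 1) = 1 := by
    simp only [Fin.sum_univ_three, grad_zero, grad_one, h1, h2, h3, h4, h5, h6]
    simp only [div_mul_eq_mul_div, ← neg_div, ← add_div]
    rw [div_eq_one_iff_eq hx]
    simp [tdet, cross]; ring
  have key : ∑ m, bary x m = C (∑ m, grad x m 0) * X 0 + C (∑ m, grad x m 1) * X 1
      + C (∑ m, -(grad x m 0 * x (m + 1) 0 + grad x m 1 * x (m + 1) 1)) := by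
    simp only [Fin.sum_univ_three, bary, map_add, map_mul, map_neg]
    ring
  rw [key, sum_grad, sum_grad, e2]
  simp

/-! ### The Bernstein form -/

/-- The shift of a family of coefficients. -/
def shift (m : Fin 3) (c : (Fin 3 → ℕ) → ℝ) : (Fin 3 → ℕ) → ℝ := fun α => c (α + Pi.single m 1)

/-- The polynomial `∑ c_α λ^α / α!`, the sum being over all `α` with `|α| = n`,
evaluated by the algorithm of de Casteljau. -/
def bern (x : Fin 3 → Plane) : ℕ → ((Fin 3 → ℕ) → ℝ) → Poly
  | 0, c => C (c 0)
  | n + 1, c => ((n + 1 : ℝ)⁻¹) • ∑ m, bary x m * bern x n (shift m c)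

theorem sum_add_single (α : Fin 3 → ℕ) (m : Fin 3) :
    ∑ i, (α + (Pi.single m 1 : Fin 3 → ℕ)) i = ∑ i, α i + 1 := by
  simp [Finset.sum_add_distrib]

/-- Coefficient families are defined on all multi-indices, but only those of degree `n` enter the
polynomial. -/
theorem bern_congr (x : Fin 3 → Plane) {n : ℕ} {c c' : (Fin 3 → ℕ) → ℝ}
    (h : ∀ α, ∑ i, α i = n → c α = c' α) : bern x n c = bern x n c' := by
  induction n generalizing c c' with
  | zero => rw [bern, bern, h 0 (by simp)]
  | succ n ih =>
    rw [bern, bern]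
    congr 1
    refine Finset.sum_congr rfl fun m _ => ?_
    rw [ih (c := shift m c) (c' := shift m c') fun α hα => h (α + Pi.single m 1) (by rw [sum_add_single, hα])]

theorem bern_add (x : Fin 3 → Plane) (n : ℕ) (c c' : (Fin 3 → ℕ) → ℝ) :
    bern x n (c + c') = bern x n c + bern x n c' := by
  induction n generalizing c c' with
  | zero => simp [bern]
  | succ n ih =>
    have : ∀ m, shift m (c + c') = shift m c + shift m c' := fun m => rfl
    simp only [bern, this, ih, mul_add, Finset.sum_add_distrib, smul_add]

theorem bern_smul (x : Fin 3 → Plane) (n : ℕ) (r : ℝ) (c : (Fin 3 → ℕ) → ℝ) :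
    bern x n (r • c) = r • bern x n c := by
  induction n generalizing c with
  | zero => simp [bern, smul_eq_C_mul]
  | succ n ih =>
    have : ∀ m, shift m (r • c) = r • shift m c := fun m => rfl
    simp only [bern, this, ih, mul_smul_comm, ← Finset.smul_sum]
    rw [smul_comm]

/-- `bern` as a linear map. -/
def bernLin (x : Fin 3 → Plane) (n : ℕ) : ((Fin 3 → ℕ) → ℝ) →ₗ[ℝ] Poly where
  toFun := bern x n
  map_add' := bern_add x n
  map_smul' := bern_smul x n

theorem bern_sub (x : Fin 3 → Plane) (n : ℕ) (c c' : (Fin 3 → ℕ) → ℝ) :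
    bern x n (c - c') = bern x n c - bern x n c' := map_sub (bernLin x n) c c'

theorem bern_sum (x : Fin 3 → Plane) (n : ℕ) {ι : Type*} (s : Finset ι)
    (c : ι → (Fin 3 → ℕ) → ℝ) : bern x n (∑ i ∈ s, c i) = ∑ i ∈ s, bern x n (c i) :=
  map_sum (bernLin x n) c s

theorem bern_zero (x : Fin 3 → Plane) (n : ℕ) : bern x n 0 = 0 := map_zero (bernLin x n)

theorem sum_bary_mul_bern (x : Fin 3 → Plane) (n : ℕ) (c : (Fin 3 → ℕ) → ℝ) :
    ∑ m, bary x m * bern x n (shift m c) = (n + 1 : ℝ) • bern x (n + 1) c := by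
  rw [bern, smul_smul, mul_inv_cancel₀ (by positivity), one_smul]

theorem bern_mem_restrictTotalDegree (x : Fin 3 → Plane) (n : ℕ) (c : (Fin 3 → ℕ) → ℝ) :
    bern x n c ∈ restrictTotalDegree (Fin 2) ℝ n := by
  induction n generalizing c with
  | zero => exact C_mem_restrictTotalDegree _ _
  | succ n ih =>
    refine Submodule.smul_mem _ _ (Submodule.sum_mem _ fun m _ => ?_)
    rw [add_comm n]
    exact mul_mem_restrictTotalDegree (bary_mem_restrictTotalDegree x m) (ih _)

/-- With the factor `1 / α!` the derivative of `λ^α / α!` with respect to `λ_m` is the basis element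
of index `α - e_m`, so differentiation is a shift without numerical factors. In the induction the
Leibniz rule gives `n + 1` copies from the differentiated lower forms and one from the
differentiated `λ_m`. -/
theorem pderiv_bern_succ (x : Fin 3 → Plane) (n : ℕ) (c : (Fin 3 → ℕ) → ℝ) (i : Fin 2) :
    pderiv i (bern x (n + 1) c) = bern x n (∑ m, grad x m i • shift m c) := by
  rw [bern_sum]
  simp only [bern_smul]
  induction n generalizing c with
  | zero =>
    simp [bern, pderiv_bary, smul_eq_C_mul, mul_comm]
  | succ n ih =>
    rw [bern, Derivation.map_smul, map_sum]
    simp only [Derivation.leibniz, pderiv_bary, ih, smul_eq_mul, Finset.sum_add_distrib,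
      Finset.mul_sum]
    rw [Finset.sum_comm]
    have h1 : ∀ l, ∑ m, bary x m * grad x l i • bern x n (shift l (shift m c))
        = grad x l i • ((n + 1 : ℝ) • bern x (n + 1) (shift l c)) := fun l => by
      rw [← sum_bary_mul_bern, Finset.smul_sum]
      refine Finset.sum_congr rfl fun m _ => ?_
      rw [mul_smul_comm]
      congr 3
      funext α
      simp only [shift, add_right_comm]
    simp only [h1]
    have h2 : ∀ m, bern x (n + 1) (shift m c) * C (grad x m i)
        = grad x m i • bern x (n + 1) (shift m c) := fun m => by
      rw [smul_eq_C_mul, mul_comm]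
    simp only [h2, smul_comm (grad x _ i), ← Finset.smul_sum]
    rw [show ∀ (r : ℝ) (y : Poly), r • y + y = (r + 1) • y from fun r y => by
      rw [add_smul, one_smul], smul_smul]
    push_cast
    rw [inv_mul_cancel₀ (by positivity), one_smul]

theorem pderiv_bern_zero (x : Fin 3 → Plane) (c : (Fin 3 → ℕ) → ℝ) (i : Fin 2) :
    pderiv i (bern x 0 c) = 0 := by simp [bern]

theorem dirDeriv_bern_succ (x : Fin 3 → Plane) (n : ℕ) (c : (Fin 3 → ℕ) → ℝ) (d : Plane) :
    dirDeriv d (bern x (n + 1) c) = bern x n (∑ m, slope x m d • shift m c) := by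
  rw [dirDeriv, pderiv_bern_succ, pderiv_bern_succ, ← bern_smul, ← bern_smul, ← bern_add]
  congr 1
  simp only [Finset.smul_sum, ← Finset.sum_add_distrib, smul_smul, ← add_smul, slope_eq, mul_comm]

/-- In the direction of an edge the derivative is a difference of shifts. -/
theorem dirDeriv_bern_sub {x : Fin 3 → Plane} (hx : tdet x ≠ 0) (n : ℕ) (c : (Fin 3 → ℕ) → ℝ)
    (i j : Fin 3) :
    dirDeriv (x i - x j) (bern x (n + 1) c) = bern x n (shift i c - shift j c) := by
  rw [dirDeriv_bern_succ]
  simp [slope_sub hx, sub_smul, Finset.sum_sub_distrib]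

/-- Multiplication by `λ_m` raises the index by `e_m` and changes `α!` by the factor `α_m` of the
new index. This factor also makes the truncated subtraction harmless when `α_m = 0`. The identity
`key` is a Leibniz rule for shifts. -/
theorem bary_mul_bern (x : Fin 3 → Plane) (n : ℕ) (c : (Fin 3 → ℕ) → ℝ) (m : Fin 3) :
    bary x m * bern x n c = bern x (n + 1) fun α => α m * c (α - Pi.single m 1) := by
  have key : ∀ (l : Fin 3) (c : (Fin 3 → ℕ) → ℝ),
      shift l (fun α => (α m : ℝ) * c (α - Pi.single m 1))
        = (fun α => (α m : ℝ) * (shift l c) (α - Pi.single m 1)) + (if l = m then 1 else 0 : ℝ) • c := by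
    intro l c
    funext α
    simp only [shift, Pi.add_apply, Pi.smul_apply, smul_eq_mul]
    rcases eq_or_ne l m with rfl | hl
    · have h1 : α + Pi.single l 1 - Pi.single l 1 = α := by
        funext i; simp
      rw [h1]
      rcases Nat.eq_zero_or_pos (α l) with h | h
      · simp [h]
      · have h2 : α - Pi.single l 1 + Pi.single l 1 = α := by
          funext i
          rcases eq_or_ne i l with rfl | hi
          · simp; omega
          · simp [hi]
        rw [h2]
        simp
        ring
    · rcases Nat.eq_zero_or_pos (α m) with h | h
      · simp [h, hl.symm]
        intro hl'; exact absurd hl' hl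
      · have h2 : α + Pi.single l 1 - Pi.single m 1 = α - Pi.single m 1 + Pi.single l 1 := by
          funext i
          rcases eq_or_ne i m with rfl | hi
          · simp [hl.symm]
          · simp [hi]
        rw [h2]
        simp [hl, hl.symm]
  induction n generalizing c with
  | zero =>
    simp only [bern, key]
    simp [ite_apply, apply_ite (C : ℝ → Poly)]
  | succ n ih =>
    conv_rhs => rw [bern]
    simp only [key, bern_add, bern_smul, ← ih, mul_add, Finset.sum_add_distrib]
    have h1 : ∀ l, bary x l * (bary x m * bern x n (shift l c))
        = bary x m * (bary x l * bern x n (shift l c)) := fun l => by ring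
    simp only [h1, ← Finset.mul_sum, sum_bary_mul_bern]
    simp only [mul_smul_comm, ite_smul, one_smul, zero_smul, mul_ite, mul_zero, Finset.sum_ite_eq',
      Finset.mem_univ, if_true]
    rw [show ∀ (r : ℝ) (y : Poly), r • y + y = (r + 1) • y from fun r y => by
      rw [add_smul, one_smul], smul_smul]
    push_cast
    rw [inv_mul_cancel₀ (by positivity), one_smul]

/-- Every polynomial of degree at most `n` has a Bernstein form of degree `n`. -/
theorem exists_bern_eq {x : Fin 3 → Plane} (hx : tdet x ≠ 0) {n : ℕ} {p : Poly}
    (hp : p ∈ restrictTotalDegree (Fin 2) ℝ n) : ∃ c, p = bern x n c := by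
  have mulX : ∀ (n : ℕ) (p : Poly), p ∈ LinearMap.range (bernLin x n) → ∀ m,
      bary x m * p ∈ LinearMap.range (bernLin x (n + 1)) := by
    rintro n _ ⟨c, rfl⟩ m
    exact ⟨_, (bary_mul_bern x n c m).symm⟩
  -- Degree raising: multiply by `1`, written as the sum of the barycentric coordinates.
  have mono : ∀ (m n : ℕ) (p : Poly), p ∈ LinearMap.range (bernLin x m) → m ≤ n →
      p ∈ LinearMap.range (bernLin x n) := by
    intro m n p hp hmn
    induction n, hmn using Nat.le_induction with
    | base => exact hp
    | succ n _ ih =>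
      rw [← one_mul p, ← sum_bary hx, Finset.sum_mul]
      exact Submodule.sum_mem _ fun l _ => mulX n p ih l
  have monom : ∀ (m : ℕ) (s : Fin 2 →₀ ℕ), s.degree = m →
      (monomial s 1 : Poly) ∈ LinearMap.range (bernLin x m) := by
    intro m
    induction m with
    | zero =>
      intro s hs
      rw [Finsupp.degree_eq_zero_iff] at hs
      exact ⟨1, by simp [bernLin, bern, hs]⟩
    | succ m ih =>
      intro s hs
      have : s ≠ 0 := fun h => by simp [h] at hs
      obtain ⟨i, hi⟩ := Finsupp.ne_iff.1 this
      have h1 : s = (s - Finsupp.single i 1) + Finsupp.single i 1 := by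
        refine Finsupp.ext fun j => ?_
        simp at hi
        rcases eq_or_ne j i with rfl | hj
        · simp; omega
        · simp [hj.symm]
      have h2 : (monomial s 1 : Poly) = X i * monomial (s - Finsupp.single i 1) 1 := by
        conv_lhs => rw [h1, ← one_mul (1 : ℝ), ← monomial_mul, mul_comm]
        rfl
      -- Each coordinate factor is replaced by a homogeneous linear form in the barycentric
      -- coordinates.
      rw [h2, ← sum_smul_bary hx i, Finset.sum_mul]
      refine Submodule.sum_mem _ fun l _ => ?_
      rw [smul_mul_assoc]
      refine Submodule.smul_mem _ _ (mulX _ _ (ih _ ?_) l)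
      rw [h1] at hs
      simp at hs
      exact hs
  have : p ∈ LinearMap.range (bernLin x n) := by
    rw [p.as_sum]
    refine Submodule.sum_mem _ fun s hs => ?_
    have : monomial s (coeff s p) = coeff s p • (monomial s 1 : Poly) := by
      rw [smul_monomial, smul_eq_mul, mul_one]
    rw [this]
    exact Submodule.smul_mem _ _ (mono _ _ _ (monom _ s rfl)
      (mem_restrictTotalDegree_iff_coeff.1 hp s (mem_support_iff.1 hs)))
  obtain ⟨c, hc⟩ := this
  exact ⟨c, hc.symm⟩

theorem value_bern_succ (x : Fin 3 → Plane) (n : ℕ) (c : (Fin 3 → ℕ) → ℝ) (y : Plane) :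
    value y (bern x (n + 1) c)
      = (n + 1 : ℝ)⁻¹ * ∑ m, value y (bary x m) * value y (bern x n (shift m c)) := by
  simp [bern, value, smul_eval]

theorem value_bern_vertex {x : Fin 3 → Plane} (hx : tdet x ≠ 0) (n : ℕ) (c : (Fin 3 → ℕ) → ℝ)
    (j : Fin 3) :
    value (x j) (bern x n c) = c (Pi.single j n) / n.factorial := by
  induction n generalizing c with
  | zero => simp [bern, value_C]
  | succ n ih =>
    rw [value_bern_succ]
    simp only [value_bary_vertex hx, ih, ite_mul, one_mul, zero_mul, Finset.sum_ite_eq',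
      Finset.mem_univ, if_true, shift, ← Pi.single_add]
    rw [Nat.factorial_succ]
    push_cast
    field_simp

/-- The restriction of a Bernstein form to an edge. -/
theorem value_bern_lineMap {x : Fin 3 → Plane} (hx : tdet x ≠ 0) (n : ℕ) (c : (Fin 3 → ℕ) → ℝ)
    (i j : Fin 3) (t : ℝ) :
    value (AffineMap.lineMap (x i) (x j) t) (bern x n c)
      = ∑ p ∈ HasAntidiagonal.antidiagonal n, c (Pi.single i p.1 + Pi.single j p.2) *
          ((1 - t) ^ p.1 / p.1.factorial * (t ^ p.2 / p.2.factorial)) := by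
  induction n generalizing c with
  | zero => simp [bern, value_C]
  | succ n ih =>
    rw [value_bern_succ]
    simp only [value_bary_lineMap hx, ih, add_mul, Finset.sum_add_distrib, mul_ite, mul_one,
      mul_zero, ite_mul, zero_mul, Finset.sum_ite_eq', Finset.mem_univ, if_true]
    rw [inv_mul_eq_iff_eq_mul₀ (by positivity)]
    -- On the antidiagonal `n + 1 = p.1 + p.2`. The two parts correspond to the two shifts that
    -- survive on the edge.
    have h1 : ∀ f : ℕ × ℕ → ℝ, ((n : ℝ) + 1) * ∑ p ∈ HasAntidiagonal.antidiagonal (n + 1), f p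
        = ∑ p ∈ HasAntidiagonal.antidiagonal (n + 1), p.1 * f p + ∑ p ∈ HasAntidiagonal.antidiagonal (n + 1), p.2 * f p := by
      intro f
      rw [← Finset.sum_add_distrib, Finset.mul_sum]
      refine Finset.sum_congr rfl fun p hp => ?_
      rw [HasAntidiagonal.mem_antidiagonal] at hp
      rw [← add_mul]
      congr 1
      exact_mod_cast hp.symm
    rw [h1]
    congr 1
    · rw [Finset.Nat.sum_antidiagonal_succ]
      simp only [Nat.cast_zero, zero_mul, zero_add, Finset.mul_sum]
      refine Finset.sum_congr rfl fun p hp => ?_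
      have e : shift i c (Pi.single i p.1 + Pi.single j p.2)
          = c (Pi.single i (p.1 + 1) + Pi.single j p.2) := by
        rw [shift, add_right_comm, ← Pi.single_add]
      rw [e, Nat.factorial_succ, pow_succ]
      push_cast
      field_simp
    · rw [Finset.Nat.sum_antidiagonal_succ']
      simp only [Nat.cast_zero, zero_mul, zero_add, Finset.mul_sum]
      refine Finset.sum_congr rfl fun p hp => ?_
      have e : shift j c (Pi.single i p.1 + Pi.single j p.2)
          = c (Pi.single i p.1 + Pi.single j (p.2 + 1)) := by
        rw [shift, add_assoc, ← Pi.single_add]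
      rw [e, Nat.factorial_succ, pow_succ]
      push_cast
      field_simp

/-! ### Orders of vanishing and Bernstein coefficients -/

theorem fin_three_ne : ∀ m : Fin 3, m ≠ m + 1 ∧ m ≠ m + 2 ∧ m + 1 ≠ m + 2 := by decide

theorem fin_three_cases : ∀ m i : Fin 3, i = m ∨ i = m + 1 ∨ i = m + 2 := by decide

theorem sum_fin_three {M : Type*} [AddCommMonoid M] (α : Fin 3 → M) (m : Fin 3) :
    ∑ i, α i = α m + α (m + 1) + α (m + 2) := by
  fin_cases m
  · exact Fin.sum_univ_three α
  · exact (Fin.sum_univ_three α).trans (by rw [add_rotate]; rfl)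
  · exact (Fin.sum_univ_three α).trans (by rw [← add_rotate]; rfl)

theorem le_of_sum_eq {α : Fin 3 → ℕ} {n : ℕ} (h : ∑ i, α i = n) (j : Fin 3) : α j ≤ n :=
  h ▸ Finset.single_le_sum (f := α) (fun _ _ => Nat.zero_le _) (Finset.mem_univ j)

theorem exists_eq_add_single {α : Fin 3 → ℕ} {l : Fin 3} (h : 0 < α l) :
    ∃ β : Fin 3 → ℕ, α = β + Pi.single l 1 := by
  refine ⟨α - Pi.single l 1, funext fun i => ?_⟩
  rcases eq_or_ne i l with rfl | hi
  · simp; omega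
  · simp [hi]

theorem eq_single_of_sum_eq {α : Fin 3 → ℕ} {j : Fin 3} {n : ℕ} (h : ∑ i, α i = n)
    (hj : α j = n) : α = Pi.single j n := by
  have h' : ∑ i ∈ univ.erase j, α i = 0 := by
    have := Finset.add_sum_erase univ α (Finset.mem_univ j)
    omega
  rw [Finset.sum_eq_zero_iff] at h'
  funext i
  rcases eq_or_ne i j with rfl | hi
  · simp [hj]
  · simp [hi, h' i (Finset.mem_erase.2 ⟨hi, Finset.mem_univ i⟩)]

theorem exists_pos_of_lt_sum {α : Fin 3 → ℕ} {j : Fin 3} {n : ℕ} (h : ∑ i, α i = n)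
    (hj : α j < n) : ∃ l, l ≠ j ∧ 0 < α l := by
  by_contra! hc
  have : ∑ i, α i = α j := Finset.sum_eq_single j (fun b _ hb => by have := hc b hb; omega)
    (fun h => absurd (Finset.mem_univ j) h)
  omega

theorem sum_eq_of_add_single {β : Fin 3 → ℕ} {l : Fin 3} {n : ℕ}
    (h : ∑ i, (β + (Pi.single l 1 : Fin 3 → ℕ)) i = n + 1) : ∑ i, β i = n := by
  rw [sum_add_single] at h
  omega

/-- Vanishing at a vertex in terms of the Bernstein coefficients. -/
theorem bern_mem_vanishing_vertex_iff {x : Fin 3 → Plane} (hx : tdet x ≠ 0) {n s : ℕ}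
    {c : (Fin 3 → ℕ) → ℝ} {j : Fin 3} :
    bern x n c ∈ vanishing {x j} s ↔ ∀ α, ∑ i, α i = n → n < s + α j → c α = 0 := by
  constructor
  · induction s generalizing n c with
    | zero =>
      intro _ α hα h
      have := le_of_sum_eq hα j
      omega
    | succ s ih =>
      intro h
      have hv : c (Pi.single j n) = 0 := by
        have := h.1 (x j) rfl
        rw [value_bern_vertex hx, div_eq_zero_iff] at this
        exact this.resolve_right (by positivity)
      suffices H : ∀ d α, ∑ i, α i = n → α j + d = n → d ≤ s → c α = 0 from
        fun α hα hs => H (n - α j) α hα (by have := le_of_sum_eq hα j; omega) (by omega)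
      intro d
      induction d with
      | zero =>
        intro α hα hd _
        rw [eq_single_of_sum_eq hα hd, hv]
      | succ d ihd =>
        intro α hα hd hs
        obtain ⟨n, rfl⟩ : ∃ m, n = m + 1 := ⟨n - 1, by omega⟩
        obtain ⟨l, hl, hl'⟩ := exists_pos_of_lt_sum hα (show α j < n + 1 by omega)
        obtain ⟨β, rfl⟩ := exists_eq_add_single hl'
        have hβ := sum_eq_of_add_single hα
        have hj : (β + (Pi.single l 1 : Fin 3 → ℕ)) j = β j := by simp [hl.symm]
        -- The derivative along the edge towards `x l` vanishes to order `s`, so the coefficients at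
        -- `β + e_l` and `β + e_j` agree. The second index is one step closer to the corner `n e_j`,
        -- where the coefficient is the value at the vertex up to a factor.
        have h1 := dirDeriv_mem_vanishing h (x l - x j)
        rw [dirDeriv_bern_sub hx] at h1
        have h2 := ih h1 β hβ (by omega)
        simp only [Pi.sub_apply, shift, sub_eq_zero] at h2
        rw [h2]
        refine ihd _ (by rw [sum_add_single, hβ]) ?_ (by omega)
        simp
        omega
  · induction s generalizing n c with
    | zero => exact fun _ => mem_vanishing_zero _ _
    | succ s ih =>
      intro h
      refine ⟨?_, fun i => ?_⟩
      · rintro _ rfl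
        rw [value_bern_vertex hx, h _ (by simp) (by simp), zero_div]
      · cases n with
        | zero => rw [pderiv_bern_zero]; exact Submodule.zero_mem _
        | succ n =>
          rw [pderiv_bern_succ]
          refine ih fun β hβ hs => ?_
          rw [Finset.sum_apply]
          refine Finset.sum_eq_zero fun m _ => ?_
          rw [Pi.smul_apply, shift, h _ (by rw [sum_add_single, hβ]) ?_, smul_zero]
          have : β j ≤ (β + (Pi.single m 1 : Fin 3 → ℕ)) j := by simp
          omega

/-- The tangential derivative vanishes on the edge as well, so by induction on the degree
neighbouring coefficients on the edge are equal. The value at an end point makes one of them zero.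
-/
theorem coeff_eq_zero_of_value_segment {x : Fin 3 → Plane} (hx : tdet x ≠ 0) {n : ℕ}
    {c : (Fin 3 → ℕ) → ℝ} {m : Fin 3}
    (h : ∀ y ∈ segment ℝ (x (m + 1)) (x (m + 2)), value y (bern x n c) = 0) :
    ∀ α, ∑ i, α i = n → α m = 0 → c α = 0 := by
  have hv : c (Pi.single (m + 1) n) = 0 := by
    have := h _ (left_mem_segment ℝ _ _)
    rw [value_bern_vertex hx, div_eq_zero_iff] at this
    exact this.resolve_right (by positivity)
  induction n generalizing c with
  | zero =>
    intro α hα _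
    rw [eq_single_of_sum_eq hα (j := m + 1) (by have := le_of_sum_eq hα (m + 1); omega), hv]
  | succ n ih =>
    suffices H : ∀ d α, ∑ i, α i = n + 1 → α m = 0 → α (m + 2) = d → c α = 0 from
      fun α hα hm => H _ α hα hm rfl
    intro d
    induction d with
    | zero =>
      intro α hα hm h2
      have : α (m + 1) = n + 1 := by
        rw [← hα]
        revert hm h2
        fin_cases m <;> simp [Fin.sum_univ_three] <;> omega
      rw [eq_single_of_sum_eq hα this, hv]
    | succ d ihd =>
      intro α hα hm h2
      obtain ⟨β, rfl⟩ := exists_eq_add_single (show 0 < α (m + 2) by omega)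
      have hβ := sum_eq_of_add_single hα
      obtain ⟨hm1, hm2, hm12⟩ := fin_three_ne m
      have h1 := value_dirDeriv_eq_zero_of_segment h
      rw [dirDeriv_bern_sub hx] at h1
      have h3 := ih h1 (by
        have := h1 _ (left_mem_segment ℝ _ _)
        rw [value_bern_vertex hx, div_eq_zero_iff] at this
        exact this.resolve_right (by positivity)) β hβ (by simpa [hm2] using hm)
      simp only [Pi.sub_apply, shift, sub_eq_zero] at h3
      rw [h3]
      refine ihd _ (by rw [sum_add_single, hβ]) ?_ ?_
      · simpa [hm2, hm1] using hm
      · simpa [hm12.symm] using h2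

/-- Every term with a nonzero coefficient contains the factor `λ_m`. -/
theorem value_bern_eq_zero_of_bary (x : Fin 3 → Plane) {n : ℕ} {c : (Fin 3 → ℕ) → ℝ} {m : Fin 3}
    {y : Plane} (hy : value y (bary x m) = 0) (h : ∀ α, ∑ i, α i = n → α m = 0 → c α = 0) :
    value y (bern x n c) = 0 := by
  induction n generalizing c with
  | zero => rw [bern, value_C]; exact h 0 (by simp) rfl
  | succ n ih =>
    rw [value_bern_succ]
    refine mul_eq_zero_of_right _ (Finset.sum_eq_zero fun l _ => ?_)
    rcases eq_or_ne l m with rfl | hl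
    · rw [hy, zero_mul]
    · rw [ih (c := shift l c) fun β hβ hm => h (β + Pi.single l 1) (by rw [sum_add_single, hβ])
        (by simp [hm, hl.symm]), mul_zero]

theorem value_bary_segment {x : Fin 3 → Plane} (hx : tdet x ≠ 0) {m : Fin 3} {y : Plane}
    (hy : y ∈ segment ℝ (x (m + 1)) (x (m + 2))) : value y (bary x m) = 0 := by
  rw [segment_eq_image_lineMap] at hy
  obtain ⟨t, _, rfl⟩ := hy
  rw [value_bary_lineMap hx]
  fin_cases m <;> simp

/-- Vanishing on an edge in terms of the Bernstein coefficients. -/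
theorem bern_mem_vanishing_edge_iff {x : Fin 3 → Plane} (hx : tdet x ≠ 0) {n s : ℕ}
    {c : (Fin 3 → ℕ) → ℝ} {m : Fin 3} :
    bern x n c ∈ vanishing (segment ℝ (x (m + 1)) (x (m + 2))) s ↔
      ∀ α, ∑ i, α i = n → α m < s → c α = 0 := by
  have hm1 := (fin_three_ne m).1
  constructor
  · induction s generalizing n c with
    | zero => exact fun _ α _ h => absurd h (by omega)
    | succ s ih =>
      intro h
      -- The layers `α m = d` parallel to the edge are treated one after another. The derivative in
      -- the transversal direction `x m - x (m + 1)` equates a coefficient of layer `d + 1` with one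
      -- of layer `d`.
      suffices H : ∀ d α, ∑ i, α i = n → α m = d → d ≤ s → c α = 0 from
        fun α hα hs => H _ α hα rfl (by omega)
      intro d
      induction d with
      | zero => exact fun α hα hd _ => coeff_eq_zero_of_value_segment hx h.1 α hα hd
      | succ d ihd =>
        intro α hα hd hs
        obtain ⟨β, rfl⟩ := exists_eq_add_single (show 0 < α m by omega)
        obtain ⟨n, rfl⟩ : ∃ k, n = k + 1 := ⟨n - 1, by rw [sum_add_single] at hα; omega⟩
        have hβ := sum_eq_of_add_single hα
        have hm : β m = d := by simpa using hd
        have h1 := dirDeriv_mem_vanishing h (x m - x (m + 1))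
        rw [dirDeriv_bern_sub hx] at h1
        have h2 := ih h1 β hβ (by omega)
        simp only [Pi.sub_apply, shift, sub_eq_zero] at h2
        rw [h2]
        exact ihd _ (by rw [sum_add_single, hβ]) (by simp [hm1, hm]) (by omega)
  · induction s generalizing n c with
    | zero => exact fun _ => mem_vanishing_zero _ _
    | succ s ih =>
      intro h
      refine ⟨fun y hy => value_bern_eq_zero_of_bary x (value_bary_segment hx hy)
        fun α hα hm => h α hα (by omega), fun i => ?_⟩
      cases n with
      | zero => rw [pderiv_bern_zero]; exact Submodule.zero_mem _
      | succ n =>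
        rw [pderiv_bern_succ]
        refine ih fun β hβ hs => ?_
        rw [Finset.sum_apply]
        refine Finset.sum_eq_zero fun l _ => ?_
        rw [Pi.smul_apply, shift, h _ (by rw [sum_add_single, hβ]) ?_, smul_zero]
        have : (β + (Pi.single l 1 : Fin 3 → ℕ)) m ≤ β m + 1 := by
          rcases eq_or_ne m l with rfl | hl
          · simp
          · simp [hl]
        omega

/-! ### Integrals over edges -/

/-- Integration by parts, with zero boundary terms, turns the pair `(p, q + 1)` into `(p + 1, q)`.
So the integral depends only on `p + q`. -/
theorem integral_bernstein (p q : ℕ) :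
    ∫ t in (0 : ℝ)..1, (1 - t) ^ p / p.factorial * (t ^ q / q.factorial)
      = ((p + q + 1).factorial : ℝ)⁻¹ := by
  induction q generalizing p with
  | zero =>
    have h : ∀ t : ℝ, HasDerivAt (fun t : ℝ => -((1 - t) ^ (p + 1) / (p + 1).factorial))
        ((1 - t) ^ p / p.factorial * (t ^ 0 / (0).factorial)) t := fun t => by
      refine (((((hasDerivAt_id t).const_sub 1).pow (p + 1)).div_const
        ((p + 1).factorial : ℝ)).neg).congr_deriv ?_
      rw [Nat.factorial_succ]
      push_cast
      simp
      field_simp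
    rw [intervalIntegral.integral_eq_sub_of_hasDerivAt (fun t _ => h t)
      (Continuous.intervalIntegrable (by fun_prop) _ _)]
    simp
  | succ q ih =>
    have h : ∀ t : ℝ, HasDerivAt
        (fun t : ℝ => (1 - t) ^ (p + 1) / (p + 1).factorial * (t ^ (q + 1) / (q + 1).factorial))
        ((1 - t) ^ (p + 1) / (p + 1).factorial * (t ^ q / q.factorial)
          - (1 - t) ^ p / p.factorial * (t ^ (q + 1) / (q + 1).factorial)) t := fun t => by
      refine (((((hasDerivAt_id t).const_sub 1).pow (p + 1)).div_const
        ((p + 1).factorial : ℝ)).mul (((hasDerivAt_id t).pow (q + 1)).div_const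
        ((q + 1).factorial : ℝ))).congr_deriv ?_
      rw [Nat.factorial_succ, Nat.factorial_succ]
      push_cast
      simp
      field_simp
      ring
    have h2 := intervalIntegral.integral_eq_sub_of_hasDerivAt (a := 0) (b := 1) (fun t _ => h t)
      (Continuous.intervalIntegrable (by fun_prop) _ _)
    rw [intervalIntegral.integral_sub (Continuous.intervalIntegrable (by fun_prop) _ _)
      (Continuous.intervalIntegrable (by fun_prop) _ _), ih] at h2
    have h3 : p + 1 + q + 1 = p + (q + 1) + 1 := by ring
    rw [h3] at h2
    simp at h2
    linarith

/-- The mean of a polynomial over a segment. -/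
def segMean (a b : Plane) (p : Poly) : ℝ := ∫ t in (0 : ℝ)..1, value (AffineMap.lineMap a b t) p

theorem segMean_symm (a b : Plane) (p : Poly) : segMean a b p = segMean b a p := by
  have h := intervalIntegral.integral_comp_sub_left (a := 0) (b := 1)
    (fun t : ℝ => value (AffineMap.lineMap b a t) p) 1
  simp only [AffineMap.lineMap_apply_one_sub, sub_self, sub_zero] at h
  exact h

theorem segMean_congr {a b : Plane} {p q : Poly}
    (h : ∀ y ∈ segment ℝ a b, value y p = value y q) : segMean a b p = segMean a b q := by
  rw [segment_eq_image_lineMap] at h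
  refine intervalIntegral.integral_congr fun t ht => ?_
  rw [Set.uIcc_of_le zero_le_one] at ht
  exact h _ ⟨t, ht, rfl⟩

/-- All basis functions on the edge have the same mean, so up to a factor the mean is the plain sum
of the edge coefficients. -/
theorem segMean_bern {x : Fin 3 → Plane} (hx : tdet x ≠ 0) (n : ℕ) (c : (Fin 3 → ℕ) → ℝ)
    (i j : Fin 3) :
    segMean (x i) (x j) (bern x n c) = ((n + 1).factorial : ℝ)⁻¹ *
      ∑ p ∈ HasAntidiagonal.antidiagonal n, c (Pi.single i p.1 + Pi.single j p.2) := by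
  simp only [segMean, value_bern_lineMap hx]
  rw [intervalIntegral.integral_finsetSum
    fun p _ => Continuous.intervalIntegrable (by fun_prop) _ _, Finset.mul_sum]
  refine Finset.sum_congr rfl fun p hp => ?_
  rw [intervalIntegral.integral_const_mul, integral_bernstein, HasAntidiagonal.mem_antidiagonal.1 hp,
    mul_comm]

/-- The flux of a vector field through a segment, multiplied by the orientation. -/
def flux (a b : Plane) (g : Poly × Poly) : ℝ :=
  (b - a) 0 * segMean a b g.2 - (b - a) 1 * segMean a b g.1

theorem flux_symm (a b : Plane) (g : Poly × Poly) : flux b a g = -flux a b g := by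
  simp only [flux, segMean_symm b a, PiLp.sub_apply]
  ring

/-- Adding `e_m` maps the indices of degree `n` bijectively to those of degree `n + 1` with `α m ≠
0`. The missing indices are those of the edge opposite to `m`, which produce the boundary term of
the divergence theorem. -/
theorem sum_shift_eq (n : ℕ) (c : (Fin 3 → ℕ) → ℝ) (m : Fin 3) :
    ∑ β ∈ piAntidiag univ n, shift m c β = ∑ α ∈ piAntidiag univ (n + 1), c α
      - ∑ p ∈ HasAntidiagonal.antidiagonal (n + 1),
          c (Pi.single (m + 1) p.1 + Pi.single (m + 2) p.2) := by
  obtain ⟨hm1, hm2, hm12⟩ := fin_three_ne m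
  rw [eq_sub_iff_add_eq, ← Finset.sum_filter_add_sum_filter_not (piAntidiag univ (n + 1))
    (fun α => α m ≠ 0)]
  congr 1
  · refine Finset.sum_bij' (fun β _ => β + Pi.single m 1) (fun α _ => α - Pi.single m 1)
      ?_ ?_ ?_ ?_ ?_
    · intro β hβ
      simp only [mem_piAntidiag, mem_filter] at hβ ⊢
      refine ⟨⟨by rw [sum_add_single, hβ.1], by simp⟩, by simp⟩
    · intro α hα
      simp only [mem_piAntidiag, mem_filter] at hα ⊢
      obtain ⟨β, rfl⟩ := exists_eq_add_single (Nat.pos_of_ne_zero hα.2)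
      rw [add_tsub_cancel_right]
      exact ⟨sum_eq_of_add_single hα.1.1, by simp⟩
    · intro β _
      exact add_tsub_cancel_right _ _
    · intro α hα
      simp only [mem_filter] at hα
      obtain ⟨β, rfl⟩ := exists_eq_add_single (Nat.pos_of_ne_zero hα.2)
      rw [add_tsub_cancel_right]
    · intro β _
      rfl
  · refine Finset.sum_bij' (fun p _ => Pi.single (m + 1) p.1 + Pi.single (m + 2) p.2)
      (fun α _ => (α (m + 1), α (m + 2))) ?_ ?_ ?_ ?_ ?_
    · intro p hp
      rw [HasAntidiagonal.mem_antidiagonal] at hp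
      simp only [mem_piAntidiag, mem_filter]
      refine ⟨⟨?_, by simp⟩, by simp [hm1, hm2]⟩
      rw [sum_fin_three _ m]
      simp [hm1, hm2, hm12, hm12.symm, hp]
    · intro α hα
      simp only [mem_piAntidiag, mem_filter] at hα
      rw [HasAntidiagonal.mem_antidiagonal]
      have := sum_fin_three α m
      have h1 : ∑ i, α i = n + 1 := hα.1.1
      have h2 : α m = 0 := not_not.1 hα.2
      simp only
      omega
    · intro p _
      simp [hm12, hm12.symm]
    · intro α hα
      simp only [mem_filter, not_not] at hα
      funext i
      rcases fin_three_cases m i with rfl | rfl | rfl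
      · simp [hm1, hm2, hα.2]
      · simp [hm12]
      · simp [hm12.symm]
    · intro p _
      rfl

/-- The Bernstein coefficients of the divergence. -/
def divCoeff (x : Fin 3 → Plane) (c₁ c₂ : (Fin 3 → ℕ) → ℝ) : (Fin 3 → ℕ) → ℝ :=
  ∑ m, grad x m 0 • shift m c₁ + ∑ m, grad x m 1 • shift m c₂

theorem div_bern_eq (x : Fin 3 → Plane) (n : ℕ) (c₁ c₂ : (Fin 3 → ℕ) → ℝ) :
    pderiv 0 (bern x (n + 1) c₁) + pderiv 1 (bern x (n + 1) c₂) = bern x n (divCoeff x c₁ c₂) := by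
  rw [pderiv_bern_succ, pderiv_bern_succ, ← bern_add]
  rfl

/-- The divergence theorem on a triangle, in terms of Bernstein coefficients. -/
theorem sum_divCoeff {x : Fin 3 → Plane} (hx : tdet x ≠ 0) (n : ℕ) (c₁ c₂ : (Fin 3 → ℕ) → ℝ) :
    tdet x * ∑ β ∈ piAntidiag univ n, divCoeff x c₁ c₂ β = -((n + 2).factorial : ℝ) *
      ∑ m, flux (x (m + 1)) (x (m + 2)) (bern x (n + 1) c₁, bern x (n + 1) c₂) := by
  have key : ∀ (c : (Fin 3 → ℕ) → ℝ) (i : Fin 2),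
      ∑ β ∈ piAntidiag univ n, (∑ m, grad x m i • shift m c) β
        = -((n + 2).factorial : ℝ) *
          ∑ m, grad x m i * segMean (x (m + 1)) (x (m + 2)) (bern x (n + 1) c) := by
    intro c i
    simp only [Finset.sum_apply, Pi.smul_apply, smul_eq_mul]
    rw [Finset.sum_comm]
    -- The full sum over degree `n + 1` does not depend on `m`, and the gradients of the barycentric
    -- coordinates add up to zero. Only the edge sums remain.
    simp only [← Finset.mul_sum, sum_shift_eq, mul_sub, Finset.sum_sub_distrib, ← Finset.sum_mul,
      sum_grad, zero_mul, zero_sub, segMean_bern hx]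
    rw [neg_mul, Finset.mul_sum]
    congr 1
    refine Finset.sum_congr rfl fun m _ => ?_
    have : ((n + 2).factorial : ℝ) ≠ 0 := by positivity
    field_simp
  simp only [divCoeff, Pi.add_apply, Finset.sum_add_distrib]
  rw [key, key, ← mul_add, mul_left_comm, ← Finset.sum_add_distrib, Finset.mul_sum]
  congr 1
  refine Finset.sum_congr rfl fun m _ => ?_
  rw [grad_zero, grad_one, flux]
  field_simp
  ring

/-! ### Interpolation on a triangle -/

theorem mem_vanishing_vertex_sub_iff {x : Fin 3 → Plane} (hx : tdet x ≠ 0) {n s : ℕ}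
    {c c' : (Fin 3 → ℕ) → ℝ} {j : Fin 3} :
    bern x n c - bern x n c' ∈ vanishing {x j} s ↔
      ∀ α, ∑ i, α i = n → n < s + α j → c α = c' α := by
  rw [← bern_sub, bern_mem_vanishing_vertex_iff hx]
  simp only [Pi.sub_apply, sub_eq_zero]

theorem mem_vanishing_edge_sub_iff {x : Fin 3 → Plane} (hx : tdet x ≠ 0) {n s : ℕ}
    {c c' : (Fin 3 → ℕ) → ℝ} {m : Fin 3} :
    bern x n c - bern x n c' ∈ vanishing (segment ℝ (x (m + 1)) (x (m + 2))) s ↔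
      ∀ α, ∑ i, α i = n → α m < s → c α = c' α := by
  rw [← bern_sub, bern_mem_vanishing_edge_iff hx]
  simp only [Pi.sub_apply, sub_eq_zero]

theorem add_add_le_sum {α : Fin 3 → ℕ} {n : ℕ} (h : ∑ i, α i = n) {i j : Fin 3} (hij : i ≠ j) :
    α i + α j ≤ n := by
  rw [← h, ← Finset.sum_pair (f := α) hij]
  exact Finset.sum_le_sum_of_subset (Finset.subset_univ _)

/-- Compatible data on the vertices and edges of a triangle can be interpolated. -/
theorem exists_interpolation {x : Fin 3 → Plane} (hx : tdet x ≠ 0) {n s v : ℕ}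
    (h1 : 2 * s ≤ v + 1) (h2 : 2 * v ≤ n + 1) {f g : Fin 3 → Poly}
    (hf : ∀ j, f j ∈ restrictTotalDegree (Fin 2) ℝ n)
    (hg : ∀ m, g m ∈ restrictTotalDegree (Fin 2) ℝ n)
    (hgf : ∀ m j, m ≠ j → g m - f j ∈ vanishing {x j} v) :
    ∃ h ∈ restrictTotalDegree (Fin 2) ℝ n,
      (∀ m, h - g m ∈ vanishing (segment ℝ (x (m + 1)) (x (m + 2))) s) ∧
      ∀ j, h - f j ∈ vanishing {x j} v := by
  classical
  choose cf hcf using fun j => exists_bern_eq hx (hf j)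
  choose cg hcg using fun m => exists_bern_eq hx (hg m)
  have hfg : ∀ m j, m ≠ j → ∀ α, ∑ i, α i = n → n < v + α j → cg m α = cf j α := by
    intro m j hmj
    rw [← mem_vanishing_vertex_sub_iff hx, ← hcf, ← hcg]
    exact hgf m j hmj
  -- Coefficients near a vertex come from `f`, the remaining ones near an edge from `g`. The choices
  -- are unambiguous: `2 * v ≤ n + 1` makes the vertex regions disjoint, and `2 * s ≤ v + 1` puts
  -- the overlap of two edge strips inside a vertex region.
  let c : (Fin 3 → ℕ) → ℝ := fun α =>
    if h : ∃ j, n < v + α j then cf h.choose α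
    else if h : ∃ m, α m < s then cg h.choose α else 0
  have cv : ∀ j α, ∑ i, α i = n → n < v + α j → c α = cf j α := by
    intro j α hα hj
    have h : ∃ j, n < v + α j := ⟨j, hj⟩
    have h' := h.choose_spec
    have e : h.choose = j := by
      by_contra hne
      have := add_add_le_sum hα hne
      omega
    simp only [c, dif_pos h, e]
  refine ⟨bern x n c, bern_mem_restrictTotalDegree _ _ _, fun m => ?_, fun j => ?_⟩
  · rw [hcg, mem_vanishing_edge_sub_iff hx]
    intro α hα hm
    by_cases h : ∃ j, n < v + α j
    · obtain ⟨j, hj⟩ := h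
      rw [cv j α hα hj, hfg m j _ α hα hj]
      rintro rfl
      omega
    · have h' : ∃ m, α m < s := ⟨m, hm⟩
      have h'' := h'.choose_spec
      have e : h'.choose = m := by
        by_contra hne
        apply h
        have h3 := sum_fin_three α m
        rcases fin_three_cases m h'.choose with e | e | e
        · exact absurd e hne
        · exact ⟨m + 2, by rw [e] at h''; omega⟩
        · exact ⟨m + 1, by rw [e] at h''; omega⟩
      simp only [c, dif_neg h, dif_pos h', e]
  · rw [hcf, mem_vanishing_vertex_sub_iff hx]
    exact cv j

/-! ### Bubbles -/

theorem shift_single (i : Fin 3) (β : Fin 3 → ℕ) (r : ℝ) :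
    shift i (Pi.single (β + Pi.single i 1) r) = Pi.single β r := by
  funext γ
  simp [shift, Pi.single_apply]

/-- The divergence of a scalar times a constant vector is a directional derivative, and along `x i -
x j` all but two barycentric coordinates have slope zero. -/
theorem divCoeff_direction {x : Fin 3 → Plane} (hx : tdet x ≠ 0) (i j : Fin 3)
    (c : (Fin 3 → ℕ) → ℝ) :
    divCoeff x ((x i - x j) 0 • c) ((x i - x j) 1 • c) = shift i c - shift j c := by
  have h : divCoeff x ((x i - x j) 0 • c) ((x i - x j) 1 • c)
      = ∑ m, slope x m (x i - x j) • shift m c := by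
    rw [divCoeff, ← Finset.sum_add_distrib]
    refine Finset.sum_congr rfl fun m _ => ?_
    rw [slope_eq]
    funext α
    simp only [shift, Pi.add_apply, Pi.smul_apply, smul_eq_mul]
    ring
  rw [h]
  simp [slope_sub hx, sub_smul, Finset.sum_sub_distrib]

/-- The Bernstein coefficients of degree `n` and zero outside of a box, as a submodule. -/
def boxCoeff (n lo hi : ℕ) : Submodule ℝ ((Fin 3 → ℕ) → ℝ) where
  carrier := {c | ∀ α, ∑ i, α i = n → (∃ i, α i < lo ∨ hi < α i) → c α = 0}
  zero_mem' := fun _ _ _ => rfl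
  add_mem' := fun hc hc' α h h' => by rw [Pi.add_apply, hc α h h', hc' α h h', add_zero]
  smul_mem' := fun r c hc α h h' => by rw [Pi.smul_apply, hc α h h', smul_zero]

/-- The coefficients that agree in degree `n` with the divergence of a field whose
coefficients are zero outside of a box. -/
def boxDiv (x : Fin 3 → Plane) (n lo hi : ℕ) : Submodule ℝ ((Fin 3 → ℕ) → ℝ) where
  carrier := {c | ∃ c₁ ∈ boxCoeff (n + 1) lo hi, ∃ c₂ ∈ boxCoeff (n + 1) lo hi,
    bern x n c = bern x n (divCoeff x c₁ c₂)}
  zero_mem' := ⟨0, Submodule.zero_mem _, 0, Submodule.zero_mem _, by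
    rw [← div_bern_eq, bern_zero, bern_zero]; simp⟩
  add_mem' := by
    rintro c d ⟨c₁, h1, c₂, h2, h⟩ ⟨d₁, h1', d₂, h2', h'⟩
    refine ⟨c₁ + d₁, Submodule.add_mem _ h1 h1', c₂ + d₂, Submodule.add_mem _ h2 h2', ?_⟩
    rw [bern_add, h, h', ← div_bern_eq, ← div_bern_eq, ← div_bern_eq]
    simp only [bern_add, map_add]
    ring
  smul_mem' := by
    rintro r c ⟨c₁, h1, c₂, h2, h⟩
    refine ⟨r • c₁, Submodule.smul_mem _ _ h1, r • c₂, Submodule.smul_mem _ _ h2, ?_⟩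
    rw [bern_smul, h, ← div_bern_eq, ← div_bern_eq]
    simp only [bern_smul, Derivation.map_smul, smul_add]

/-- The field with one coefficient, at the common upper index, and direction `x i - x j` has this
difference as its divergence. Hence indices below the same index of the box are equivalent modulo
divergences. -/
theorem single_sub_single_mem_boxDiv {x : Fin 3 → Plane} (hx : tdet x ≠ 0) {n lo hi : ℕ}
    {β β' : Fin 3 → ℕ} {i j : Fin 3}
    (h : β + Pi.single i 1 = β' + Pi.single j 1)
    (hbox : ∀ l, lo ≤ (β + (Pi.single i 1 : Fin 3 → ℕ)) l ∧
      (β + (Pi.single i 1 : Fin 3 → ℕ)) l ≤ hi) :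
    (Pi.single β 1 - Pi.single β' 1 : (Fin 3 → ℕ) → ℝ) ∈ boxDiv x n lo hi := by
  have hs : (Pi.single (β + Pi.single i 1) 1 : (Fin 3 → ℕ) → ℝ) ∈ boxCoeff (n + 1) lo hi := by
    rintro α _ ⟨l, hl⟩
    rw [Pi.single_apply, if_neg]
    rintro rfl
    have := hbox l
    omega
  refine ⟨_, Submodule.smul_mem _ ((x i - x j) 0) hs, _, Submodule.smul_mem _ ((x i - x j) 1) hs, ?_⟩
  rw [divCoeff_direction hx, shift_single, h, shift_single]

/-- One walks through the box in degree `n + 1`, moving a unit from a coordinate `p` that is too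
large to a coordinate `q` that is too small. Every coordinate stays between its values at the two
ends, so the walk does not leave the box. The number `d` is the total excess, which drops by one at
each move. -/
theorem single_sub_single_mem_boxDiv_of_box {x : Fin 3 → Plane} (hx : tdet x ≠ 0) {n lo hi : ℕ}
    (d : ℕ) : ∀ {β β' : Fin 3 → ℕ} {i i' : Fin 3},
    ∑ l, β l = n → ∑ l, β' l = n →
    (∀ l, lo ≤ (β + (Pi.single i 1 : Fin 3 → ℕ)) l ∧
      (β + (Pi.single i 1 : Fin 3 → ℕ)) l ≤ hi) →
    (∀ l, lo ≤ (β' + (Pi.single i' 1 : Fin 3 → ℕ)) l ∧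
      (β' + (Pi.single i' 1 : Fin 3 → ℕ)) l ≤ hi) →
    ∑ l, ((β + (Pi.single i 1 : Fin 3 → ℕ)) l - (β' + (Pi.single i' 1 : Fin 3 → ℕ)) l) = d →
    (Pi.single β 1 - Pi.single β' 1 : (Fin 3 → ℕ) → ℝ) ∈ boxDiv x n lo hi := by
  induction d with
  | zero =>
    intro β β' i i' hβ hβ' hb hb' hd
    refine single_sub_single_mem_boxDiv hx (i := i) (j := i') ?_ hb
    rw [Finset.sum_eq_zero_iff] at hd
    have hle : ∀ l ∈ univ, (β + (Pi.single i 1 : Fin 3 → ℕ)) l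
        ≤ (β' + (Pi.single i' 1 : Fin 3 → ℕ)) l := fun l hl => by
      have := hd l hl
      omega
    have := (Finset.sum_eq_sum_iff_of_le hle).1 (by rw [sum_add_single, sum_add_single, hβ, hβ'])
    exact funext fun l => this l (Finset.mem_univ l)
  | succ d ih =>
    intro β β' i i' hβ hβ' hb hb' hd
    obtain ⟨p, hp⟩ : ∃ p, (β' + (Pi.single i' 1 : Fin 3 → ℕ)) p
        < (β + (Pi.single i 1 : Fin 3 → ℕ)) p := by
      by_contra! hc
      rw [Finset.sum_eq_zero fun l _ => Nat.sub_eq_zero_of_le (hc l)] at hd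
      omega
    obtain ⟨q, hq⟩ : ∃ q, (β + (Pi.single i 1 : Fin 3 → ℕ)) q
        < (β' + (Pi.single i' 1 : Fin 3 → ℕ)) q := by
      by_contra! hc
      have := Finset.sum_lt_sum (fun l (_ : l ∈ univ) => hc l) ⟨p, Finset.mem_univ p, hp⟩
      rw [sum_add_single, sum_add_single, hβ, hβ'] at this
      omega
    obtain ⟨γ, hγ⟩ := exists_eq_add_single (α := β + (Pi.single i 1 : Fin 3 → ℕ)) (l := p)
      (by omega)
    have hγs : ∑ l, γ l = n := sum_eq_of_add_single (l := p) (by rw [← hγ, sum_add_single, hβ])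
    have hpq : p ≠ q := by rintro rfl; omega
    have hbγ : ∀ l, lo ≤ (γ + (Pi.single q 1 : Fin 3 → ℕ)) l ∧
        (γ + (Pi.single q 1 : Fin 3 → ℕ)) l ≤ hi := by
      intro l
      have e1 := hb l
      have e2 := hb' l
      rw [hγ] at e1 hp hq
      rcases eq_or_ne l p with rfl | hlp
      · simp [hpq] at e1 e2 hp hq ⊢
        omega
      · rcases eq_or_ne l q with rfl | hlq
        · simp [hlp] at e1 e2 hp hq ⊢
          omega
        · simpa [hlp, hlq] using e1
    have h1 := single_sub_single_mem_boxDiv hx (n := n) hγ hb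
    have h2 := ih hγs hβ' hbγ hb' (by
      have e : ∀ l, (β + (Pi.single i 1 : Fin 3 → ℕ)) l - (β' + (Pi.single i' 1 : Fin 3 → ℕ)) l
          = ((γ + (Pi.single q 1 : Fin 3 → ℕ)) l - (β' + (Pi.single i' 1 : Fin 3 → ℕ)) l)
            + (Pi.single p 1 : Fin 3 → ℕ) l := by
        intro l
        rw [hγ] at hp hq ⊢
        rcases eq_or_ne l p with rfl | hlp
        · simp [hpq] at hp ⊢
          omega
        · rcases eq_or_ne l q with rfl | hlq
          · simp [hlp] at hq ⊢
            omega
          · simp [hlp, hlq]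
      simp only [e, Finset.sum_add_distrib] at hd
      simpa using hd)
    simpa using Submodule.add_mem _ h1 h2

/-- Coefficients with zero sum in a box are those of the divergence of a bubble. -/
theorem exists_bubble {x : Fin 3 → Plane} (hx : tdet x ≠ 0) {n r s M : ℕ} (hr : 1 ≤ r)
    (hs : 2 * r ≤ s) (hM : s ≤ M) (hn : n + 1 = M + s) {c : (Fin 3 → ℕ) → ℝ}
    (hc : c ∈ boxCoeff n (r - 1) M) (h0 : ∑ β ∈ piAntidiag univ n, c β = 0) :
    c ∈ boxDiv x n r M := by
  -- Every index of the larger box in degree `n` lies below an index of the smaller box in degree `n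
  -- + 1`. By `2 * r ≤ s` at most one coordinate equals `r - 1`, since otherwise the third would
  -- exceed `M`; that coordinate is raised. If there is none, any coordinate below `M` can be
  -- raised, and one exists because `n < 3 * M`.
  have adj : ∀ β : Fin 3 → ℕ, ∑ l, β l = n → (∀ l, r - 1 ≤ β l ∧ β l ≤ M) →
      ∃ i, ∀ l, r ≤ (β + (Pi.single i 1 : Fin 3 → ℕ)) l ∧
        (β + (Pi.single i 1 : Fin 3 → ℕ)) l ≤ M := by
    intro β hβ hb
    have h3 := sum_fin_three β
    by_cases h : ∃ m, β m = r - 1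
    · obtain ⟨m, hm⟩ := h
      refine ⟨m, fun l => ?_⟩
      have := h3 m
      have b1 := hb (m + 1)
      have b2 := hb (m + 2)
      obtain ⟨m1, m2, m12⟩ := fin_three_ne m
      rcases fin_three_cases m l with rfl | rfl | rfl
      · simp; omega
      · simp [m1.symm]; omega
      · simp [m2.symm]; omega
    · push Not at h
      obtain ⟨j, hj⟩ : ∃ j, β j < M := by
        by_contra! hc
        have := h3 0
        have b0 := hc 0
        have b1 := hc (0 + 1)
        have b2 := hc (0 + 2)
        omega
      refine ⟨j, fun l => ?_⟩
      have b := hb l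
      have b' := h l
      rcases eq_or_ne l j with rfl | hl
      · simp; omega
      · simp [hl]; omega
  have box_of_ne : ∀ β : Fin 3 → ℕ, ∑ l, β l = n → c β ≠ 0 → ∀ l, r - 1 ≤ β l ∧ β l ≤ M := by
    intro β hβ hne l
    by_contra hcon
    exact hne (hc β hβ ⟨l, by omega⟩)
  have hmem : ∀ c', (∀ α, ∑ i, α i = n → c α = c' α) → c' ∈ boxDiv x n r M →
      c ∈ boxDiv x n r M := by
    rintro c' h ⟨c₁, h1, c₂, h2, h'⟩
    exact ⟨c₁, h1, c₂, h2, (bern_congr x h).trans h'⟩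
  by_cases hz : ∃ β₀ : Fin 3 → ℕ, ∑ l, β₀ l = n ∧ c β₀ ≠ 0
  · obtain ⟨β₀, hβ₀, hne⟩ := hz
    obtain ⟨i₀, hi₀⟩ := adj β₀ hβ₀ (box_of_ne β₀ hβ₀ hne)
    -- Since the coefficients have sum zero, subtracting the unit coefficient at the fixed index
    -- `β₀` from each term changes nothing.
    refine hmem (∑ β ∈ piAntidiag univ n, c β • (Pi.single β 1 - Pi.single β₀ 1)) ?_ ?_
    · intro α hα
      have hα' : α ∈ piAntidiag univ n := mem_piAntidiag.2 ⟨hα, by simp⟩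
      rw [Finset.sum_apply]
      simp only [Pi.smul_apply, Pi.sub_apply, smul_eq_mul, mul_sub, Finset.sum_sub_distrib,
        ← Finset.sum_mul, h0, zero_mul, sub_zero]
      rw [Finset.sum_eq_single α (fun β _ hβ => by simp [hβ.symm])
        (fun h => absurd hα' h)]
      simp
    · refine Submodule.sum_mem _ fun β hβ => ?_
      by_cases hcβ : c β = 0
      · rw [hcβ, zero_smul]
        exact Submodule.zero_mem _
      · have hβ' : ∑ l, β l = n := (mem_piAntidiag.1 hβ).1
        obtain ⟨i, hi⟩ := adj β hβ' (box_of_ne β hβ' hcβ)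
        exact Submodule.smul_mem _ _
          (single_sub_single_mem_boxDiv_of_box hx _ hβ' hβ₀ hi hi₀ rfl)
  · push Not at hz
    exact hmem 0 hz (Submodule.zero_mem _)

/-! ### Vector fields near an edge -/

theorem segMean_add (a b : Plane) (p q : Poly) :
    segMean a b (p + q) = segMean a b p + segMean a b q := by
  simp only [segMean, value_add]
  exact intervalIntegral.integral_add ((continuous_value_lineMap a b p).intervalIntegrable _ _)
    ((continuous_value_lineMap a b q).intervalIntegrable _ _)

theorem segMean_smul (a b : Plane) (r : ℝ) (p : Poly) :
    segMean a b (r • p) = r * segMean a b p := by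
  simp only [segMean, value_smul, intervalIntegral.integral_const_mul]

theorem flux_add (a b : Plane) (g g' : Poly × Poly) :
    flux a b (g + g') = flux a b g + flux a b g' := by
  simp only [flux, Prod.fst_add, Prod.snd_add, segMean_add]
  ring

theorem flux_direction (a b w : Plane) (p : Poly) :
    flux a b (w 0 • p, w 1 • p) = cross (b - a) w * segMean a b p := by
  simp only [flux, segMean_smul, cross]
  ring

theorem div_direction (w : Plane) (p : Poly) :
    pderiv 0 (w 0 • p) + pderiv 1 (w 1 • p) = dirDeriv w p := by
  simp only [Derivation.map_smul, dirDeriv]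

/-- An antiderivative of the coefficients in the direction from the first to the third vertex. -/
def antiCoeff (c : (Fin 3 → ℕ) → ℝ) : (Fin 3 → ℕ) → ℝ := fun α =>
  ∑ l ∈ range (α 2), c ![α 0 + l, α 1, α 2 - (l + 1)]

/-- The two sums run along the same line of indices and differ only in their first term. -/
theorem shift_antiCoeff (c : (Fin 3 → ℕ) → ℝ) :
    shift 2 (antiCoeff c) - shift 0 (antiCoeff c) = c := by
  funext β
  have h20 : (2 : Fin 3) ≠ 0 := by decide
  have h21 : (2 : Fin 3) ≠ 1 := by decide
  have h10 : (1 : Fin 3) ≠ 0 := by decide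
  have e : ![β 0, β 1, β 2] = β := by
    funext i
    fin_cases i <;> rfl
  simp only [Pi.sub_apply, shift, antiCoeff, Pi.add_apply, Pi.single_eq_same,
    Pi.single_eq_of_ne h20, Pi.single_eq_of_ne h20.symm, Pi.single_eq_of_ne h21.symm,
    Pi.single_eq_of_ne h10, add_zero]
  rw [Finset.sum_range_succ']
  simp only [add_zero, zero_add, Nat.add_sub_cancel, e, Nat.add_sub_add_right]
  rw [add_sub_right_comm, add_eq_right, sub_eq_zero]
  refine Finset.sum_congr rfl fun l _ => ?_
  rw [add_assoc, add_comm 1 l]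

/-- On an edge, jets at the end points, the divergence, and the flux can be prescribed. -/
theorem exists_edge_field {x : Fin 3 → Plane} (hx : tdet x ≠ 0) {n v : ℕ} (hv : 1 ≤ v)
    (hn : 2 * v ≤ n + 1) {q : Poly} (hq : q ∈ restrictTotalDegree (Fin 2) ℝ n)
    {f : Fin 3 → Poly × Poly} (hf₁ : ∀ j, (f j).1 ∈ restrictTotalDegree (Fin 2) ℝ (n + 1))
    (hf₂ : ∀ j, (f j).2 ∈ restrictTotalDegree (Fin 2) ℝ (n + 1))
    (hfq : ∀ j, j ≠ 2 → q - (pderiv 0 (f j).1 + pderiv 1 (f j).2) ∈ vanishing {x j} (v - 1))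
    (F : ℝ) :
    ∃ g : Poly × Poly, g.1 ∈ restrictTotalDegree (Fin 2) ℝ (n + 1) ∧
      g.2 ∈ restrictTotalDegree (Fin 2) ℝ (n + 1) ∧
      (∀ j, j ≠ 2 → g.1 - (f j).1 ∈ vanishing {x j} v ∧ g.2 - (f j).2 ∈ vanishing {x j} v) ∧
      pderiv 0 g.1 + pderiv 1 g.2 = q ∧ flux (x 0) (x 1) g = F := by
  have h12 : ∀ j : Fin 3, j ≠ 2 → j = 0 ∨ j = 1 := by decide
  have jets : ∀ p : Fin 3 → Poly, (∀ j, p j ∈ restrictTotalDegree (Fin 2) ℝ (n + 1)) →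
      ∃ c, ∀ j, j ≠ 2 → bern x (n + 1) c - p j ∈ vanishing {x j} v := by
    intro p hp
    choose cp hcp using fun j => exists_bern_eq hx (hp j)
    refine ⟨fun α => if n + 1 < v + α 0 then cp 0 α else cp 1 α, fun j hj => ?_⟩
    rw [hcp, mem_vanishing_vertex_sub_iff hx]
    intro α hα h
    rcases h12 j hj with rfl | rfl
    · rw [if_pos h]
    · rw [if_neg]
      have := add_add_le_sum hα (show (0 : Fin 3) ≠ 1 by decide)
      omega
  obtain ⟨c₁, hc₁⟩ := jets _ hf₁
  obtain ⟨c₂, hc₂⟩ := jets _ hf₂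
  set w : Plane := x 2 - x 0 with hw
  -- a bubble on the edge with a nonzero mean
  let γ : Fin 3 → ℕ := ![n + 1 - v, v, 0]
  have hγ : ∑ i, γ i = n + 1 := by
    simp [γ, Fin.sum_univ_three]
    omega
  set b : Poly := bern x (n + 1) (Pi.single γ 1) with hb
  have hbv : ∀ j, j ≠ 2 → b ∈ vanishing {x j} v := by
    intro j hj
    rw [hb, bern_mem_vanishing_vertex_iff hx]
    intro α hα h
    rw [Pi.single_apply, if_neg]
    rintro rfl
    rcases h12 j hj with rfl | rfl <;> simp [γ] at h <;> omega
  have hbm : segMean (x 0) (x 1) b ≠ 0 := by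
    rw [hb, segMean_bern hx]
    refine mul_ne_zero (by positivity) ?_
    rw [Finset.sum_eq_single (n + 1 - v, v)]
    · have : (Pi.single 0 (n + 1 - v) + Pi.single 1 v : Fin 3 → ℕ) = γ := by
        funext i
        fin_cases i <;> simp [γ]
      simp [this]
    · intro p _ hp
      rw [Pi.single_apply, if_neg]
      intro h
      have e0 := congrFun h 0
      have e1 := congrFun h 1
      simp [γ] at e0 e1
      exact hp (Prod.ext e0 e1)
    · intro h
      exact absurd (HasAntidiagonal.mem_antidiagonal.2 (by simp; omega)) h
  have hcw : cross (x 1 - x 0) w ≠ 0 := hx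
  set g₀ : Poly × Poly := (bern x (n + 1) c₁, bern x (n + 1) c₂) with hg₀
  -- The vector `w` is transversal to the edge, so adding `t * b` in this direction changes the flux
  -- by `t` times this nonzero denominator. The jets at the end points stay, because `b` vanishes
  -- there to order `v`.
  set t : ℝ := (F - flux (x 0) (x 1) g₀) / (cross (x 1 - x 0) w * segMean (x 0) (x 1) b) with ht
  set g₁ : Poly × Poly := g₀ + (w 0 • t • b, w 1 • t • b) with hg₁
  have hg₁F : flux (x 0) (x 1) g₁ = F := by
    rw [hg₁, flux_add, flux_direction, segMean_smul, ht]
    field_simp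
    ring
  have hg₁d : g₁.1 ∈ restrictTotalDegree (Fin 2) ℝ (n + 1) ∧
      g₁.2 ∈ restrictTotalDegree (Fin 2) ℝ (n + 1) := by
    constructor <;>
    exact Submodule.add_mem _ (bern_mem_restrictTotalDegree _ _ _) (Submodule.smul_mem _ _
      (Submodule.smul_mem _ _ (bern_mem_restrictTotalDegree _ _ _)))
  have hg₁f : ∀ j, j ≠ 2 →
      g₁.1 - (f j).1 ∈ vanishing {x j} v ∧ g₁.2 - (f j).2 ∈ vanishing {x j} v := by
    intro j hj
    have hb' : ∀ r : ℝ, r • t • b ∈ vanishing {x j} v := fun r =>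
      Submodule.smul_mem _ _ (Submodule.smul_mem _ _ (hbv j hj))
    constructor
    · have := Submodule.add_mem _ (hc₁ j hj) (hb' (w 0))
      rw [sub_add_eq_add_sub] at this
      exact this
    · have := Submodule.add_mem _ (hc₂ j hj) (hb' (w 1))
      rw [sub_add_eq_add_sub] at this
      exact this
  -- correction of the divergence
  have hdeg : q - (pderiv 0 g₁.1 + pderiv 1 g₁.2) ∈ restrictTotalDegree (Fin 2) ℝ n :=
    Submodule.sub_mem _ hq (Submodule.add_mem _ (pderiv_mem_restrictTotalDegree hg₁d.1 0)
      (pderiv_mem_restrictTotalDegree hg₁d.2 1))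
  obtain ⟨c, hc⟩ := exists_bern_eq hx hdeg
  have hcv : ∀ j, j ≠ 2 → ∀ α, ∑ i, α i = n → n < v - 1 + α j → c α = 0 := by
    intro j hj
    rw [← bern_mem_vanishing_vertex_iff hx, ← hc]
    obtain ⟨u, rfl⟩ : ∃ u, v = u + 1 := ⟨v - 1, by omega⟩
    have h1 := (hg₁f j hj).1.2 0
    have h2 := (hg₁f j hj).2.2 1
    have := Submodule.sub_mem _ (hfq j hj) (Submodule.add_mem _ h1 h2)
    rw [map_sub, map_sub] at this
    convert this using 1
    ring
  -- This antiderivative of the error along `w` has no coefficients with `α 2 = 0`. So it vanishes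
  -- on the edge and does not change the flux. The zeros of `c` near the vertices 0 and 1 carry over
  -- with one more order, which preserves the jets.
  set p : Poly := bern x (n + 1) (antiCoeff c) with hp
  have hpv : ∀ j, j ≠ 2 → p ∈ vanishing {x j} v := by
    intro j hj
    rw [hp, bern_mem_vanishing_vertex_iff hx]
    intro α hα h
    refine Finset.sum_eq_zero fun l hl => hcv j hj _ ?_ ?_
    · rw [Finset.mem_range] at hl
      rw [Fin.sum_univ_three] at hα ⊢
      simp
      omega
    · rcases h12 j hj with rfl | rfl <;> simp <;> omega
  have hp0 : segMean (x 0) (x 1) p = 0 := by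
    have h : ∀ y ∈ segment ℝ (x 0) (x 1), value y p = value y 0 := by
      intro y hy
      rw [value_zero]
      refine value_bern_eq_zero_of_bary x (m := 2) (value_bary_segment hx hy) fun α _ hm => ?_
      simp [antiCoeff, hm]
    rw [segMean_congr h]
    simp [segMean, value_zero]
  have hpd : dirDeriv w p = q - (pderiv 0 g₁.1 + pderiv 1 g₁.2) := by
    rw [hp, hw, dirDeriv_bern_sub hx, shift_antiCoeff, hc]
  refine ⟨g₁ + (w 0 • p, w 1 • p), ?_, ?_, ?_, ?_, ?_⟩
  · exact Submodule.add_mem _ hg₁d.1 (Submodule.smul_mem _ _ (bern_mem_restrictTotalDegree _ _ _))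
  · exact Submodule.add_mem _ hg₁d.2 (Submodule.smul_mem _ _ (bern_mem_restrictTotalDegree _ _ _))
  · intro j hj
    have h1 := Submodule.add_mem _ (hg₁f j hj).1 (Submodule.smul_mem _ (w 0) (hpv j hj))
    have h2 := Submodule.add_mem _ (hg₁f j hj).2 (Submodule.smul_mem _ (w 1) (hpv j hj))
    rw [sub_add_eq_add_sub] at h1 h2
    exact ⟨h1, h2⟩
  · rw [Prod.fst_add, Prod.snd_add, map_add, map_add, add_add_add_comm]
    simp only
    rw [div_direction, hpd]
    ring
  · rw [flux_add, hg₁F, flux_direction, hp0]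
    ring

/-! ### Triangles of a grid -/

variable {T : Geometry.SimplicialComplex ℝ Plane} {Ω : Set Plane}

theorem exists_smul_eq_of_cross_eq_zero {u v : Plane} (hu : u ≠ 0) (h : cross u v = 0) :
    ∃ r : ℝ, v = r • u := by
  rw [cross, sub_eq_zero] at h
  by_cases h0 : u 0 = 0
  · have h1 : u 1 ≠ 0 := fun h1 => hu (by ext i; fin_cases i <;> simp [h0, h1])
    have hv : v 0 = 0 := by
      rw [h0, zero_mul, zero_eq_mul] at h
      exact h.resolve_left h1
    refine ⟨v 1 / u 1, ?_⟩
    ext i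
    fin_cases i
    · simp [h0, hv]
    · simp [h1]
  · refine ⟨v 0 / u 0, ?_⟩
    ext i
    fin_cases i
    · simp [h0]
    · simp only [Fin.mk_one, PiLp.smul_apply, smul_eq_mul]
      field_simp
      linarith

theorem tdet_ne_zero_of_affineIndependent {x : Fin 3 → Plane} (h : AffineIndependent ℝ x) :
    tdet x ≠ 0 := by
  intro h0
  rw [affineIndependent_iff_not_collinear] at h
  apply h
  by_cases hu : x 1 - x 0 = 0
  · rw [sub_eq_zero] at hu
    refine (collinear_iff_of_mem (Set.mem_range_self 0)).2 ⟨x 2 - x 0, ?_⟩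
    rintro _ ⟨i, rfl⟩
    fin_cases i
    · exact ⟨0, by simp⟩
    · exact ⟨0, by simp [hu]⟩
    · exact ⟨1, by simp⟩
  · obtain ⟨r, hr⟩ := exists_smul_eq_of_cross_eq_zero hu h0
    refine (collinear_iff_of_mem (Set.mem_range_self 0)).2 ⟨x 1 - x 0, ?_⟩
    rintro _ ⟨i, rfl⟩
    fin_cases i
    · exact ⟨0, by simp⟩
    · exact ⟨1, by simp⟩
    · exact ⟨r, by rw [← hr]; simp⟩

theorem Triangle.tdet_ne_zero (K : Triangle T) {x : Fin 3 → Plane} (hx : Function.Injective x)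
    (hK : ∀ i, x i ∈ K.1) : tdet x ≠ 0 := by
  have := (T.indep K.2.1).comp_embedding (⟨fun i => ⟨x i, hK i⟩, fun i j h => hx (by
    simpa using h)⟩ : Fin 3 ↪ K.1)
  exact tdet_ne_zero_of_affineIndependent this

/-- Two vertices of a triangle extend to an enumeration of its vertices. -/
theorem Triangle.exists_enum (K : Triangle T) {a b : Plane} (hab : a ≠ b) (ha : a ∈ K.1)
    (hb : b ∈ K.1) : ∃ x : Fin 3 → Plane, x 0 = a ∧ x 1 = b ∧ tdet x ≠ 0 ∧
      ∀ y, y ∈ K.1 ↔ ∃ i, y = x i := by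
  classical
  have hb' : b ∈ K.1.erase a := Finset.mem_erase.2 ⟨hab.symm, hb⟩
  have h1 : ((K.1.erase a).erase b).card = 1 := by
    rw [Finset.card_erase_of_mem hb', Finset.card_erase_of_mem ha, K.2.2]
  obtain ⟨c, hc⟩ := Finset.card_eq_one.1 h1
  have hc' : c ∈ (K.1.erase a).erase b := by rw [hc]; exact Finset.mem_singleton_self c
  simp only [Finset.mem_erase] at hc'
  refine ⟨![a, b, c], rfl, rfl, K.tdet_ne_zero ?_ ?_, fun y => ?_⟩
  · intro i j hij
    fin_cases i <;> fin_cases j <;> simp_all [eq_comm]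
  · intro i
    fin_cases i
    · exact ha
    · exact hb
    · exact hc'.2.2
  · have : y ∈ (K.1.erase a).erase b ↔ y = c := by rw [hc, Finset.mem_singleton]
    simp only [Finset.mem_erase] at this
    simp only [Fin.exists_fin_succ]
    constructor
    · intro hy
      by_cases h1 : y = a
      · exact Or.inl h1
      · by_cases h2 : y = b
        · exact Or.inr (Or.inl h2)
        · exact Or.inr (Or.inr (Or.inl (this.1 ⟨h2, h1, hy⟩)))
    · rintro (rfl | rfl | h | h)
      · exact ha
      · exact hb
      · exact (this.2 h).2.2
      · exact absurd h (by simp)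

theorem Triangle.exists_enum' (K : Triangle T) : ∃ x : Fin 3 → Plane, 0 < tdet x ∧
    ∀ y, y ∈ K.1 ↔ ∃ i, y = x i := by
  obtain ⟨a, ha, b, hb, hab⟩ := Finset.one_lt_card.1 (show 1 < K.1.card by rw [K.2.2]; norm_num)
  obtain ⟨x, -, -, h0, hx⟩ := K.exists_enum hab ha hb
  rcases lt_or_gt_of_ne h0 with h | h
  · refine ⟨![x 1, x 0, x 2], ?_, fun y => ?_⟩
    · have : tdet ![x 1, x 0, x 2] = -tdet x := by
        simp [tdet, cross]
        ring
      rw [this]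
      linarith
    · rw [hx]
      simp only [Fin.exists_fin_succ]
      simp
      tauto
  · exact ⟨x, h, hx⟩

theorem enum_injective {x : Fin 3 → Plane} (hx : tdet x ≠ 0) : Function.Injective x := by
  intro i j hij
  by_contra hne
  have h1 := value_bary_vertex hx i i
  have h2 := value_bary_vertex hx i j
  rw [← hij, h1, if_pos rfl, if_neg hne] at h2
  norm_num at h2

theorem Triangle.finite (hT : IsTriangularGrid T Ω) : Finite (Triangle T) :=
  (hT.finite.subset fun _ h => h.1 : {K : Finset Plane | K ∈ T.faces ∧ K.card = 3}.Finite)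

theorem mem_space_iff_exists_triangle (hT : IsTriangularGrid T Ω) {y : Plane} :
    y ∈ T.space ↔ ∃ K : Triangle T, y ∈ convexHull ℝ (K.1 : Set Plane) := by
  rw [Geometry.SimplicialComplex.mem_space_iff]
  constructor
  · rintro ⟨s, hs, hy⟩
    obtain ⟨t, ht, h3, hst⟩ := hT.pure s hs
    exact ⟨⟨t, ht, h3⟩, convexHull_mono (by exact_mod_cast hst) hy⟩
  · rintro ⟨K, hK⟩
    exact ⟨K.1, K.2.1, hK⟩

theorem isClosed_convexHull_triangle (K : Triangle T) :
    IsClosed (convexHull ℝ (K.1 : Set Plane)) :=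
  (K.1.finite_toSet.isCompact_convexHull (𝕜 := ℝ)).isClosed

theorem segment_subset_triangle {K : Triangle T} {a b : Plane} (ha : a ∈ K.1) (hb : b ∈ K.1) :
    segment ℝ a b ⊆ convexHull ℝ (K.1 : Set Plane) :=
  segment_subset_convexHull ha hb

/-- A point common to two triangles lies on a common vertex or edge. -/
theorem Triangle.inter_cases {K K' : Triangle T} {y : Plane}
    (hy : y ∈ convexHull ℝ (K.1 : Set Plane)) (hy' : y ∈ convexHull ℝ (K'.1 : Set Plane)) :
    K = K' ∨ (y ∈ K.1 ∧ y ∈ K'.1) ∨ ∃ a b, a ≠ b ∧ a ∈ K.1 ∧ b ∈ K.1 ∧ a ∈ K'.1 ∧ b ∈ K'.1 ∧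
      y ∈ segment ℝ a b := by
  classical
  -- In a simplicial complex the intersection of two triangles is spanned by their common vertices.
  -- The cases are the number of these.
  have h := T.inter_subset_convexHull K.2.1 K'.2.1 ⟨hy, hy'⟩
  rw [← Finset.coe_inter] at h
  have hcard : (K.1 ∩ K'.1).card ≤ 3 := (Finset.card_le_card Finset.inter_subset_left).trans_eq K.2.2
  obtain h0 | h1 | h2 | h3 : (K.1 ∩ K'.1).card = 0 ∨ (K.1 ∩ K'.1).card = 1 ∨
    (K.1 ∩ K'.1).card = 2 ∨ (K.1 ∩ K'.1).card = 3 := by omega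
  · rw [Finset.card_eq_zero] at h0
    simp [h0] at h
  · obtain ⟨a, ha⟩ := Finset.card_eq_one.1 h1
    simp only [ha, Finset.coe_singleton, convexHull_singleton, Set.mem_singleton_iff] at h
    have : y ∈ K.1 ∩ K'.1 := by rw [ha, h]; exact Finset.mem_singleton_self a
    exact Or.inr (Or.inl (Finset.mem_inter.1 this))
  · obtain ⟨a, b, hab, he⟩ := Finset.card_eq_two.1 h2
    simp only [he, Finset.coe_pair, convexHull_pair] at h
    have ha : a ∈ K.1 ∩ K'.1 := by rw [he]; simp
    have hb : b ∈ K.1 ∩ K'.1 := by rw [he]; simp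
    rw [Finset.mem_inter] at ha hb
    exact Or.inr (Or.inr ⟨a, b, hab, ha.1, hb.1, ha.2, hb.2, h⟩)
  · have e1 := Finset.eq_of_subset_of_card_le
      (Finset.inter_subset_left : K.1 ∩ K'.1 ⊆ K.1) (by rw [h3, K.2.2])
    have e2 := Finset.eq_of_subset_of_card_le
      (Finset.inter_subset_right : K.1 ∩ K'.1 ⊆ K'.1) (by rw [h3, K'.2.2])
    exact Or.inl (Subtype.ext (e1.symm.trans e2))

/-! ### The finite element spaces in terms of orders of vanishing -/

theorem vertexDOF_sub (x : Plane) (i j : ℕ) (p q : Poly) :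
    vertexDOF x i j (p - q) = vertexDOF x i j p - vertexDOF x i j q := by
  rw [eq_sub_iff_add_eq, ← vertexDOF_add, sub_add_cancel]

theorem edgeDOF_sub (a b n : Plane) (θ i j : ℕ) (p q : Poly) :
    edgeDOF a b n θ i j (p - q) = edgeDOF a b n θ i j p - edgeDOF a b n θ i j q := by
  rw [eq_sub_iff_add_eq, ← edgeDOF_add, sub_add_cancel]

theorem exists_unit_normal {u : Plane} (hu : u ≠ 0) :
    ∃ n : Plane, ‖n‖ = 1 ∧ inner ℝ n u = 0 ∧ cross u n ≠ 0 := by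
  have h0 : 0 < u 0 ^ 2 + u 1 ^ 2 := by
    by_contra! h
    apply hu
    ext i
    fin_cases i <;> simp <;> nlinarith [sq_nonneg (u 0), sq_nonneg (u 1)]
  have hρ : 0 < √(u 0 ^ 2 + u 1 ^ 2) := Real.sqrt_pos.2 h0
  have hρ2 := Real.sq_sqrt h0.le
  set ρ := √(u 0 ^ 2 + u 1 ^ 2)
  refine ⟨!₂[-u 1 / ρ, u 0 / ρ], ?_, ?_, ?_⟩
  · rw [EuclideanSpace.norm_eq, Real.sqrt_eq_one, Fin.sum_univ_two]
    simp [div_pow]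
    field_simp
    linarith
  · simp [PiLp.inner_apply, Fin.sum_univ_two]
    ring
  · have : cross u !₂[-u 1 / ρ, u 0 / ρ] = ρ := by
      simp [cross]
      field_simp
      linarith
    rw [this]
    exact hρ.ne'

/-- The moments on an edge determine a polynomial that vanishes at the end points of the edge
to the appropriate order. -/
theorem value_eq_zero_of_moments {x : Fin 3 → Plane} (hx : tdet x ≠ 0) {N s : ℕ} {p : Poly}
    (hp : p ∈ restrictTotalDegree (Fin 2) ℝ N) (h0 : p ∈ vanishing {x 0} s)
    (h1 : p ∈ vanishing {x 1} s)
    (h : ∀ i j, i + j = N → s ≤ i → s ≤ j → ∫ t in (0 : ℝ)..1,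
      value (AffineMap.lineMap (x 0) (x 1) t) p * ((1 - t) ^ i * t ^ j) = 0) :
    ∀ y ∈ segment ℝ (x 0) (x 1), value y p = 0 := by
  obtain ⟨c, rfl⟩ := exists_bern_eq hx hp
  rw [bern_mem_vanishing_vertex_iff hx] at h0 h1
  set w : ℝ → ℝ := fun t => value (AffineMap.lineMap (x 0) (x 1) t) (bern x N c) with hw
  have hwc : Continuous w := continuous_value_lineMap _ _ _
  -- One factor is expanded in Bernstein form. The terms with both exponents at least `s` are zero
  -- by the moment conditions, the others by vanishing at the end points.
  have key : ∫ t in (0 : ℝ)..1, w t * w t = 0 := by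
    have e : ∀ z t, z * w t = ∑ p ∈ HasAntidiagonal.antidiagonal N,
        c (Pi.single 0 p.1 + Pi.single 1 p.2) / (p.1.factorial * p.2.factorial) *
          (z * ((1 - t) ^ p.1 * t ^ p.2)) := fun z t => by
      have e' : w t = _ := value_bern_lineMap hx N c 0 1 t
      rw [e', Finset.mul_sum]
      refine Finset.sum_congr rfl fun p _ => ?_
      field_simp
    rw [funext fun t => e (w t) t]
    rw [intervalIntegral.integral_finsetSum
      fun p _ => Continuous.intervalIntegrable (by fun_prop) _ _]
    refine Finset.sum_eq_zero fun p hp => ?_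
    rw [HasAntidiagonal.mem_antidiagonal] at hp
    rw [intervalIntegral.integral_const_mul]
    have hs : ∑ i, (Pi.single 0 p.1 + Pi.single 1 p.2 : Fin 3 → ℕ) i = N := by
      rw [Fin.sum_univ_three]
      simp [hp]
    by_cases hi : s ≤ p.1
    · by_cases hj : s ≤ p.2
      · rw [h _ _ hp hi hj, mul_zero]
      · rw [h0 _ hs (by simp; omega), zero_div, zero_mul]
    · rw [h1 _ hs (by simp; omega), zero_div, zero_mul]
  intro y hy
  rw [segment_eq_image_lineMap] at hy
  obtain ⟨t, ht, rfl⟩ := hy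
  by_contra hne
  have := intervalIntegral.integral_pos (f := fun t => w t * w t) zero_lt_one
    (hwc.mul hwc).continuousOn (fun t _ => mul_self_nonneg _) ⟨t, ht, mul_self_pos.2 hne⟩
  exact this.ne' key

/-- The finite element space consists of the piecewise polynomials whose jumps vanish to order
`n₂` at the vertices and to order `n₁` on the edges. -/
theorem mem_space_iff (hT : IsTriangularGrid T Ω) {k n₁ n₂ : ℕ} {z₁ z₂ : ℤ}
    (hz₁ : z₁ + 1 = n₁) (hz₂ : z₂ + 1 = n₂) (h12 : n₁ ≤ n₂) (h2 : 1 ≤ n₂) {u : Broken T} :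
    u ∈ space T k z₁ z₂ ↔
      (∀ K, u K ∈ restrictTotalDegree (Fin 2) ℝ k) ∧
      (∀ (x : Plane) (K K' : Triangle T), x ∈ K.1 → x ∈ K'.1 → u K - u K' ∈ vanishing {x} n₂) ∧
      (∀ (a b : Plane) (K K' : Triangle T), a ≠ b → a ∈ K.1 → b ∈ K.1 → a ∈ K'.1 → b ∈ K'.1 →
        u K - u K' ∈ vanishing (segment ℝ a b) n₁) := by
  constructor
  · rintro ⟨hdeg, -, hv, he⟩
    have hv' : ∀ (x : Plane) (K K' : Triangle T), x ∈ K.1 → x ∈ K'.1 →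
        u K - u K' ∈ vanishing {x} n₂ := by
      intro x K K' hx hx'
      rw [mem_vanishing_singleton_iff]
      intro i j hij
      rw [vertexDOF_sub, hv x K K' hx hx' i j (by omega), sub_self]
    refine ⟨hdeg, hv', fun a b K K' hab ha hb ha' hb' => ?_⟩
    obtain ⟨n, hn1, hn2, hn3⟩ := exists_unit_normal (sub_ne_zero.2 hab.symm)
    -- Only the iterated normal derivatives have to be shown to vanish. The `m`-th one has degree at
    -- most `k - m` and order `n₂ - m` at the end points, which matches the range of the moments.
    refine mem_vanishing_segment_of_iterate hn3 fun m hm => ?_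
    obtain ⟨x, rfl, rfl, hx, -⟩ := K.exists_enum hab ha hb
    have hd : ∀ m, (dirDeriv n)^[m] (u K - u K') ∈ restrictTotalDegree (Fin 2) ℝ (k - m) := by
      intro m
      induction m with
      | zero => exact Submodule.sub_mem _ (hdeg K) (hdeg K')
      | succ m ih =>
        rw [Function.iterate_succ_apply']
        exact dirDeriv_mem_restrictTotalDegree ih n
    have hvm : ∀ y, y ∈ K.1 → y ∈ K'.1 →
        (dirDeriv n)^[m] (u K - u K') ∈ vanishing {y} (n₂ - m) := fun y hy hy' =>
      iterate_dirDeriv_mem_vanishing (by rw [Nat.sub_add_cancel (by omega)]; exact hv' y K K' hy hy') n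
    refine value_eq_zero_of_moments hx (hd m) (hvm _ ha ha') (hvm _ hb hb')
      fun i j hij hi hj => ?_
    -- The truncated difference `k - m` is a true one here: both exponents are at least `n₂ - m ≥
    -- 1`, which excludes `k - m = 0`.
    have := he (x 0) (x 1) K K' hab ha hb ha' hb' n hn1 hn2 m i j (by omega) (by omega) (by omega)
      (by omega)
    rw [← sub_eq_zero, ← edgeDOF_sub] at this
    exact this
  · rintro ⟨hdeg, hv, he⟩
    refine ⟨hdeg, fun h1 => ?_, ?_, ?_⟩
    · classical
      have agree : ∀ (y : Plane) (K K' : Triangle T), y ∈ convexHull ℝ (K.1 : Set Plane) →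
          y ∈ convexHull ℝ (K'.1 : Set Plane) → value y (u K) = value y (u K') := by
        intro y K K' hy hy'
        rw [← sub_eq_zero, ← value_sub]
        rcases Triangle.inter_cases hy hy' with rfl | ⟨h, h'⟩ | ⟨a, b, hab, ha, hb, ha', hb', hy⟩
        · rw [sub_self, value_zero]
        · exact value_eq_zero_of_mem_vanishing h2 (hv y K K' h h') rfl
        · exact value_eq_zero_of_mem_vanishing (by omega) (he a b K K' hab ha hb ha' hb') hy
      let f : Plane → ℝ := fun y =>
        if h : ∃ K : Triangle T, y ∈ convexHull ℝ (K.1 : Set Plane) then value y (u h.choose) else 0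
      have hf : ∀ K : Triangle T, ∀ y ∈ convexHull ℝ (K.1 : Set Plane), f y = value y (u K) := by
        intro K y hy
        have h : ∃ K : Triangle T, y ∈ convexHull ℝ (K.1 : Set Plane) := ⟨K, hy⟩
        simp only [f, dif_pos h]
        exact agree y _ _ h.choose_spec hy
      refine ⟨f, ?_, hf⟩
      have := Triangle.finite hT
      have hU : T.space = ⋃ K : Triangle T, convexHull ℝ (K.1 : Set Plane) := by
        ext y
        rw [mem_space_iff_exists_triangle hT, Set.mem_iUnion]
      rw [hU]
      exact (locallyFinite_of_finite _).continuousOn_iUnion isClosed_convexHull_triangle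
        fun K => (continuous_value (u K)).continuousOn.congr (hf K)
    · intro x K K' hx hx' i j hij
      rw [← sub_eq_zero, ← vertexDOF_sub]
      exact mem_vanishing_singleton_iff.1 (hv x K K' hx hx') i j (by omega)
    · intro a b K K' hab ha hb ha' hb' n _ _ θ i j hθ _ _ _
      rw [← sub_eq_zero, ← edgeDOF_sub, edgeDOF]
      have h0 : (dirDeriv n)^[θ] (u K - u K') ∈ vanishing (segment ℝ a b) (n₁ - θ) :=
        iterate_dirDeriv_mem_vanishing (by
          rw [Nat.sub_add_cancel (by omega)]; exact he a b K K' hab ha hb ha' hb') n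
      rw [intervalIntegral.integral_congr (g := fun _ => (0 : ℝ)) fun t ht => ?_]
      · simp
      · rw [Set.uIcc_of_le zero_le_one] at ht
        have : value (AffineMap.lineMap a b t) ((dirDeriv n)^[θ] (u K - u K')) = 0 :=
          value_eq_zero_of_mem_vanishing (by omega) h0
            (by rw [segment_eq_image_lineMap]; exact ⟨t, ht, rfl⟩)
        simp only [this, zero_mul]

/-! ### Prescribing the fluxes -/

theorem value_bary_lineMap' (x : Fin 3 → Plane) (m : Fin 3) (a b : Plane) (t : ℝ) :
    value (AffineMap.lineMap a b t) (bary x m)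
      = (1 - t) * value a (bary x m) + t * value b (bary x m) := by
  rw [value_bary, value_bary, value_bary, slope_lineMap]

theorem mem_convexHull_of_bary {x : Fin 3 → Plane} (hx : tdet x ≠ 0) {y : Plane}
    (h : ∀ m, 0 ≤ value y (bary x m)) : y ∈ convexHull ℝ (Set.range x) := by
  have h1 : ∑ m, value y (bary x m) = 1 := by
    have := congrArg (value y) (sum_bary hx)
    simpa [value] using this
  have h2 : y = ∑ m, value y (bary x m) • x m := by
    ext i
    have := congrArg (value y) (sum_smul_bary hx i)
    simp only [value, map_sum, smul_eval, eval_X] at this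
    rw [← this]
    simp [Fin.sum_univ_three, value, mul_comm]
  rw [h2]
  exact (convex_convexHull ℝ _).sum_mem (fun m _ => h m) h1
    fun m _ => subset_convexHull ℝ _ (Set.mem_range_self m)

/-- Two triangles with a common edge lie on opposite sides of it. -/
theorem Triangle.tdet_mul_tdet_neg {K K' : Triangle T} (hKK' : K ≠ K') {x x' : Fin 3 → Plane}
    (hx : tdet x ≠ 0) (hx' : tdet x' ≠ 0) (hK : ∀ y, y ∈ K.1 ↔ ∃ i, y = x i)
    (hK' : ∀ y, y ∈ K'.1 ↔ ∃ i, y = x' i) (h0 : x' 0 = x 0) (h1 : x' 1 = x 1) :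
    tdet x * tdet x' < 0 := by
  by_contra! hpos
  have hpos : 0 < tdet x / tdet x' := by
    have := lt_of_le_of_ne hpos (mul_ne_zero hx hx').symm
    rcases pos_and_pos_or_neg_and_neg_of_mul_pos this with ⟨a, b⟩ | ⟨a, b⟩
    · exact div_pos a b
    · exact div_pos_of_neg_of_neg a b
  have hz : x 2 ∉ K'.1 := by
    intro hz
    apply hKK'
    have hsub : K.1 ⊆ K'.1 := by
      intro y hy
      obtain ⟨i, rfl⟩ := (hK y).1 hy
      fin_cases i
      · exact (hK' _).2 ⟨0, h0.symm⟩
      · exact (hK' _).2 ⟨1, h1.symm⟩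
      · exact hz
    exact Subtype.ext (Finset.eq_of_subset_of_card_le hsub (by rw [K.2.2, K'.2.2]))
  -- The ratio of the signed areas is the coordinate of `x 2` with respect to the common edge in the
  -- other triangle. It would be positive if both triangles lay on the same side.
  have hz2 : value (x 2) (bary x' 2) = tdet x / tdet x' := by
    obtain ⟨-, -, -, -, h5, h6⟩ := fin_three_add
    rw [value_bary, slope, h5, h6, h0, h1]
    rfl
  -- The point `p` is the midpoint of the common edge, moved by `ε` towards `x 2`. With `ε * A = 1 /
  -- 4` the other two coordinates in `K'` stay positive, so `p` would lie in both triangles.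
  set A := |value (x 2) (bary x' 0)| + |value (x 2) (bary x' 1)| + 1 with hA
  have hA1 : 1 ≤ A := le_add_of_nonneg_left (by positivity)
  set ε := 1 / (4 * A) with hε
  have hεA : ε * A = 1 / 4 := by rw [hε]; field_simp
  have hε0 : 0 < ε := by positivity
  have hε1 : ε ≤ 1 / 4 := by nlinarith
  set p : Plane := AffineMap.lineMap (AffineMap.lineMap (x 0) (x 1) (1 / 2 : ℝ)) (x 2) ε with hp
  have hpx : ∀ m, value p (bary x m) = (1 - ε) * ((1 / 2) * (if m = 0 then 1 else 0)
      + (1 / 2) * (if m = 1 then 1 else 0)) + ε * (if m = 2 then 1 else 0) := by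
    intro m
    rw [hp, value_bary_lineMap', value_bary_lineMap hx, value_bary_vertex hx]
    norm_num
  have hpx' : ∀ m, value p (bary x' m) = (1 - ε) * ((1 / 2) * (if m = 0 then 1 else 0)
      + (1 / 2) * (if m = 1 then 1 else 0)) + ε * value (x 2) (bary x' m) := by
    intro m
    rw [hp, value_bary_lineMap', ← h0, ← h1, value_bary_lineMap hx']
    norm_num
  have range_eq : ∀ {K : Triangle T} {x : Fin 3 → Plane}, (∀ y, y ∈ K.1 ↔ ∃ i, y = x i) →
      Set.range x = (K.1 : Set Plane) := by
    intro K x h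
    ext y
    rw [Finset.mem_coe, h, Set.mem_range]
    simp only [eq_comm]
  have hpK : p ∈ convexHull ℝ (K.1 : Set Plane) := by
    rw [← range_eq hK]
    refine mem_convexHull_of_bary hx fun m => ?_
    rw [hpx]
    fin_cases m <;> simp <;> linarith
  have hpK' : p ∈ convexHull ℝ (K'.1 : Set Plane) := by
    rw [← range_eq hK']
    refine mem_convexHull_of_bary hx' fun m => ?_
    rw [hpx']
    have e0 := neg_abs_le (value (x 2) (bary x' 0))
    have e1 := neg_abs_le (value (x 2) (bary x' 1))
    have a0 := abs_nonneg (value (x 2) (bary x' 0))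
    have a1 := abs_nonneg (value (x 2) (bary x' 1))
    fin_cases m
    · simp only [Fin.zero_eta, if_true, Fin.reduceEq, if_false]
      nlinarith
    · simp only [Fin.mk_one, if_true, Fin.reduceEq, if_false]
      nlinarith
    · simp only [Fin.reduceFinMk, Fin.reduceEq, if_false, hz2]
      have := mul_pos hε0 hpos
      linarith
  -- All common vertices lie on the line of the edge, whereas the coordinate of `p` transversal to
  -- it is `ε > 0`. So `p` lies on no common face.
  have common : ∀ y, y ∈ K.1 → y ∈ K'.1 → value y (bary x 2) = 0 := by
    intro y hy hy'
    obtain ⟨i, rfl⟩ := (hK y).1 hy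
    rw [value_bary_vertex hx, if_neg]
    rintro rfl
    exact hz hy'
  have hp2 := hpx 2
  simp at hp2
  rcases Triangle.inter_cases hpK hpK' with h | ⟨h, h'⟩ | ⟨a, b, -, ha, hb, ha', hb', h⟩
  · exact hKK' h
  · rw [common p h h'] at hp2
    exact hε0.ne hp2
  · rw [segment_eq_image_lineMap] at h
    obtain ⟨t, -, ht⟩ := h
    rw [← ht, value_bary_lineMap', common a ha ha', common b hb hb'] at hp2
    simp at hp2
    exact hε0.ne hp2

/-- A functional that avoids finitely many hyperplanes kills none of the differences. It ensures
that the highest vertex of a set of triangles is unique. -/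
theorem exists_dual_injOn {V : Set Plane} (hV : V.Finite) :
    ∃ φ : Module.Dual ℝ Plane, Set.InjOn φ V := by
  have := hV.to_subtype
  obtain ⟨φ, hφ⟩ := Module.exists_dual_forall_apply_ne_zero (K := ℝ)
    (fun p : {p : V × V // p.1 ≠ p.2} => (p.1.1 : Plane) - p.1.2) fun p h =>
      p.2 (Subtype.ext (sub_eq_zero.1 h))
  refine ⟨φ, fun a ha b hb hab => ?_⟩
  by_contra hne
  refine hφ ⟨(⟨a, ha⟩, ⟨b, hb⟩), fun h => hne (congrArg Subtype.val h)⟩ ?_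
  rw [map_sub, hab, sub_self]

/-- A nonzero function on the triangles has an edge that belongs to exactly one triangle of its
support. -/
theorem exists_edge_of_ne_zero (hT : IsTriangularGrid T Ω) {c : Triangle T → ℝ} (hc : c ≠ 0) :
    ∃ (K : Triangle T) (a b : Plane), c K ≠ 0 ∧ a ≠ b ∧ a ∈ K.1 ∧ b ∈ K.1 ∧
      ∀ K' : Triangle T, K' ≠ K → a ∈ K'.1 → b ∈ K'.1 → c K' = 0 := by
  classical
  have := Triangle.finite hT
  set V : Set Plane := ⋃ K : Triangle T, (K.1 : Set Plane) with hV
  have hVf : V.Finite := Set.finite_iUnion fun K => K.1.finite_toSet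
  have memV : ∀ (K : Triangle T) y, y ∈ K.1 → y ∈ V := fun K y hy => Set.mem_iUnion.2 ⟨K, hy⟩
  obtain ⟨φ, hφ⟩ := exists_dual_injOn hVf
  -- The functional `ψ` is `φ` rotated by a right angle and `r` is the squared length of `φ`. Thus
  -- comparing the quotients `ψ / φ` amounts to finding the sign of a cross product.
  have cross_eq : ∃ (ψ : Plane → ℝ) (r : ℝ), 0 ≤ r ∧ (r = 0 → ∀ u, φ u = 0) ∧
      ∀ u v, r * cross u v = φ u * ψ v - φ v * ψ u := by
    have e : ∀ u : Plane, φ u = u 0 * φ (EuclideanSpace.single 0 1)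
        + u 1 * φ (EuclideanSpace.single 1 1) := by
      intro u
      have : u = u 0 • EuclideanSpace.single 0 1 + u 1 • EuclideanSpace.single 1 1 := by
        ext i
        fin_cases i <;> simp
      conv_lhs => rw [this, map_add, map_smul, map_smul, smul_eq_mul, smul_eq_mul]
    refine ⟨fun v => -φ (EuclideanSpace.single 1 1) * v 0 + φ (EuclideanSpace.single 0 1) * v 1,
      φ (EuclideanSpace.single 0 1) ^ 2 + φ (EuclideanSpace.single 1 1) ^ 2, by positivity,
      fun h u => ?_, fun u v => ?_⟩
    · have p0 : φ (EuclideanSpace.single 0 1) = 0 := by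
        rw [← sq_eq_zero_iff]
        nlinarith [sq_nonneg (φ (EuclideanSpace.single 0 1)), sq_nonneg (φ (EuclideanSpace.single 1 1))]
      have p1 : φ (EuclideanSpace.single 1 1) = 0 := by
        rw [← sq_eq_zero_iff]
        nlinarith [sq_nonneg (φ (EuclideanSpace.single 0 1)), sq_nonneg (φ (EuclideanSpace.single 1 1))]
      rw [e u, p0, p1]
      ring
    rw [e u, e v, cross]
    ring
  obtain ⟨ψ, r, hr, hr0, hψ⟩ := cross_eq
  -- the top vertex of the support
  set S : Set Plane := {y | ∃ K : Triangle T, c K ≠ 0 ∧ y ∈ K.1} with hS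
  have hSf : S.Finite := hVf.subset fun y ⟨K, _, hy⟩ => memV K y hy
  obtain ⟨K₀, hK₀⟩ := Function.ne_iff.1 hc
  obtain ⟨y₀, hy₀⟩ : K₀.1.Nonempty := Finset.card_pos.1 (by rw [K₀.2.2]; norm_num)
  obtain ⟨a, ⟨K₁, hK₁, ha⟩, hmax⟩ := Set.exists_max_image S φ hSf ⟨y₀, K₀, hK₀, hy₀⟩
  -- the extremal edge at this vertex
  set S' : Set Plane := {y | y ≠ a ∧ ∃ K : Triangle T, c K ≠ 0 ∧ a ∈ K.1 ∧ y ∈ K.1} with hS'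
  have hS'f : S'.Finite := hVf.subset fun y ⟨_, K, _, _, hy⟩ => memV K y hy
  obtain ⟨y₁, hy₁, hy₁'⟩ := Finset.exists_mem_ne (by rw [K₁.2.2]; norm_num : 1 < K₁.1.card) a
  obtain ⟨b, ⟨hba, K, hK, haK, hbK⟩, hmax'⟩ := Set.exists_max_image S'
    (fun y => ψ (y - a) / φ (y - a)) hS'f ⟨y₁, hy₁', K₁, hK₁, ha, hy₁⟩
  have neg : ∀ y ∈ S', φ (y - a) < 0 := by
    rintro y ⟨hne, K, hK, haK, hyK⟩
    rw [map_sub, sub_neg]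
    refine lt_of_le_of_ne (hmax y ⟨K, hK, hyK⟩) fun h => hne ?_
    exact hφ (memV K y hyK) (memV K a haK) h
  -- Seen from the top vertex `a`, all other vertices have negative height. The edge `a b` has
  -- extremal slope, so the triangles of the support at `a` lie on one side of it. Two distinct ones
  -- containing this edge would lie on opposite sides.
  have side : ∀ z ∈ S', r * cross (b - a) (z - a) ≤ 0 := by
    intro z hz
    have h1 := neg z hz
    have h2 := neg b ⟨hba, K, hK, haK, hbK⟩
    have h3 := hmax' z hz
    rw [div_le_iff_of_neg h1, div_mul_eq_mul_div, div_le_iff_of_neg h2] at h3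
    rw [hψ]
    linarith
  refine ⟨K, a, b, hK, hba.symm, haK, hbK, fun K' hKK' ha' hb' => ?_⟩
  by_contra hK'
  obtain ⟨x, rfl, rfl, hx, hxK⟩ := K.exists_enum hba.symm haK hbK
  obtain ⟨x', h0, h1, hx', hxK'⟩ := K'.exists_enum hba.symm ha' hb'
  have opp := Triangle.tdet_mul_tdet_neg hKK'.symm hx hx' hxK hxK' h0 h1
  have s1 := side (x 2) ⟨fun h => absurd (enum_injective hx h) (by decide), K, hK, haK,
    (hxK _).2 ⟨2, rfl⟩⟩
  have s2 := side (x' 2) ⟨fun h => absurd (enum_injective hx' (h.trans h0.symm)) (by decide), K',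
    hK', ha', (hxK' _).2 ⟨2, rfl⟩⟩
  have hr' : r ≠ 0 := fun h => (neg (x 1) ⟨hba, K, hK, haK, hbK⟩).ne (hr0 h _)
  have hr0 : 0 < r := lt_of_le_of_ne hr hr'.symm
  have t1 : tdet x ≤ 0 := nonpos_of_mul_nonpos_right s1 hr0
  have t2 : tdet x' ≤ 0 := by
    rw [tdet, h0, h1]
    exact nonpos_of_mul_nonpos_right s2 hr0
  have := mul_nonneg_of_nonpos_of_nonpos t1 t2
  linarith

/-- The sums of an antisymmetric function over the boundaries of the triangles can be
prescribed. -/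
theorem exists_antisymm_sum_eq (hT : IsTriangularGrid T Ω) {x : Triangle T → Fin 3 → Plane}
    (hx : ∀ K, tdet (x K) ≠ 0) (hxK : ∀ K y, y ∈ K.1 ↔ ∃ i, y = x K i) (τ : Triangle T → ℝ) :
    ∃ F : Plane → Plane → ℝ, (∀ a b, F b a = -F a b) ∧
      ∀ K, ∑ m, F (x K (m + 1)) (x K (m + 2)) = τ K := by
  classical
  have := Triangle.finite hT
  have := Fintype.ofFinite (Triangle T)
  let L : (Plane × Plane → ℝ) →ₗ[ℝ] (Triangle T → ℝ) :=
    { toFun := fun G K => ∑ m, (G (x K (m + 1), x K (m + 2)) - G (x K (m + 2), x K (m + 1)))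
      map_add' := fun G G' => by
        funext K
        simp only [Pi.add_apply, ← Finset.sum_add_distrib]
        exact Finset.sum_congr rfl fun m _ => by ring
      map_smul' := fun r G => by
        funext K
        simp only [Pi.smul_apply, smul_eq_mul, Finset.mul_sum, RingHom.id_apply]
        exact Finset.sum_congr rfl fun m _ => by ring }
  have hL : LinearMap.range L = ⊤ := by
    by_contra hne
    obtain ⟨f, hf, hLf⟩ := Submodule.exists_le_ker_of_lt_top _ (lt_top_iff_ne_top.2 hne)
    have hfe := LinearMap.pi_apply_eq_sum_univ f
    set c : Triangle T → ℝ := fun K => f fun K' => if K = K' then 1 else 0 with hc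
    have hc0 : c ≠ 0 := by
      intro h
      apply hf
      refine LinearMap.ext fun τ => ?_
      rw [hfe, LinearMap.zero_apply]
      exact Finset.sum_eq_zero fun K _ => by rw [show (f fun K' => if K = K' then 1 else 0) = 0 from
        congrFun h K, smul_zero]
    obtain ⟨K, a, b, hcK, hab, ha, hb, hu⟩ := exists_edge_of_ne_zero hT hc0
    -- A functional that vanishes on the range is tested on one oriented edge that belongs to a
    -- single triangle of its support. The result is, up to sign, the coefficient at this triangle,
    -- which is not zero.
    have h0 : f (L (Pi.single (a, b) 1)) = 0 := hLf ⟨_, rfl⟩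
    rw [hfe, Finset.sum_eq_single K] at h0
    · rw [smul_eq_mul, mul_eq_zero] at h0
      refine h0.elim ?_ hcK
      obtain ⟨i, rfl⟩ := (hxK K a).1 ha
      obtain ⟨j, rfl⟩ := (hxK K b).1 hb
      have inj : ∀ i j, x K i = x K j ↔ i = j := fun i j => (enum_injective (hx K)).eq_iff
      have hij : i ≠ j := fun h => hab (by rw [h])
      simp only [L, LinearMap.coe_mk, AddHom.coe_mk, Pi.single_apply, Prod.mk.injEq, inj,
        Fin.sum_univ_three]
      clear * - hij
      fin_cases i <;> fin_cases j <;> simp at hij ⊢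
    · intro K' _ hK'
      by_cases h : a ∈ K'.1 ∧ b ∈ K'.1
      · rw [show (f fun K'' => if K' = K'' then 1 else 0) = 0 from hu K' hK' h.1 h.2, smul_zero]
      · have : L (Pi.single (a, b) 1) K' = 0 := by
          simp only [L, LinearMap.coe_mk, AddHom.coe_mk]
          refine Finset.sum_eq_zero fun m _ => ?_
          have mem : ∀ i, x K' i ∈ K'.1 := fun i => (hxK K' _).2 ⟨i, rfl⟩
          rw [Pi.single_apply, Pi.single_apply, if_neg, if_neg, sub_zero]
          · intro h'
            rw [Prod.mk.injEq] at h'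
            exact h ⟨h'.1 ▸ mem _, h'.2 ▸ mem _⟩
          · intro h'
            rw [Prod.mk.injEq] at h'
            exact h ⟨h'.1 ▸ mem _, h'.2 ▸ mem _⟩
        rw [this, zero_smul]
    · exact fun h => absurd (Finset.mem_univ K) h
  obtain ⟨G, hG⟩ := LinearMap.range_eq_top.1 hL τ
  exact ⟨fun a b => G (a, b) - G (b, a), fun a b => by ring, fun K => congrFun hG K⟩

/-! ### Surjectivity of the divergence -/

/-- Every function on a triangle that is compatible with the data on the vertices and edges is
the divergence of a field with these data. -/
theorem exists_triangle_field {x : Fin 3 → Plane} (hx : tdet x ≠ 0) {n r s : ℕ} (hr : 1 ≤ r)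
    (hs : 2 * r ≤ s) (hn : 2 * s ≤ n + 1) {q : Poly} {cq : (Fin 3 → ℕ) → ℝ}
    (hq : q = bern x n cq) {f g : Fin 3 → Poly × Poly}
    (hf₁ : ∀ j, (f j).1 ∈ restrictTotalDegree (Fin 2) ℝ (n + 1))
    (hf₂ : ∀ j, (f j).2 ∈ restrictTotalDegree (Fin 2) ℝ (n + 1))
    (hg₁ : ∀ j, (g j).1 ∈ restrictTotalDegree (Fin 2) ℝ (n + 1))
    (hg₂ : ∀ j, (g j).2 ∈ restrictTotalDegree (Fin 2) ℝ (n + 1))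
    (hgf₁ : ∀ m j, m ≠ j → (g m).1 - (f j).1 ∈ vanishing {x j} s)
    (hgf₂ : ∀ m j, m ≠ j → (g m).2 - (f j).2 ∈ vanishing {x j} s)
    (hfq : ∀ j, q - (pderiv 0 (f j).1 + pderiv 1 (f j).2) ∈ vanishing {x j} (s - 1))
    (hgq : ∀ m, q - (pderiv 0 (g m).1 + pderiv 1 (g m).2) ∈
      vanishing (segment ℝ (x (m + 1)) (x (m + 2))) (r - 1))
    (hF : tdet x * ∑ β ∈ piAntidiag univ n, cq β
      = -((n + 2).factorial : ℝ) * ∑ m, flux (x (m + 1)) (x (m + 2)) (g m)) :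
    ∃ v : Poly × Poly, v.1 ∈ restrictTotalDegree (Fin 2) ℝ (n + 1) ∧
      v.2 ∈ restrictTotalDegree (Fin 2) ℝ (n + 1) ∧ pderiv 0 v.1 + pderiv 1 v.2 = q ∧
      (∀ j, v.1 - (f j).1 ∈ vanishing {x j} s ∧ v.2 - (f j).2 ∈ vanishing {x j} s) ∧
      ∀ m, v.1 - (g m).1 ∈ vanishing (segment ℝ (x (m + 1)) (x (m + 2))) r ∧
        v.2 - (g m).2 ∈ vanishing (segment ℝ (x (m + 1)) (x (m + 2))) r := by
  obtain ⟨h₁, hd₁, he₁, hv₁⟩ := exists_interpolation hx (s := r) (by omega) (by omega) hf₁ hg₁ hgf₁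
  obtain ⟨h₂, hd₂, he₂, hv₂⟩ := exists_interpolation hx (s := r) (by omega) (by omega) hf₂ hg₂ hgf₂
  obtain ⟨c₁, hc₁⟩ := exists_bern_eq hx hd₁
  obtain ⟨c₂, hc₂⟩ := exists_bern_eq hx hd₂
  have hdiv : ∀ (S : Set Plane) (d : ℕ) (p : Poly × Poly), 1 ≤ d →
      q - (pderiv 0 p.1 + pderiv 1 p.2) ∈ vanishing S (d - 1) → h₁ - p.1 ∈ vanishing S d →
      h₂ - p.2 ∈ vanishing S d → bern x n (cq - divCoeff x c₁ c₂) ∈ vanishing S (d - 1) := by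
    intro S d p hd hp h1 h2
    obtain ⟨d, rfl⟩ : ∃ e, d = e + 1 := ⟨d - 1, by omega⟩
    have := Submodule.sub_mem _ hp (Submodule.add_mem _ (h1.2 0) (h2.2 1))
    rw [map_sub, map_sub] at this
    rw [bern_sub, ← div_bern_eq, ← hc₁, ← hc₂, ← hq]
    convert this using 1
    ring
  -- The divergence error vanishes to order `r - 1` on the edges and `s - 1` at the vertices. The
  -- field correction has to vanish to orders `r` and `s` in degree `n + 1`. The upper bound is the
  -- same `n + 1 - s` for both, as degree and order rise together.
  have hbox : cq - divCoeff x c₁ c₂ ∈ boxCoeff n (r - 1) (n + 1 - s) := by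
    rintro α hα ⟨i, hi | hi⟩
    · exact (bern_mem_vanishing_edge_iff hx).1 (hdiv _ r _ hr (hgq i) (he₁ i) (he₂ i)) α hα hi
    · exact (bern_mem_vanishing_vertex_iff hx).1
        (hdiv _ s _ (by omega) (hfq i) (hv₁ i) (hv₂ i)) α hα (by omega)
  have hflux : ∀ m, flux (x (m + 1)) (x (m + 2)) (h₁, h₂)
      = flux (x (m + 1)) (x (m + 2)) (g m) := by
    intro m
    have e : ∀ {p q : Poly}, p - q ∈ vanishing (segment ℝ (x (m + 1)) (x (m + 2))) r →
        segMean (x (m + 1)) (x (m + 2)) p = segMean (x (m + 1)) (x (m + 2)) q := fun h =>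
      segMean_congr fun y hy => by
        rw [← sub_eq_zero, ← value_sub]
        exact value_eq_zero_of_mem_vanishing (by omega) h hy
    rw [flux, flux, e (he₁ m), e (he₂ m)]
  -- The interpolant has the fluxes of the edge data, so the divergence theorem gives its divergence
  -- the same integral as `q`.
  have hsum : ∑ β ∈ piAntidiag univ n, (cq - divCoeff x c₁ c₂) β = 0 := by
    have := sum_divCoeff hx n c₁ c₂
    simp only [← hc₁, ← hc₂, hflux] at this
    rw [← hF] at this
    simp only [Pi.sub_apply, Finset.sum_sub_distrib]
    rw [mul_left_cancel₀ hx this, sub_self]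
  obtain ⟨d₁, hd₁', d₂, hd₂', hd⟩ := exists_bubble hx hr hs (by omega) (by omega) hbox hsum
  have bub : ∀ d ∈ boxCoeff (n + 1) r (n + 1 - s),
      (∀ j, bern x (n + 1) d ∈ vanishing {x j} s) ∧
      ∀ m, bern x (n + 1) d ∈ vanishing (segment ℝ (x (m + 1)) (x (m + 2))) r := by
    intro d hd
    constructor
    · intro j
      exact (bern_mem_vanishing_vertex_iff hx).2 fun α hα h => hd α hα ⟨j, by omega⟩
    · intro m
      exact (bern_mem_vanishing_edge_iff hx).2 fun α hα h => hd α hα ⟨m, by omega⟩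
  have add : ∀ {S : Set Plane} {d : ℕ} {p q b : Poly}, p - q ∈ vanishing S d → b ∈ vanishing S d →
      p + b - q ∈ vanishing S d := fun h h' => by
    rw [add_sub_right_comm]
    exact Submodule.add_mem _ h h'
  refine ⟨(h₁ + bern x (n + 1) d₁, h₂ + bern x (n + 1) d₂),
    Submodule.add_mem _ hd₁ (bern_mem_restrictTotalDegree _ _ _),
    Submodule.add_mem _ hd₂ (bern_mem_restrictTotalDegree _ _ _), ?_, fun j => ?_, fun m => ?_⟩
  · simp only
    rw [map_add, map_add, add_add_add_comm, div_bern_eq, ← hd, bern_sub, ← div_bern_eq, ← hc₁,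
      ← hc₂, ← hq]
    ring
  · exact ⟨add (hv₁ j) ((bub d₁ hd₁').1 j), add (hv₂ j) ((bub d₂ hd₂').1 j)⟩
  · exact ⟨add (he₁ m) ((bub d₁ hd₁').2 m), add (he₂ m) ((bub d₂ hd₂').2 m)⟩

theorem mem_vanishing_sub_trans {S : Set Plane} {d : ℕ} {p q r : Poly}
    (h : p - r ∈ vanishing S d) (h' : q - r ∈ vanishing S d) : p - q ∈ vanishing S d := by
  have := Submodule.sub_mem _ h h'
  rwa [sub_sub_sub_cancel_right] at this

/-- Surjectivity of the divergence, in terms of orders of vanishing of jumps. -/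
theorem exists_div_eq (hT : IsTriangularGrid T Ω) {n r s : ℕ} (hr : 1 ≤ r)
    (hs : 2 * r ≤ s) (hn : 2 * s ≤ n + 1) {q : Broken T}
    (hq : ∀ K, q K ∈ restrictTotalDegree (Fin 2) ℝ n)
    (hqv : ∀ (x : Plane) (K K' : Triangle T), x ∈ K.1 → x ∈ K'.1 →
      q K - q K' ∈ vanishing {x} (s - 1))
    (hqe : ∀ (a b : Plane) (K K' : Triangle T), a ≠ b → a ∈ K.1 → b ∈ K.1 → a ∈ K'.1 → b ∈ K'.1 →
      q K - q K' ∈ vanishing (segment ℝ a b) (r - 1)) :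
    ∃ v : Triangle T → Poly × Poly,
      (∀ K, (v K).1 ∈ restrictTotalDegree (Fin 2) ℝ (n + 1) ∧
        (v K).2 ∈ restrictTotalDegree (Fin 2) ℝ (n + 1)) ∧
      (∀ K, pderiv 0 (v K).1 + pderiv 1 (v K).2 = q K) ∧
      (∀ (x : Plane) (K K' : Triangle T), x ∈ K.1 → x ∈ K'.1 →
        (v K).1 - (v K').1 ∈ vanishing {x} s ∧ (v K).2 - (v K').2 ∈ vanishing {x} s) ∧
      ∀ (a b : Plane) (K K' : Triangle T), a ≠ b → a ∈ K.1 → b ∈ K.1 → a ∈ K'.1 → b ∈ K'.1 →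
        (v K).1 - (v K').1 ∈ vanishing (segment ℝ a b) r ∧
        (v K).2 - (v K').2 ∈ vanishing (segment ℝ a b) r := by
  classical
  choose x hx' hxK using fun K : Triangle T => K.exists_enum'
  have hx : ∀ K, tdet (x K) ≠ 0 := fun K => (hx' K).ne'
  choose cq hcq using fun K => exists_bern_eq (hx K) (hq K)
  -- the jets at the vertices
  have exf : ∀ y : Plane, ∃ f : Poly × Poly, f.1 ∈ restrictTotalDegree (Fin 2) ℝ (n + 1) ∧
      f.2 ∈ restrictTotalDegree (Fin 2) ℝ (n + 1) ∧ ∀ K : Triangle T, y ∈ K.1 →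
        q K - (pderiv 0 f.1 + pderiv 1 f.2) ∈ vanishing {y} (s - 1) := by
    intro y
    by_cases h : ∃ K : Triangle T, y ∈ K.1
    · obtain ⟨K, hK⟩ := h
      -- A primitive of `q` on one triangle at `y` will do for all, since the jumps of `q` vanish
      -- there to order `s - 1`.
      refine ⟨(antideriv 0 (q K), 0), antideriv_mem_restrictTotalDegree (hq K) 0,
        Submodule.zero_mem _, fun K' hK' => ?_⟩
      rw [pderiv_antideriv, map_zero, add_zero]
      exact hqv y K' K hK' hK
    · exact ⟨0, Submodule.zero_mem _, Submodule.zero_mem _, fun K hK => absurd ⟨K, hK⟩ h⟩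
  choose f hf₁ hf₂ hfq using exf
  -- the fluxes through the edges
  obtain ⟨F, hF, hFsum⟩ := exists_antisymm_sum_eq hT hx hxK fun K =>
    -(tdet (x K) * ∑ β ∈ piAntidiag univ n, cq K β) / (n + 2).factorial
  -- the fields near the edges
  let P : Plane → Plane → Poly × Poly → Prop := fun a b g =>
    g.1 ∈ restrictTotalDegree (Fin 2) ℝ (n + 1) ∧ g.2 ∈ restrictTotalDegree (Fin 2) ℝ (n + 1) ∧
    (g.1 - (f a).1 ∈ vanishing {a} s ∧ g.2 - (f a).2 ∈ vanishing {a} s) ∧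
    (g.1 - (f b).1 ∈ vanishing {b} s ∧ g.2 - (f b).2 ∈ vanishing {b} s) ∧
    (∀ K : Triangle T, a ∈ K.1 → b ∈ K.1 →
      q K - (pderiv 0 g.1 + pderiv 1 g.2) ∈ vanishing (segment ℝ a b) (r - 1)) ∧
    flux a b g = F a b
  -- The field is chosen per unoriented edge, so that both neighbours use the same one. The
  -- antisymmetry of `F` makes the flux condition independent of the orientation.
  have exg : ∀ e : Sym2 Plane, ∃ g : Poly × Poly, ∀ a b, e = s(a, b) → a ≠ b →
      (∃ K : Triangle T, a ∈ K.1 ∧ b ∈ K.1) → P a b g := by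
    intro e
    induction e using Sym2.ind with
    | _ a b =>
      by_cases h : a ≠ b ∧ ∃ K : Triangle T, a ∈ K.1 ∧ b ∈ K.1
      · obtain ⟨hab, K, ha, hb⟩ := h
        obtain ⟨y, rfl, rfl, hy, hyK⟩ := K.exists_enum hab ha hb
        obtain ⟨g, hg₁, hg₂, hgf, hgq, hgF⟩ := exists_edge_field hy (v := s) (by omega) hn (hq K)
          (f := fun j => f (y j)) (fun j => hf₁ _) (fun j => hf₂ _)
          (fun j _ => hfq _ K ((hyK _).2 ⟨j, rfl⟩)) (F (y 0) (y 1))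
        have hP : P (y 0) (y 1) g := by
          refine ⟨hg₁, hg₂, hgf 0 (by decide), hgf 1 (by decide), fun K' ha' hb' => ?_, hgF⟩
          rw [hgq]
          exact hqe _ _ K' K hab ha' hb' ha hb
        refine ⟨g, fun a b he _ _ => ?_⟩
        rw [Sym2.eq_iff] at he
        rcases he with ⟨rfl, rfl⟩ | ⟨rfl, rfl⟩
        · exact hP
        · obtain ⟨h1, h2, h3, h4, h5, h6⟩ := hP
          refine ⟨h1, h2, h4, h3, fun K' ha' hb' => ?_, ?_⟩
          · rw [segment_symm]
            exact h5 K' hb' ha'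
          · rw [flux_symm, h6, hF (y 1), neg_neg]
      · refine ⟨0, fun a' b' he hab ⟨K, ha, hb⟩ => absurd ?_ h⟩
        rw [Sym2.eq_iff] at he
        rcases he with ⟨rfl, rfl⟩ | ⟨rfl, rfl⟩
        · exact ⟨hab, K, ha, hb⟩
        · exact ⟨hab.symm, K, hb, ha⟩
  choose g hg using exg
  have hgP : ∀ (K : Triangle T) a b, a ≠ b → a ∈ K.1 → b ∈ K.1 → P a b (g s(a, b)) :=
    fun K a b hab ha hb => hg _ a b rfl hab ⟨K, ha, hb⟩
  have mem : ∀ K i, x K i ∈ K.1 := fun K i => (hxK K _).2 ⟨i, rfl⟩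
  have ne : ∀ K {i j}, i ≠ j → x K i ≠ x K j := fun K i j h => (enum_injective (hx K)).ne h
  have hgK : ∀ K m, P (x K (m + 1)) (x K (m + 2)) (g s(x K (m + 1), x K (m + 2))) := fun K m =>
    hgP K _ _ (ne K (fin_three_ne m).2.2) (mem K _) (mem K _)
  have main : ∀ K, ∃ v : Poly × Poly, v.1 ∈ restrictTotalDegree (Fin 2) ℝ (n + 1) ∧
      v.2 ∈ restrictTotalDegree (Fin 2) ℝ (n + 1) ∧ pderiv 0 v.1 + pderiv 1 v.2 = q K ∧
      (∀ j, v.1 - (f (x K j)).1 ∈ vanishing {x K j} s ∧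
        v.2 - (f (x K j)).2 ∈ vanishing {x K j} s) ∧
      ∀ m, v.1 - (g s(x K (m + 1), x K (m + 2))).1 ∈
          vanishing (segment ℝ (x K (m + 1)) (x K (m + 2))) r ∧
        v.2 - (g s(x K (m + 1), x K (m + 2))).2 ∈
          vanishing (segment ℝ (x K (m + 1)) (x K (m + 2))) r := by
    intro K
    refine exists_triangle_field (hx K) hr hs hn (hcq K) (f := fun j => f (x K j))
      (g := fun m => g s(x K (m + 1), x K (m + 2))) (fun j => hf₁ _) (fun j => hf₂ _)
      (fun m => (hgK K m).1) (fun m => (hgK K m).2.1) ?_ ?_ (fun j => hfq _ K (mem K j))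
      (fun m => (hgK K m).2.2.2.2.1 K (mem K _) (mem K _)) ?_
    · intro m j hmj
      rcases fin_three_cases m j with rfl | rfl | rfl
      · exact absurd rfl hmj
      · exact (hgK K m).2.2.1.1
      · exact (hgK K m).2.2.2.1.1
    · intro m j hmj
      rcases fin_three_cases m j with rfl | rfl | rfl
      · exact absurd rfl hmj
      · exact (hgK K m).2.2.1.2
      · exact (hgK K m).2.2.2.1.2
    · rw [Finset.sum_congr rfl fun m _ => (hgK K m).2.2.2.2.2, hFsum]
      field_simp
  choose v hv₁ hv₂ hvq hvf hvg using main
  have edge : ∀ (K : Triangle T) a b, a ≠ b → a ∈ K.1 → b ∈ K.1 →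
      (v K).1 - (g s(a, b)).1 ∈ vanishing (segment ℝ a b) r ∧
      (v K).2 - (g s(a, b)).2 ∈ vanishing (segment ℝ a b) r := by
    intro K a b hab ha hb
    obtain ⟨i, rfl⟩ := (hxK K a).1 ha
    obtain ⟨j, rfl⟩ := (hxK K b).1 hb
    have hij : i ≠ j := fun h => hab (by rw [h])
    have : ∃ m : Fin 3, (i = m + 1 ∧ j = m + 2) ∨ (i = m + 2 ∧ j = m + 1) := by
      clear * - hij
      revert i j
      decide
    obtain ⟨m, ⟨rfl, rfl⟩ | ⟨rfl, rfl⟩⟩ := this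
    · exact hvg K m
    · rw [Sym2.eq_swap, segment_symm]
      exact hvg K m
  -- Neighbouring fields agree to the required orders because both agree with the same vertex and
  -- edge data.
  refine ⟨v, fun K => ⟨hv₁ K, hv₂ K⟩, hvq, fun y K K' hK hK' => ?_,
    fun a b K K' hab ha hb ha' hb' => ?_⟩
  · obtain ⟨i, rfl⟩ := (hxK K y).1 hK
    obtain ⟨j, hj⟩ := (hxK K' _).1 hK'
    have h1 := hvf K i
    have h2 := hvf K' j
    rw [← hj] at h2
    exact ⟨mem_vanishing_sub_trans h1.1 h2.1, mem_vanishing_sub_trans h1.2 h2.2⟩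
  · have h1 := edge K a b hab ha hb
    have h2 := edge K' a b hab ha' hb'
    exact ⟨mem_vanishing_sub_trans h1.1 h2.1, mem_vanishing_sub_trans h1.2 h2.2⟩

/-! ### Gluing local primitives on a simply connected region -/

open Topology Filter in
/-- A locally constant cocycle on a simply connected and locally path connected space is a
coboundary. -/
theorem exists_locallyConstant_splitting {X A : Type*} [TopologicalSpace X]
    [SimplyConnectedSpace X] [LocallyPathConnectedSpace X] [AddCommGroup A] {U : X → Set X}
    (hU : ∀ x, IsOpen (U x)) (hx : ∀ x, x ∈ U x) (c : X → X → X → A)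
    (hself : ∀ i, ∀ y ∈ U i, c i i y = 0)
    (hcomp : ∀ i j k, ∀ y ∈ U i ∩ U j ∩ U k, c i j y + c j k y = c i k y)
    (hloc : ∀ i j, ∀ y ∈ U i ∩ U j, ∀ᶠ z in 𝓝 y, c i j z = c i j y) :
    ∃ s : X → X → A, (∀ i, ∀ y ∈ U i, ∀ᶠ z in 𝓝 y, s i z = s i y) ∧
      ∀ i j, ∀ y ∈ U i ∩ U j, s j y = s i y + c i j y := by
  let _ : TopologicalSpace A := ⊥
  have _ : DiscreteTopology A := ⟨rfl⟩
  -- Translations by the cocycle glue a bundle with discrete fibre `A`, that is, a covering. Its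
  -- global sections are the splittings of the cocycle.
  let Z : FiberBundleCore X X A :=
    { baseSet := U
      isOpen_baseSet := hU
      indexAt := id
      mem_baseSet_at := hx
      coordChange := fun i j y a => a + c i j y
      coordChange_self := fun i y hy a => by rw [hself i y hy, add_zero]
      continuousOn_coordChange := fun i j p hp => by
        have h1 : ∀ᶠ q : X × A in 𝓝 p, c i j q.1 = c i j p.1 :=
          continuous_fst.continuousAt.eventually (hloc i j p.1 hp.1)
        have h2 : ContinuousAt (fun q : X × A => q.2 + c i j p.1) p :=
          ((continuous_of_discreteTopology (f := fun a : A => a + c i j p.1)).comp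
            continuous_snd).continuousAt
        refine (h2.congr ?_).continuousWithinAt
        filter_upwards [h1] with q hq
        rw [hq]
      coordChange_comp := fun i j k y hy a => by rw [add_assoc, hcomp i j k y hy] }
  have hcov : IsCoveringMap Z.proj := FiberBundle.isCoveringMap
  have : Nonempty X := (inferInstance : PathConnectedSpace X).nonempty
  let a₀ : X := Classical.arbitrary X
  -- As the base is simply connected and locally path connected, the identity lifts to a section.
  -- Its coordinates in the local trivializations are the functions `s i`.
  obtain ⟨F, ⟨-, hF⟩, -⟩ := hcov.existsUnique_continuousMap_lifts (ContinuousMap.id X) a₀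
    (⟨a₀, (0 : A)⟩ : Z.TotalSpace) rfl
  have hF1 : ∀ y, (F y).1 = y := fun y => congrFun hF y
  refine ⟨fun i y => (Z.localTriv i (F y)).2, fun i y hy => ?_, fun i j y hy => ?_⟩
  · have hmem : F y ∈ (Z.localTriv i).source := by
      rw [(Z.localTriv i).mem_source]
      change (F y).1 ∈ U i
      rw [hF1]
      exact hy
    have h1 : ContinuousAt (fun y => (Z.localTriv i (F y)).2) y :=
      ContinuousAt.snd (ContinuousAt.comp (g := Z.localTriv i) ((Z.localTriv i).continuousAt hmem)
        F.continuous.continuousAt)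
    have h2 := h1.eventually (isOpen_discrete {(Z.localTriv i (F y)).2} |>.mem_nhds rfl)
    exact h2
  · let u : A := (F y).2
    have e : ∀ i, (Z.localTriv i (F y)).2 = u + c (F y).1 i (F y).1 := fun i => rfl
    change (Z.localTriv j (F y)).2 = (Z.localTriv i (F y)).2 + c i j y
    rw [e j, e i, hF1, add_assoc]
    congr 1
    exact (hcomp y i j y ⟨⟨hx y, hy.1⟩, hy.2⟩).symm

/-- The points that belong only to triangles that contain `x`. -/
def star (T : Geometry.SimplicialComplex ℝ Plane) (x : T.space) : Set T.space :=
  {y | ∀ K : Triangle T, (y : Plane) ∈ convexHull ℝ (K.1 : Set Plane) →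
    (x : Plane) ∈ convexHull ℝ (K.1 : Set Plane)}

/-- The complement is the union of the finitely many closed triangles that miss `x`. -/
theorem isOpen_star (hT : IsTriangularGrid T Ω) (x : T.space) : IsOpen (star T x) := by
  have := Triangle.finite hT
  have : star T x = ⋂ K : {K : Triangle T // (x : Plane) ∉ convexHull ℝ (K.1 : Set Plane)},
      ((↑) : T.space → Plane) ⁻¹' (convexHull ℝ (K.1.1 : Set Plane))ᶜ := by
    ext y
    simp only [star, Set.mem_ofPred_eq, Set.mem_iInter, Set.mem_preimage, Set.mem_compl_iff,
      Subtype.forall]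
    exact forall_congr' fun K => not_imp_not.symm
  rw [this]
  exact isOpen_iInter_of_finite fun K =>
    (isClosed_convexHull_triangle K.1).isOpen_compl.preimage continuous_subtype_val

theorem mem_star (x : T.space) : x ∈ star T x := fun _ h => h

/-- In a small ball around `x` only triangles that contain `x` occur. Convexity of these makes the
region star-shaped about `x` there. -/
theorem locallyPathConnectedSpace_space (hT : IsTriangularGrid T Ω) :
    LocallyPathConnectedSpace T.space := by
  refine ⟨fun x => ⟨fun t => ⟨fun ht => ?_, fun ⟨i, hi, hit⟩ => Filter.mem_of_superset hi.1 hit⟩⟩⟩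
  obtain ⟨ε, hε, hball⟩ := Metric.mem_nhds_iff.1
    (Filter.inter_mem ht ((isOpen_star hT x).mem_nhds (mem_star x)))
  have hstar : StarConvex ℝ (x : Plane) (T.space ∩ Metric.ball (x : Plane) ε) := by
    rw [starConvex_iff_segment_subset]
    rintro y ⟨hy, hyε⟩
    obtain ⟨K, hK⟩ := (mem_space_iff_exists_triangle hT).1 hy
    have hyt := (@hball ⟨y, hy⟩ hyε).2
    have hxK := hyt K hK
    refine Set.subset_inter (fun z hz => (mem_space_iff_exists_triangle hT).2
      ⟨K, (convex_convexHull ℝ _).segment_subset hxK hK hz⟩)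
      ((convex_ball _ _).segment_subset (Metric.mem_ball_self hε) hyε)
  have hpc := hstar.isPathConnected ⟨x.2, Metric.mem_ball_self hε⟩
  refine ⟨Metric.ball x ε, ⟨Metric.ball_mem_nhds x hε, ?_⟩, fun y hy => (hball hy).1⟩
  convert hpc.preimage_coe Set.inter_subset_left using 1
  ext y
  simp only [Set.mem_preimage, Set.mem_inter_iff, y.2, true_and]
  rfl

open Topology in
/-- Piecewise polynomials with single-valued gradients on a simply connected region become
single-valued after adding constants. -/
theorem exists_constants (hT : IsTriangularGrid T Ω) [SimplyConnectedSpace T.space]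
    {p : Broken T}
    (hp : ∀ (K K' : Triangle T), ∀ y ∈ convexHull ℝ (K.1 : Set Plane),
      y ∈ convexHull ℝ (K'.1 : Set Plane) → ∀ i, value y (pderiv i (p K - p K')) = 0) :
    ∃ c : Triangle T → ℝ, ∀ (K K' : Triangle T), ∀ y ∈ convexHull ℝ (K.1 : Set Plane),
      y ∈ convexHull ℝ (K'.1 : Set Plane) → value y (p K) + c K = value y (p K') + c K' := by
  have := locallyPathConnectedSpace_space hT
  -- The intersection of two triangles is convex and the difference of the two polynomials has zero
  -- gradient on it. So the difference is constant along the segment from `x` to `y`.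
  have indep : ∀ (K K' : Triangle T) (x y : Plane), x ∈ convexHull ℝ (K.1 : Set Plane) →
      x ∈ convexHull ℝ (K'.1 : Set Plane) → y ∈ convexHull ℝ (K.1 : Set Plane) →
      y ∈ convexHull ℝ (K'.1 : Set Plane) →
      value y (p K) - value x (p K) = value y (p K') - value x (p K') := by
    intro K K' x y hx hx' hy hy'
    have h := value_eq_of_segment (a := x) (b := y) (p := p K - p K') (fun z hz => by
      have e := hp K K' z ((convex_convexHull ℝ _).segment_subset hx hy hz)
        ((convex_convexHull ℝ _).segment_subset hx' hy' hz)
      rw [dirDeriv, value_add, value_smul, value_smul, e, e]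
      ring) y (right_mem_segment ℝ x y)
    rw [value_sub, value_sub] at h
    linarith
  choose κ hκ using fun y : T.space => (mem_space_iff_exists_triangle hT).1 y.2
  -- The potential on the star of `x`, normalized to vanish at `x`. It does not depend on the chosen
  -- triangle, and the differences of these local potentials form the cocycle to be split.
  let f : T.space → T.space → ℝ := fun x y => value y (p (κ y)) - value x (p (κ y))
  have hf : ∀ x, ∀ y ∈ star T x, ∀ K : Triangle T, (y : Plane) ∈ convexHull ℝ (K.1 : Set Plane) →
      f x y = value y (p K) - value x (p K) := by
    intro x y hy K hK
    exact indep _ _ _ _ (hy _ (hκ y)) (hy _ hK) (hκ y) hK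
  have hopen : ∀ x y : T.space, y ∈ star T x → ∀ᶠ z in 𝓝 y, z ∈ star T x := fun x y hy =>
    (isOpen_star hT x).mem_nhds hy
  obtain ⟨s, hs, hs'⟩ := exists_locallyConstant_splitting (isOpen_star hT) mem_star
    (fun i j y => f i y - f j y) (fun i y _ => sub_self _) (fun i j k y _ => by ring) (by
      intro i j y hy
      -- A triangle that contains `z` near `y` also contains `y`. Both differences can be computed
      -- on it, and there the dependence on the point cancels.
      filter_upwards [hopen y y (mem_star y), hopen i y hy.1, hopen j y hy.2] with z hz hzi hzj
      have hK := hκ z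
      rw [hf i z hzi _ hK, hf j z hzj _ hK, hf i y hy.1 _ (hz _ hK), hf j y hy.2 _ (hz _ hK)]
      ring)
  -- On each star `s i + f i` does not depend on `i`, and `f y y = 0`. So `g` is the global
  -- potential, and on each triangle it differs from `p K` by a locally constant function.
  let g : T.space → ℝ := fun y => s y y
  have hg : ∀ K : Triangle T, ∀ y z : T.space, (y : Plane) ∈ convexHull ℝ (K.1 : Set Plane) →
      (z : Plane) ∈ convexHull ℝ (K.1 : Set Plane) →
      g y - value y (p K) = g z - value z (p K) := by
    intro K
    have hpre : PreconnectedSpace (convexHull ℝ (K.1 : Set Plane)) :=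
      Subtype.preconnectedSpace (convex_convexHull ℝ _).isPreconnected
    let incl : convexHull ℝ (K.1 : Set Plane) → T.space := fun y =>
      ⟨y, (mem_space_iff_exists_triangle hT).2 ⟨K, y.2⟩⟩
    have hincl : Continuous incl := by fun_prop
    have hlc : IsLocallyConstant fun y => g (incl y) - value (incl y) (p K) := by
      rw [IsLocallyConstant.iff_eventually_eq]
      intro y
      have h1 := hincl.continuousAt.eventually (hopen (incl y) (incl y) (mem_star _))
      have h2 := hincl.continuousAt.eventually (hs (incl y) (incl y) (mem_star _))
      filter_upwards [h1, h2] with z hz hz'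
      have h3 := hs' (incl y) (incl z) (incl z) ⟨hz, mem_star _⟩
      rw [hf _ _ hz K z.2, hf _ _ (mem_star _) K z.2, hz'] at h3
      simp only [g]
      rw [h3]
      ring
    intro y z hy hz
    exact hlc.apply_eq_of_preconnectedSpace ⟨y, hy⟩ ⟨z, hz⟩
  have hne : ∀ K : Triangle T, ∃ y : T.space, (y : Plane) ∈ convexHull ℝ (K.1 : Set Plane) := by
    intro K
    obtain ⟨y, hy⟩ : K.1.Nonempty := Finset.card_pos.1 (by rw [K.2.2]; norm_num)
    have hy' := subset_convexHull ℝ (K.1 : Set Plane) hy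
    exact ⟨⟨y, (mem_space_iff_exists_triangle hT).2 ⟨K, hy'⟩⟩, hy'⟩
  choose b hb using hne
  refine ⟨fun K => g (b K) - value (b K) (p K), fun K K' y hy hy' => ?_⟩
  let y' : T.space := ⟨y, (mem_space_iff_exists_triangle hT).2 ⟨K, hy⟩⟩
  have h1 := hg K y' (b K) hy (hb K)
  have h2 := hg K' y' (b K') hy' (hb K')
  simp only [← h1, ← h2, y']
  ring

/-! ### The exact sequence -/

theorem eq_C_of_pderiv_eq_zero {p : Poly} (h : ∀ i, pderiv i p = 0) : p = C (coeff 0 p) := by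
  ext s
  rw [coeff_C]
  split_ifs with hs
  · rw [hs]
  · obtain ⟨i, hi⟩ := Finsupp.ne_iff.1 (Ne.symm hs)
    have h1 : s = (s - Finsupp.single i 1) + Finsupp.single i 1 := by
      refine Finsupp.ext fun j => ?_
      simp at hi
      rcases eq_or_ne j i with rfl | hj
      · simp; omega
      · simp [hj.symm]
    have h2 := congrArg (coeff (s - Finsupp.single i 1)) (h i)
    rw [coeff_pderiv, ← h1, coeff_zero, mul_eq_zero] at h2
    exact h2.resolve_right (by positivity)

theorem pderiv_sub_mem_vanishing {S : Set Plane} {s : ℕ} {p q : Poly}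
    (h : p - q ∈ vanishing S (s + 1)) (i : Fin 2) :
    pderiv i p - pderiv i q ∈ vanishing S s := by
  rw [← map_sub]
  exact h.2 i

/-- A derivative lowers by one both the degree and the order to which the jumps vanish. -/
theorem curl_mem_space (hT : IsTriangularGrid T Ω) {k r₁ r₂ : ℕ} (h12 : r₁ ≤ r₂) (h2 : 1 ≤ r₂)
    {u : Broken T} (hu : u ∈ space T k r₁ r₂) :
    curl T u ∈ (space T (k - 1) ((r₁ : ℤ) - 1) ((r₂ : ℤ) - 1)).prod
      (space T (k - 1) ((r₁ : ℤ) - 1) ((r₂ : ℤ) - 1)) := by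
  obtain ⟨hd, hv, he⟩ := (mem_space_iff hT (n₁ := r₁ + 1) (n₂ := r₂ + 1) (by push_cast; rfl)
    (by push_cast; rfl) (by omega) (by omega)).1 hu
  have key : ∀ i, (fun K => pderiv i (u K)) ∈ space T (k - 1) ((r₁ : ℤ) - 1) ((r₂ : ℤ) - 1) := by
    intro i
    rw [mem_space_iff hT (n₁ := r₁) (n₂ := r₂) (by ring) (by ring) h12 h2]
    exact ⟨fun K => pderiv_mem_restrictTotalDegree (hd K) i,
      fun x K K' hx hx' => pderiv_sub_mem_vanishing (hv x K K' hx hx') i,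
      fun a b K K' hab ha hb ha' hb' => pderiv_sub_mem_vanishing (he a b K K' hab ha hb ha' hb') i⟩
  exact ⟨key 1, Submodule.neg_mem _ (key 0)⟩

theorem div_mem_space (hT : IsTriangularGrid T Ω) {k r₁ r₂ : ℕ} (h1 : 1 ≤ r₁) (h12 : r₁ ≤ r₂)
    (h2 : 2 ≤ r₂) {v : Broken T × Broken T}
    (hv : v ∈ (space T (k - 1) ((r₁ : ℤ) - 1) ((r₂ : ℤ) - 1)).prod
      (space T (k - 1) ((r₁ : ℤ) - 1) ((r₂ : ℤ) - 1))) :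
    div T v ∈ space T (k - 2) ((r₁ : ℤ) - 2) ((r₂ : ℤ) - 2) := by
  obtain ⟨s₁, rfl⟩ : ∃ s, r₁ = s + 1 := ⟨r₁ - 1, by omega⟩
  obtain ⟨s₂, rfl⟩ : ∃ s, r₂ = s + 1 := ⟨r₂ - 1, by omega⟩
  have key : ∀ w ∈ space T (k - 1) (((s₁ + 1 : ℕ) : ℤ) - 1) (((s₂ + 1 : ℕ) : ℤ) - 1), ∀ i,
      (fun K => pderiv i (w K)) ∈
        space T (k - 2) (((s₁ + 1 : ℕ) : ℤ) - 2) (((s₂ + 1 : ℕ) : ℤ) - 2) := by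
    intro w hw i
    obtain ⟨hd, hv, he⟩ := (mem_space_iff hT (n₁ := s₁ + 1) (n₂ := s₂ + 1) (by ring) (by ring)
      h12 (by omega)).1 hw
    rw [mem_space_iff hT (n₁ := s₁) (n₂ := s₂) (by push_cast; ring) (by push_cast; ring)
      (by omega) (by omega)]
    exact ⟨fun K => pderiv_mem_restrictTotalDegree (hd K) i,
      fun x K K' hx hx' => pderiv_sub_mem_vanishing (hv x K K' hx hx') i,
      fun a b K K' hab ha hb ha' hb' => pderiv_sub_mem_vanishing (he a b K K' hab ha hb ha' hb') i⟩
  exact Submodule.add_mem _ (key _ hv.1 0) (key _ hv.2 1)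

theorem const_mem_space (hT : IsTriangularGrid T Ω) {k r₁ r₂ : ℕ} (h12 : r₁ ≤ r₂) (c : ℝ) :
    const T c ∈ space T k r₁ r₂ := by
  rw [mem_space_iff hT (n₁ := r₁ + 1) (n₂ := r₂ + 1) (by push_cast; rfl) (by push_cast; rfl)
    (by omega) (by omega)]
  refine ⟨fun K => C_mem_restrictTotalDegree _ _, fun x K K' _ _ => ?_,
    fun a b K K' _ _ _ _ _ => ?_⟩ <;>
  · change C c - C c ∈ _
    rw [sub_self]
    exact Submodule.zero_mem _

/-- A continuous function with finitely many values on a preconnected set is constant. -/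
theorem exists_const_eq (hT : IsTriangularGrid T Ω) (hΩ : IsPreconnected T.space) {k r₁ r₂ : ℕ}
    {u : Broken T} (hu : u ∈ space T k r₁ r₂) (h : curl T u = 0) : ∃ c, const T c = u := by
  have hC : ∀ K, u K = C (coeff 0 (u K)) := by
    intro K
    refine eq_C_of_pderiv_eq_zero fun i => ?_
    have h1 := congrFun (congrArg Prod.fst h) K
    have h0 := congrFun (congrArg Prod.snd h) K
    fin_cases i
    · exact neg_eq_zero.1 h0
    · exact h1
  obtain ⟨f, hf, hfu⟩ := hu.2.1 (by positivity)
  have hfu' : ∀ K : Triangle T, ∀ y ∈ convexHull ℝ (K.1 : Set Plane), f y = coeff 0 (u K) := by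
    intro K y hy
    rw [hfu K y hy, hC K, value_C, coeff_C, if_pos rfl]
  have := Triangle.finite hT
  have hmaps : Set.MapsTo f T.space (Set.range fun K => coeff 0 (u K)) := by
    intro y hy
    obtain ⟨K, hK⟩ := (mem_space_iff_exists_triangle hT).1 hy
    exact ⟨K, (hfu' K y hK).symm⟩
  have hvert : ∀ K : Triangle T, ∃ y ∈ T.space, f y = coeff 0 (u K) := by
    intro K
    obtain ⟨y, hy⟩ : K.1.Nonempty := Finset.card_pos.1 (by rw [K.2.2]; norm_num)
    have hy' := subset_convexHull ℝ (K.1 : Set Plane) hy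
    exact ⟨y, (mem_space_iff_exists_triangle hT).2 ⟨K, hy'⟩, hfu' K y hy'⟩
  rcases isEmpty_or_nonempty (Triangle T) with h' | ⟨⟨K₀⟩⟩
  · exact ⟨0, funext fun K => h'.elim K⟩
  · refine ⟨coeff 0 (u K₀), funext fun K => ?_⟩
    obtain ⟨y, hy, hy'⟩ := hvert K
    obtain ⟨y₀, hy₀, hy₀'⟩ := hvert K₀
    have e := hΩ.constant_of_mapsTo (Set.toFinite _).isDiscrete hf hmaps hy hy₀
    rw [hC K, ← hy', e, hy₀']
    rfl

/-- The potentials of the triangles are made single-valued by constants. Their jumps then vanish,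
and the derivatives of the jumps are, up to sign, jumps of `v`, so one order is gained. Since `r₁ ≥
1`, the components of `v` are continuous, which gives the single-valued gradients. -/
theorem exists_curl_eq_of_div_eq_zero (hT : IsTriangularGrid T Ω) [SimplyConnectedSpace T.space]
    {k r₁ r₂ : ℕ} (h1 : 1 ≤ r₁) (h12 : r₁ ≤ r₂) (hk : 1 ≤ k) {v : Broken T × Broken T}
    (hv : v ∈ (space T (k - 1) ((r₁ : ℤ) - 1) ((r₂ : ℤ) - 1)).prod
      (space T (k - 1) ((r₁ : ℤ) - 1) ((r₂ : ℤ) - 1))) (h : div T v = 0) :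
    ∃ u ∈ space T k r₁ r₂, curl T u = v := by
  have hs : ∀ {w : Broken T}, w ∈ space T (k - 1) ((r₁ : ℤ) - 1) ((r₂ : ℤ) - 1) ↔ _ :=
    mem_space_iff hT (n₁ := r₁) (n₂ := r₂) (by ring) (by ring) h12 (by omega)
  have single : ∀ w ∈ space T (k - 1) ((r₁ : ℤ) - 1) ((r₂ : ℤ) - 1), ∀ (K K' : Triangle T) (y : Plane),
      y ∈ convexHull ℝ (K.1 : Set Plane) → y ∈ convexHull ℝ (K'.1 : Set Plane) →
      value y (w K - w K') = 0 := by
    intro w hw K K' y hy hy'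
    obtain ⟨f, -, hf⟩ := hw.2.1 (by omega)
    rw [value_sub, ← hf K y hy, ← hf K' y hy', sub_self]
  obtain ⟨hd₁, hv₁, he₁⟩ := hs.1 hv.1
  obtain ⟨hd₂, hv₂, he₂⟩ := hs.1 hv.2
  choose p hp hp₁ hp₂ using fun K => exists_curl_eq (hd₁ K) (hd₂ K) (congrFun h K)
  rw [Nat.sub_add_cancel hk] at hp
  have hp₀ : ∀ K, pderiv 0 (p K) = -v.2 K := fun K => by rw [← hp₂, neg_neg]
  obtain ⟨c, hc⟩ := exists_constants hT (p := p) (fun K K' y hy hy' i => by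
    fin_cases i
    · have := single _ hv.2 K' K y hy' hy
      simp only [Fin.zero_eta]
      rw [map_sub, hp₀, hp₀, neg_sub_neg]
      exact this
    · simp only [Fin.mk_one]
      rw [map_sub, hp₁, hp₁]
      exact single _ hv.1 K K' y hy hy')
  have hjump : ∀ (S : Set Plane) (s : ℕ) (K K' : Triangle T), S ⊆ convexHull ℝ (K.1 : Set Plane) →
      S ⊆ convexHull ℝ (K'.1 : Set Plane) → v.1 K - v.1 K' ∈ vanishing S s →
      v.2 K - v.2 K' ∈ vanishing S s →
      (p K + C (c K)) - (p K' + C (c K')) ∈ vanishing S (s + 1) := by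
    intro S s K K' hS hS' h1 h2
    refine ⟨fun y hy => ?_, fun i => ?_⟩
    · rw [value_sub, value_add, value_add, value_C, value_C, hc K K' y (hS hy) (hS' hy), sub_self]
    · fin_cases i
      · simp only [Fin.zero_eta]
        rw [map_sub, map_add, map_add, pderiv_C, pderiv_C, add_zero, add_zero, hp₀, hp₀,
          neg_sub_neg, ← neg_sub]
        exact Submodule.neg_mem _ h2
      · simp only [Fin.mk_one]
        rw [map_sub, map_add, map_add, pderiv_C, pderiv_C, add_zero, add_zero, hp₁, hp₁]
        exact h1
  refine ⟨fun K => p K + C (c K), ?_, ?_⟩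
  · rw [mem_space_iff hT (n₁ := r₁ + 1) (n₂ := r₂ + 1) (by push_cast; rfl) (by push_cast; rfl)
      (by omega) (by omega)]
    refine ⟨fun K => Submodule.add_mem _ (hp K) (C_mem_restrictTotalDegree _ _),
      fun x K K' hx hx' => ?_, fun a b K K' hab ha hb ha' hb' => ?_⟩
    · exact hjump _ _ K K' (Set.singleton_subset_iff.2 (subset_convexHull ℝ _ hx))
        (Set.singleton_subset_iff.2 (subset_convexHull ℝ _ hx')) (hv₁ x K K' hx hx')
        (hv₂ x K K' hx hx')
    · exact hjump _ _ K K' (segment_subset_triangle ha hb) (segment_subset_triangle ha' hb')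
        (he₁ a b K K' hab ha hb ha' hb') (he₂ a b K K' hab ha hb ha' hb')
  · refine Prod.ext (funext fun K => ?_) (funext fun K => ?_)
    · change pderiv 1 (p K + C (c K)) = _
      rw [map_add, pderiv_C, add_zero, hp₁]
    · change -pderiv 0 (p K + C (c K)) = _
      rw [map_add, pderiv_C, add_zero, hp₂]

theorem div_surjective (hT : IsTriangularGrid T Ω) {k r₁ r₂ : ℕ} (h1 : 1 ≤ r₁)
    (h12 : 2 * r₁ ≤ r₂) (hk : 2 * r₂ + 1 ≤ k) {q : Broken T}
    (hq : q ∈ space T (k - 2) ((r₁ : ℤ) - 2) ((r₂ : ℤ) - 2)) :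
    ∃ v ∈ (space T (k - 1) ((r₁ : ℤ) - 1) ((r₂ : ℤ) - 1)).prod
      (space T (k - 1) ((r₁ : ℤ) - 1) ((r₂ : ℤ) - 1)), div T v = q := by
  -- For `r₁ = 1` the edge order is zero: `q` may be discontinuous across edges, in accordance with
  -- the index `-1`.
  obtain ⟨hd, hv, he⟩ := (mem_space_iff hT (n₁ := r₁ - 1) (n₂ := r₂ - 1) (by omega) (by omega)
    (by omega) (by omega)).1 hq
  obtain ⟨v, hvd, hvq, hvv, hve⟩ := exists_div_eq hT h1 h12 (by omega) hd hv he
  rw [show k - 2 + 1 = k - 1 by omega] at hvd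
  refine ⟨(fun K => (v K).1, fun K => (v K).2), ⟨?_, ?_⟩, funext hvq⟩
  · rw [SetLike.mem_coe, mem_space_iff hT (n₁ := r₁) (n₂ := r₂) (by ring) (by ring) (by omega)
      (by omega)]
    exact ⟨fun K => (hvd K).1, fun x K K' hx hx' => (hvv x K K' hx hx').1,
      fun a b K K' hab ha hb ha' hb' => (hve a b K K' hab ha hb ha' hb').1⟩
  · rw [SetLike.mem_coe, mem_space_iff hT (n₁ := r₁) (n₂ := r₂) (by ring) (by ring) (by omega)
      (by omega)]
    exact ⟨fun K => (hvd K).2, fun x K K' hx hx' => (hvv x K K' hx hx').2,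
      fun a b K K' hab ha hb ha' hb' => (hve a b K K' hab ha hb ha' hb').2⟩

theorem div_curl (u : Broken T) : div T (curl T u) = 0 := by
  funext K
  change pderiv 0 (pderiv 1 (u K)) + pderiv 1 (-pderiv 0 (u K)) = 0
  rw [map_neg, pderiv_comm 0 1, add_neg_cancel]

theorem curl_const (c : ℝ) : curl T (const T c) = 0 := by
  refine Prod.ext (funext fun K => ?_) (funext fun K => ?_)
  · exact pderiv_C
  · change -pderiv 0 (C c) = 0
    rw [pderiv_C, neg_zero]

end

end SmoothFE

theorem mainTheorem3
    (Ω : Set SmoothFE.Plane) (hΩ : SimplyConnectedSpace Ω)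
    (T : Geometry.SimplicialComplex ℝ SmoothFE.Plane) (hT : SmoothFE.IsTriangularGrid T Ω)
    (r₁ r₂ k : ℕ) (hr₁ : 1 ≤ r₁) (hr₂ : 2 * r₁ ≤ r₂) (hk : 2 * r₂ + 1 ≤ k) :
    ∃ (h₀ : ∀ c : ℝ, SmoothFE.const T c ∈ SmoothFE.space T k r₁ r₂)
      (h₁ : ∀ u ∈ SmoothFE.space T k r₁ r₂, SmoothFE.curl T u ∈
        (SmoothFE.space T (k - 1) ((r₁ : ℤ) - 1) ((r₂ : ℤ) - 1)).prod
          (SmoothFE.space T (k - 1) ((r₁ : ℤ) - 1) ((r₂ : ℤ) - 1)))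
      (h₂ : ∀ v ∈ (SmoothFE.space T (k - 1) ((r₁ : ℤ) - 1) ((r₂ : ℤ) - 1)).prod
          (SmoothFE.space T (k - 1) ((r₁ : ℤ) - 1) ((r₂ : ℤ) - 1)),
        SmoothFE.div T v ∈ SmoothFE.space T (k - 2) ((r₁ : ℤ) - 2) ((r₂ : ℤ) - 2)),
      Function.Injective ((SmoothFE.const T).codRestrict (SmoothFE.space T k r₁ r₂) h₀) ∧
      Function.Exact ((SmoothFE.const T).codRestrict (SmoothFE.space T k r₁ r₂) h₀)
        ((SmoothFE.curl T).restrict h₁) ∧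
      Function.Exact ((SmoothFE.curl T).restrict h₁) ((SmoothFE.div T).restrict h₂) ∧
      Function.Surjective ((SmoothFE.div T).restrict h₂) := by
  obtain rfl := hT.cover
  refine ⟨fun c => SmoothFE.const_mem_space hT (by omega) c,
    fun u hu => SmoothFE.curl_mem_space hT (by omega) (by omega) hu,
    fun v hv => SmoothFE.div_mem_space hT hr₁ (by omega) (by omega) hv, ?_, ?_, ?_, ?_⟩
  · intro c d hcd
    -- Constants are determined by their values on a triangle, and the non-empty region provides
    -- one.
    obtain ⟨y⟩ : Nonempty T.space := (inferInstance : PathConnectedSpace T.space).nonempty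
    obtain ⟨K, -⟩ := (SmoothFE.mem_space_iff_exists_triangle hT).1 y.2
    exact MvPolynomial.C_injective _ _ (congrFun (congrArg Subtype.val hcd) K)
  · rintro ⟨u, hu⟩
    constructor
    · intro h
      have hpre : IsPreconnected T.space := isPreconnected_iff_preconnectedSpace.2 inferInstance
      obtain ⟨c, hc⟩ := SmoothFE.exists_const_eq hT hpre hu (congrArg Subtype.val h)
      exact ⟨c, Subtype.ext hc⟩
    · rintro ⟨c, hc⟩
      refine Subtype.ext ?_
      rw [← hc]
      exact SmoothFE.curl_const c
  · rintro ⟨v, hv⟩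
    constructor
    · intro h
      obtain ⟨u, hu, huv⟩ := SmoothFE.exists_curl_eq_of_div_eq_zero hT hr₁ (by omega) (by omega) hv
        (congrArg Subtype.val h)
      exact ⟨⟨u, hu⟩, Subtype.ext huv⟩
    · rintro ⟨u, hu⟩
      refine Subtype.ext ?_
      rw [← hu]
      exact SmoothFE.div_curl u.1
  · rintro ⟨q, hq⟩
    obtain ⟨v, hv, hvq⟩ := SmoothFE.div_surjective hT hr₁ hr₂ hk hq
    exact ⟨⟨v, hv⟩, Subtype.ext hvq⟩
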